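/- **Setting.** Let an alphabet of $n\ge 2$ characters with frequencies $f(c)\ge 0$ be given. A *prefix tree* $T$ is a binary tree in which every internal node has exactly two children and whose leaves correspond one-to-one to the characters; $d_T(c)$ is the depth of the leaf of $c$ (the root has depth $0$), and the *code length* of $T$ is $\mathrm{len}(T)=\sum_c f(c)\,d_T(c)$. A *blocking scheme* is a finite sequence $\langle (w_1,q_1),\dots,(w_m,q_m)\rangle$ of widths $w_j\in\{1,2,\dots\}$ and access costs $q_j\ge 0$; its *number of memory hierarchies* is $k=1+|\{i\in[2,m]: q_i\neq q_{i-1}\}|$. The block level of $c$ in $T$ is the least $h$ with $\sum_{j\le h}w_j\ge d_T(c)$; only trees of height at most $\sum_{j\le m}w_j$ are admitted, so that it exists. The *decode time* of $T$ is $\Delta(T)=\sum_c f(c)\sum_{j\le h(c)}q_j$, where $h(c)$ is the block level of $c$. For a permitted code length $\mathcal L$, let $\mathrm{DOPT}(\mathcal L)$ be the minimum of $\Delta(T)$ over all admitted prefix trees $T$ with $\mathrm{len}(T)\le\mathcal L$. **Theorem 3.** There is an algorithm (a fixed real-RAM program with unit-cost operations and no rounding operation) which, given the frequencies, a blocking scheme,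 a real number $\mathcal L$, and real numbers $\varepsilon,\delta>0$, always halts and, whenever some admitted prefix tree has code length at most $\mathcal L$, returns (as a linked structure in memory) an admitted prefix tree $T$ with $$\mathrm{len}(T)\le(1+\varepsilon)(1+\delta)\,\mathcal L\qquad\text{and}\qquad \Delta(T)\le(1+\delta)\,\mathrm{DOPT}(\mathcal L).$$ Its running time is $$O\!\left(\frac{n^2k^2\log^2 n}{\varepsilon\,\delta^2}\right),$$ where $\varepsilon$ and $\delta$ are assumed to be bounded from above by an arbitrary fixed constant, on which alone the implied constant depends. In particular, when the number $k$ of memory hierarchies is a constant, the running time is $O\!\left(\frac{n^2\log^2 n}{\varepsilon\,\delta^2}\right)$. -/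

import Mathlib

/-! ### Prefix trees

A prefix tree is a binary tree all of whose internal nodes have exactly two children, and whose
leaves correspond one-to-one to the characters of the alphabet. -/

/-- Full binary trees whose leaves carry a label in `α`. -/
inductive CodeTree (α : Type) : Type
  | leaf (c : α) : CodeTree α
  | node (l r : CodeTree α) : CodeTree α

namespace CodeTree

variable {α : Type}

/-- The labels of the leaves, from left to right. -/
def leaves : CodeTree α → List α
  | leaf c => [c]
  | node l r => l.leaves ++ r.leaves

/-- Every character labels exactly one leaf. -/
def IsPrefixTree (T : CodeTree α) : Prop :=
  T.leaves.Nodup ∧ ∀ c : α, c ∈ T.leaves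

/-- The depth of the leaf labelled `c`, the root having depth `0`
(only used for trees in which `c` labels exactly one leaf). -/
def depth [DecidableEq α] : CodeTree α → α → ℕ
  | leaf _, _ => 0
  | node l r, c => if c ∈ l.leaves then l.depth c + 1 else r.depth c + 1

/-- The code length `∑_c f(c) · d_T(c)`. -/
noncomputable def len [DecidableEq α] [Fintype α] (f : α → ℝ) (T : CodeTree α) : ℝ :=
  ∑ c, f c * (T.depth c : ℝ)

end CodeTree

/-! ### Blocking schemes -/

/-- A blocking scheme of `m` block levels `<(w₁,q₁), …, (w_m,q_m)>`; here block level `j + 1` of the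
text is the index `j : Fin m`. Widths are positive numbers of bits, access costs are nonnegative. -/
structure BlockingScheme where
  m : ℕ
  w : Fin m → ℕ
  q : Fin m → ℝ
  w_pos : ∀ j, 0 < w j
  q_nonneg : ∀ j, 0 ≤ q j

namespace BlockingScheme

variable (BS : BlockingScheme)

/-- Number of memory hierarchies: one plus the number of changes of the access cost. -/
noncomputable def hierarchies : ℕ :=
  1 + Set.ncard {i : Fin BS.m | ∃ j : Fin BS.m, (j : ℕ) + 1 = (i : ℕ) ∧ BS.q i ≠ BS.q j}

/-- Total width of the first `h` block levels. -/
def width (h : ℕ) : ℕ := ∑ j : Fin BS.m, if (j : ℕ) < h then BS.w j else 0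

/-- Total cost of one access to each of the first `h` block levels. -/
noncomputable def accessCost (h : ℕ) : ℝ := ∑ j : Fin BS.m, if (j : ℕ) < h then BS.q j else 0

/-- The block level of depth `d`: the least `h` with `w₁ + ⋯ + w_h ≥ d`
(meaningful when `d` is at most the total width of the scheme). -/
noncomputable def blockLevel (d : ℕ) : ℕ := sInf {h : ℕ | d ≤ BS.width h}

variable {α : Type} [DecidableEq α]

/-- Every character of the tree lies in some block level of the scheme, i.e. its cost is defined. -/
def Fits (T : CodeTree α) : Prop := ∀ c : α, T.depth c ≤ BS.width BS.m

/-- The cost of decoding the character `c`. -/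
noncomputable def charCost (T : CodeTree α) (c : α) : ℝ :=
  BS.accessCost (BS.blockLevel (T.depth c))

/-- The decode time of the tree. -/
noncomputable def decodeTime [Fintype α] (f : α → ℝ) (T : CodeTree α) : ℝ :=
  ∑ c, f c * BS.charCost T c

/-- `v` is the minimum decode time among the prefix trees (decodable with the blocking scheme)
whose code length is at most `L`. -/
def IsDOPT [Fintype α] (f : α → ℝ) (L v : ℝ) : Prop :=
  IsLeast {x : ℝ | ∃ T : CodeTree α, T.IsPrefixTree ∧ BS.Fits T ∧ T.len f ≤ L ∧
    BS.decodeTime f T = x} v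

end BlockingScheme

/-! ### The machine model

A real RAM, programmed in a structured language. The store has integer registers and integer arrays,
real registers and real arrays (arrays have unbounded length and are addressed by integers). Integers
can be added, subtracted (truncated at zero) and compared; reals can be added, subtracted, multiplied,
divided (with `x / 0 = 0`) and compared; an integer can be used as a real, but there is no operation
that takes a real to an integer (no rounding). Every operation, constant, register access, array
access, assignment, test and branching takes one time unit. -/

namespace RealRAM

/-- Contents of the registers and of the arrays. -/
structure Store where
  nat : ℕ → ℕ
  real : ℕ → ℝ
  natArr : ℕ → ℕ → ℕ
  realArr : ℕ → ℕ → ℝ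

/-- Integer expressions. -/
inductive NExp : Type
  | lit (c : ℕ)
  | reg (x : ℕ)
  | get (a : ℕ) (i : NExp)
  | add (e f : NExp)
  | sub (e f : NExp)

/-- Value of an integer expression. -/
def NExp.eval (s : Store) : NExp → ℕ
  | lit c => c
  | reg x => s.nat x
  | get a i => s.natArr a (i.eval s)
  | add e f => e.eval s + f.eval s
  | sub e f => e.eval s - f.eval s

/-- Number of operations in an integer expression. -/
def NExp.cost : NExp → ℕ
  | lit _ => 1
  | reg _ => 1
  | get _ i => i.cost + 1
  | add e f => e.cost + f.cost + 1
  | sub e f => e.cost + f.cost + 1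

/-- Real expressions. -/
inductive RExp : Type
  | lit (c : ℕ)
  | ofNat (e : NExp)
  | reg (x : ℕ)
  | get (a : ℕ) (i : NExp)
  | add (e f : RExp)
  | sub (e f : RExp)
  | mul (e f : RExp)
  | div (e f : RExp)

/-- Value of a real expression. -/
noncomputable def RExp.eval (s : Store) : RExp → ℝ
  | lit c => (c : ℝ)
  | ofNat e => (e.eval s : ℝ)
  | reg x => s.real x
  | get a i => s.realArr a (i.eval s)
  | add e f => e.eval s + f.eval s
  | sub e f => e.eval s - f.eval s
  | mul e f => e.eval s * f.eval s
  | div e f => e.eval s / f.eval s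

/-- Number of operations in a real expression. -/
def RExp.cost : RExp → ℕ
  | lit _ => 1
  | ofNat e => e.cost + 1
  | reg _ => 1
  | get _ i => i.cost + 1
  | add e f => e.cost + f.cost + 1
  | sub e f => e.cost + f.cost + 1
  | mul e f => e.cost + f.cost + 1
  | div e f => e.cost + f.cost + 1

/-- Comparisons. -/
inductive Test : Type
  | natLt (e f : NExp)
  | realLt (e f : RExp)

/-- The comparison succeeds in the given store. -/
def Test.Holds (s : Store) : Test → Prop
  | natLt e f => e.eval s < f.eval s
  | realLt e f => e.eval s < f.eval s

/-- Number of operations in a comparison. -/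
def Test.cost : Test → ℕ
  | natLt e f => e.cost + f.cost + 1
  | realLt e f => e.cost + f.cost + 1

/-- Programs. -/
inductive Program : Type
  | skip
  | setNat (x : ℕ) (e : NExp)
  | putNat (a : ℕ) (i e : NExp)
  | setReal (x : ℕ) (e : RExp)
  | putReal (a : ℕ) (i : NExp) (e : RExp)
  | seq (p p' : Program)
  | ite (b : Test) (p p' : Program)
  | loop (b : Test) (p : Program)

/-- `Runs p s t s'`: started in the store `s`, the program `p` halts after exactly `t` time units
with the store `s'`. (`loop b p` is `while b do p`.) -/
inductive Runs : Program → Store → ℕ → Store → Prop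
  | skip (s : Store) : Runs .skip s 1 s
  | setNat (s : Store) (x : ℕ) (e : NExp) :
      Runs (.setNat x e) s (e.cost + 1) { s with nat := Function.update s.nat x (e.eval s) }
  | putNat (s : Store) (a : ℕ) (i e : NExp) :
      Runs (.putNat a i e) s (i.cost + e.cost + 1)
        { s with
          natArr := Function.update s.natArr a (Function.update (s.natArr a) (i.eval s) (e.eval s)) }
  | setReal (s : Store) (x : ℕ) (e : RExp) :
      Runs (.setReal x e) s (e.cost + 1) { s with real := Function.update s.real x (e.eval s) }
  | putReal (s : Store) (a : ℕ) (i : NExp) (e : RExp) :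
      Runs (.putReal a i e) s (i.cost + e.cost + 1)
        { s with
          realArr := Function.update s.realArr a (Function.update (s.realArr a) (i.eval s) (e.eval s)) }
  | seq {p p' : Program} {s s' s'' : Store} {t t' : ℕ} :
      Runs p s t s' → Runs p' s' t' s'' → Runs (.seq p p') s (t + t') s''
  | ite_true {b : Test} {p p' : Program} {s s' : Store} {t : ℕ} :
      b.Holds s → Runs p s t s' → Runs (.ite b p p') s (b.cost + 1 + t) s'
  | ite_false {b : Test} {p p' : Program} {s s' : Store} {t : ℕ} :
      ¬ b.Holds s → Runs p' s t s' → Runs (.ite b p p') s (b.cost + 1 + t) s'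
  | loop_true {b : Test} {p : Program} {s s' s'' : Store} {t t' : ℕ} :
      b.Holds s → Runs p s t s' → Runs (.loop b p) s' t' s'' →
        Runs (.loop b p) s (b.cost + 1 + t + t') s''
  | loop_false {b : Test} {p : Program} {s : Store} :
      ¬ b.Holds s → Runs (.loop b p) s (b.cost + 1) s

/-- The store holds the tree `T` as a linked structure whose root is the cell `p`: the integer array
`1` holds `0` at an internal node and `c + 1` at a leaf labelled `c`; the integer arrays `2` and `3`
hold the addresses of the left and of the right child of an internal node. -/
def Store.HoldsTree (s : Store) {n : ℕ} : ℕ → CodeTree (Fin n) → Prop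
  | p, .leaf c => s.natArr 1 p = (c : ℕ) + 1
  | p, .node l r => s.natArr 1 p = 0 ∧ s.HoldsTree (s.natArr 2 p) l ∧ s.HoldsTree (s.natArr 3 p) r

end RealRAM

/-! ### Inputs -/

/-- An input: the frequencies of the `n` characters, a blocking scheme, the permitted code length,
and the approximation parameters. -/
structure DecodeInput where
  n : ℕ
  two_le_n : 2 ≤ n
  freq : Fin n → ℝ
  freq_nonneg : ∀ c, 0 ≤ freq c
  BS : BlockingScheme
  L : ℝ
  ε : ℝ
  δ : ℝ
  ε_pos : 0 < ε
  δ_pos : 0 < δ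

/-- The store in which a program is started: integer registers `0, 1` hold `n, m`; real registers
`0, 1, 2` hold the permitted code length, `ε` and `δ`; the real array `0` holds the frequencies, the
integer array `0` the widths and the real array `1` the access costs; all other cells are zero. -/
noncomputable def DecodeInput.initial (I : DecodeInput) : RealRAM.Store where
  nat x := if x = 0 then I.n else if x = 1 then I.BS.m else 0
  real x := if x = 0 then I.L else if x = 1 then I.ε else if x = 2 then I.δ else 0
  natArr a i := if a = 0 then (if h : i < I.BS.m then I.BS.w ⟨i, h⟩ else 0) else 0
  realArr a i :=
    if a = 0 then (if h : i < I.n then I.freq ⟨i, h⟩ else 0)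
    else if a = 1 then (if h : i < I.BS.m then I.BS.q ⟨i, h⟩ else 0) else 0

/-! Code length and decode time are both of the form `∑ f c * Q (depth c)` with `Q` monotone: the
identity for the length, `depthCost` for the decode time. Only the depths of the leaves matter, and
the proof works with depth sequences satisfying the Kraft inequality.

Truncation (`exists_truncation`). Cut the depths into windows of `W = ⌈log₂ n⌉ + 1` levels. Push the
leaves of one window down by one level and lift everything below it to its bottom. The pushed-down
part frees half of its Kraft mass, which is enough for up to `n` leaves at the bottom
(`kraft_truncateDepth`). Only characters of the chosen window become more expensive. Their code
length at most doubles, and so does their decode time unless the next level costs more than all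
levels above it together. Such a bad level starts a new memory hierarchy, so there are at most `k`
of them. Among `⌈2/δ⌉` windows without bad levels, fewer than `1/δ` carry more than a fraction `δ`
of the length, and fewer than `1/δ` more than a fraction `δ` of the decode time; some window is
light in both senses. Hence height `H = O(k log n / δ)` suffices, at the price of a factor `1 + δ`
in both quantities.

Dynamic program (`dpTable`). By rearrangement, frequent characters may be taken to lie higher. A
tree is then built level by level: of `b` available nodes, either one becomes the leaf of the most
frequent remaining character, or all are split. A split moves the `g` remaining characters one level
down; it adds their total frequency to the code length, and that frequency times the increment of
`depthCost` to the decode time. The table minimises the decode time exactly, while code length is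
spent from a budget of `V = ⌈(H+1)/ε⌉` units, each split being rounded down. Rounding down keeps the
truncated optimum feasible (`dpTable_le_of_kraft`). A path has at most `H` splits and loses less
than one further unit through the ceiling in `V`, so the true length exceeds `(1+δ)L` by at most `H
+ 1` units, that is by `ε(1+δ)L` (`buildLoop_ends`, `solved_of_forest`).

The table has `O(H n² V)` entries, each computed in constant time, which is the claimed running
time; all other phases are cheaper. The remaining work verifies a concrete program in a small
program logic (`Frame`, `Ends`). -/

namespace RealRAM

/-! ### Program logic: frames and running time bounds -/

namespace Program

/-- The program never assigns to the integer register `x`. -/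
def keepsNat (x : ℕ) : Program → Bool
  | setNat y _ => !(x == y)
  | seq p p' => p.keepsNat x && p'.keepsNat x
  | ite _ p p' => p.keepsNat x && p'.keepsNat x
  | loop _ p => p.keepsNat x
  | _ => true

/-- The program never assigns to the real register `x`. -/
def keepsReal (x : ℕ) : Program → Bool
  | setReal y _ => !(x == y)
  | seq p p' => p.keepsReal x && p'.keepsReal x
  | ite _ p p' => p.keepsReal x && p'.keepsReal x
  | loop _ p => p.keepsReal x
  | _ => true

/-- The program never assigns to the integer array `x`. -/
def keepsNatArr (x : ℕ) : Program → Bool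
  | putNat y _ _ => !(x == y)
  | seq p p' => p.keepsNatArr x && p'.keepsNatArr x
  | ite _ p p' => p.keepsNatArr x && p'.keepsNatArr x
  | loop _ p => p.keepsNatArr x
  | _ => true

/-- The program never assigns to the real array `x`. -/
def keepsRealArr (x : ℕ) : Program → Bool
  | putReal y _ _ => !(x == y)
  | seq p p' => p.keepsRealArr x && p'.keepsRealArr x
  | ite _ p p' => p.keepsRealArr x && p'.keepsRealArr x
  | loop _ p => p.keepsRealArr x
  | _ => true

/-- The program contains no loop. -/
def straight : Program → Bool
  | seq p p' => p.straight && p'.straight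
  | ite _ p p' => p.straight && p'.straight
  | loop _ _ => false
  | _ => true

/-- The number of operations in the text of a program. -/
def size : Program → ℕ
  | skip => 1
  | setNat _ e => e.cost + 1
  | putNat _ i e => i.cost + e.cost + 1
  | setReal _ e => e.cost + 1
  | putReal _ i e => i.cost + e.cost + 1
  | seq p p' => p.size + p'.size
  | ite b p p' => b.cost + 1 + (p.size + p'.size)
  | loop b p => b.cost + 1 + p.size

open Classical in
/-- The final store of a loop-free program. -/
noncomputable def effect : Program → Store → Store
  | skip, s => s
  | setNat x e, s => { s with nat := Function.update s.nat x (e.eval s) }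
  | putNat a i e, s =>
      { s with
        natArr := Function.update s.natArr a (Function.update (s.natArr a) (i.eval s) (e.eval s)) }
  | setReal x e, s => { s with real := Function.update s.real x (e.eval s) }
  | putReal a i e, s =>
      { s with
        realArr := Function.update s.realArr a
          (Function.update (s.realArr a) (i.eval s) (e.eval s)) }
  | seq p p', s => p'.effect (p.effect s)
  | ite b p p', s => if b.Holds s then p.effect s else p'.effect s
  | loop _ _, s => s

end Program

/-- `s'` agrees with `s` on everything that `p` never assigns to. -/
structure Frame (p : Program) (s s' : Store) : Prop where
  nat : ∀ x, p.keepsNat x = true → s'.nat x = s.nat x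
  real : ∀ x, p.keepsReal x = true → s'.real x = s.real x
  natArr : ∀ a, p.keepsNatArr a = true → s'.natArr a = s.natArr a
  realArr : ∀ a, p.keepsRealArr a = true → s'.realArr a = s.realArr a

theorem Frame.refl (p : Program) (s : Store) : Frame p s s :=
  ⟨fun _ _ => rfl, fun _ _ => rfl, fun _ _ => rfl, fun _ _ => rfl⟩

theorem Frame.trans {p : Program} {s s' s'' : Store} (h : Frame p s s') (h' : Frame p s' s'') :
    Frame p s s'' :=
  ⟨fun x hx => (h'.nat x hx).trans (h.nat x hx), fun x hx => (h'.real x hx).trans (h.real x hx),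
    fun x hx => (h'.natArr x hx).trans (h.natArr x hx),
    fun x hx => (h'.realArr x hx).trans (h.realArr x hx)⟩

theorem Frame.mono {p p' : Program} {s s' : Store} (h : Frame p s s')
    (h1 : ∀ x, p'.keepsNat x = true → p.keepsNat x = true)
    (h2 : ∀ x, p'.keepsReal x = true → p.keepsReal x = true)
    (h3 : ∀ x, p'.keepsNatArr x = true → p.keepsNatArr x = true)
    (h4 : ∀ x, p'.keepsRealArr x = true → p.keepsRealArr x = true) : Frame p' s s' :=
  ⟨fun x hx => h.nat x (h1 x hx), fun x hx => h.real x (h2 x hx),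
    fun x hx => h.natArr x (h3 x hx), fun x hx => h.realArr x (h4 x hx)⟩

/-- The `keeps` predicates are Boolean functions of the program text, so for a concrete program each
use of a frame is discharged by `rfl`. -/
theorem Runs.frame {p : Program} {s s' : Store} {t : ℕ} (h : Runs p s t s') : Frame p s s' := by
  induction h with
  | skip s => exact Frame.refl _ _
  | setNat s x e =>
    refine ⟨fun y hy => ?_, fun _ _ => rfl, fun _ _ => rfl, fun _ _ => rfl⟩
    exact Function.update_of_ne (by simpa [Program.keepsNat] using hy) _ _
  | putNat s a i e =>
    refine ⟨fun _ _ => rfl, fun _ _ => rfl, fun y hy => ?_, fun _ _ => rfl⟩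
    exact Function.update_of_ne (by simpa [Program.keepsNatArr] using hy) _ _
  | setReal s x e =>
    refine ⟨fun _ _ => rfl, fun y hy => ?_, fun _ _ => rfl, fun _ _ => rfl⟩
    exact Function.update_of_ne (by simpa [Program.keepsReal] using hy) _ _
  | putReal s a i e =>
    refine ⟨fun _ _ => rfl, fun _ _ => rfl, fun _ _ => rfl, fun y hy => ?_⟩
    exact Function.update_of_ne (by simpa [Program.keepsRealArr] using hy) _ _
  | seq _ _ ih ih' =>
    refine Frame.trans (ih.mono ?_ ?_ ?_ ?_) (ih'.mono ?_ ?_ ?_ ?_) <;> intro x hx <;>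
      simp_all [Program.keepsNat, Program.keepsNatArr, Program.keepsReal, Program.keepsRealArr]
  | ite_true _ _ ih =>
    refine ih.mono ?_ ?_ ?_ ?_ <;> intro x hx <;>
      simp_all [Program.keepsNat, Program.keepsNatArr, Program.keepsReal, Program.keepsRealArr]
  | ite_false _ _ ih =>
    refine ih.mono ?_ ?_ ?_ ?_ <;> intro x hx <;>
      simp_all [Program.keepsNat, Program.keepsNatArr, Program.keepsReal, Program.keepsRealArr]
  | loop_true _ _ _ ih ih' =>
    exact Frame.trans (ih.mono (fun _ h => h) (fun _ h => h) (fun _ h => h) (fun _ h => h)) ih'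
  | loop_false _ => exact Frame.refl _ _

/-- Started in `s`, the program halts in a store with the property `Q`, after having executed every
operation in its text at most `X` times on average. -/
def Ends (p : Program) (s : Store) (X : ℕ) (Q : Store → Prop) : Prop :=
  ∃ t s', Runs p s t s' ∧ t ≤ p.size * X ∧ Q s'

theorem Ends.withFrame {p : Program} {s : Store} {X : ℕ} {Q : Store → Prop} (h : Ends p s X Q) :
    Ends p s X (fun s' => Frame p s s' ∧ Q s') := by
  obtain ⟨t, s', hr, ht, hQ⟩ := h
  exact ⟨t, s', hr, ht, hr.frame, hQ⟩

theorem Ends.mono {p : Program} {s : Store} {X X' : ℕ} {Q Q' : Store → Prop} (h : Ends p s X Q)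
    (hX : X ≤ X') (hQ : ∀ s', Q s' → Q' s') : Ends p s X' Q' := by
  obtain ⟨t, s', hr, ht, hQ'⟩ := h
  exact ⟨t, s', hr, ht.trans (Nat.mul_le_mul_left _ hX), hQ _ hQ'⟩

/-- Sizes add under composition while `X` stays the same. This confines all constant factors to the
size of the program, and only iteration counts have to be estimated. -/
theorem Ends.seq {p p' : Program} {s : Store} {X : ℕ} {Q : Store → Prop} (R : Store → Prop)
    (h : Ends p s X R) (h' : ∀ s', Frame p s s' → R s' → Ends p' s' X Q) :
    Ends (.seq p p') s X Q := by
  obtain ⟨t, s', hr, ht, hR⟩ := h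
  obtain ⟨t', s'', hr', ht', hQ⟩ := h' s' hr.frame hR
  exact ⟨t + t', s'', .seq hr hr', by rw [Program.size, Nat.add_mul]; omega, hQ⟩

theorem Ends.ite {b : Test} {p p' : Program} {s : Store} {X : ℕ} {Q : Store → Prop} (hX : 1 ≤ X)
    (h : b.Holds s → Ends p s X Q) (h' : ¬ b.Holds s → Ends p' s X Q) :
    Ends (.ite b p p') s X Q := by
  have hb : b.cost + 1 ≤ (b.cost + 1) * X := Nat.le_mul_of_pos_right _ hX
  have hs : (Program.ite b p p').size * X = (b.cost + 1) * X + (p.size * X + p'.size * X) := by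
    rw [Program.size, Nat.add_mul, Nat.add_mul p.size]
  by_cases hb' : b.Holds s
  · obtain ⟨t, s', hr, ht, hQ⟩ := h hb'
    exact ⟨_, s', .ite_true hb' hr, by omega, hQ⟩
  · obtain ⟨t, s', hr, ht, hQ⟩ := h' hb'
    exact ⟨_, s', .ite_false hb' hr, by omega, hQ⟩

theorem Program.runs_effect {p : Program} (hp : p.straight = true) (s : Store) :
    ∃ t, Runs p s t (p.effect s) ∧ t ≤ p.size := by
  induction p generalizing s with
  | skip => exact ⟨_, .skip s, le_rfl⟩
  | setNat x e => exact ⟨_, .setNat s x e, le_rfl⟩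
  | putNat a i e => exact ⟨_, .putNat s a i e, le_rfl⟩
  | setReal x e => exact ⟨_, .setReal s x e, le_rfl⟩
  | putReal a i e => exact ⟨_, .putReal s a i e, le_rfl⟩
  | seq p p' ih ih' =>
    simp only [straight, Bool.and_eq_true] at hp
    obtain ⟨t, h, ht⟩ := ih hp.1 s
    obtain ⟨t', h', ht'⟩ := ih' hp.2 (p.effect s)
    exact ⟨_, .seq h h', by simp only [size]; omega⟩
  | ite b p p' ih ih' =>
    simp only [straight, Bool.and_eq_true] at hp
    by_cases hb : b.Holds s
    · obtain ⟨t, h, ht⟩ := ih hp.1 s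
      refine ⟨b.cost + 1 + t, ?_, by simp only [size]; omega⟩
      simp only [effect, hb, if_true]
      exact .ite_true hb h
    · obtain ⟨t, h, ht⟩ := ih' hp.2 s
      refine ⟨b.cost + 1 + t, ?_, by simp only [size]; omega⟩
      simp only [effect, hb, if_false]
      exact .ite_false hb h
  | loop b p _ => simp [straight] at hp

theorem Ends.straight {p : Program} (hp : p.straight = true) {s : Store} {X : ℕ} (hX : 1 ≤ X)
    {Q : Store → Prop} (h : Q (p.effect s)) : Ends p s X Q := by
  obtain ⟨t, hr, ht⟩ := Program.runs_effect hp s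
  exact ⟨t, _, hr, ht.trans (Nat.le_mul_of_pos_right _ hX), h⟩

/-- Loop-free programs in front of other programs. -/
theorem Ends.straight_seq {p p' : Program} (hp : p.straight = true) {s : Store} {X : ℕ}
    (hX : 1 ≤ X) {Q : Store → Prop} (h : Ends p' (p.effect s) X Q) : Ends (.seq p p') s X Q :=
  Ends.seq (fun s' => s' = p.effect s) (Ends.straight hp hX rfl) fun _ _ h' => h' ▸ h

/-- The rule for loops, with an invariant `J` and a variant `μ`. -/
theorem Ends.loop {b : Test} {p : Program} {s : Store} {X : ℕ} (J : Store → Prop) (μ : Store → ℕ)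
    (Y : ℕ) (hY : 1 ≤ Y) (hX : (μ s + 1) * Y ≤ X) (h0 : J s)
    (hstep : ∀ s', Frame p s s' → J s' → b.Holds s' →
      Ends p s' Y (fun s'' => J s'' ∧ μ s'' < μ s')) :
    Ends (.loop b p) s X (fun s' => J s' ∧ ¬ b.Holds s') := by
  -- One share of `Y` for each remaining iteration, and one more for the final failing test.
  suffices H : ∀ k s', μ s' = k → Frame p s s' → J s' →
      Ends (.loop b p) s' ((μ s' + 1) * Y) (fun s' => J s' ∧ ¬ b.Holds s') from
    (H _ s rfl (Frame.refl _ _) h0).mono hX fun _ h => h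
  intro k
  induction k using Nat.strong_induction_on with
  | _ k ih =>
    intro s' hk hF hJ
    have hc : b.cost + 1 ≤ (b.cost + 1) * Y := Nat.le_mul_of_pos_right _ hY
    have hs : (Program.loop b p).size * Y = (b.cost + 1) * Y + p.size * Y := by
      rw [Program.size, Nat.add_mul]
    by_cases hb : b.Holds s'
    · obtain ⟨t, s'', hr, ht, hJ', hμ⟩ := hstep s' hF hJ hb
      obtain ⟨t', s₃, hr', ht', hQ⟩ := ih (μ s'') (by omega) s'' rfl (hF.trans hr.frame) hJ'
      refine ⟨_, s₃, .loop_true hb hr hr', ?_, hQ⟩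
      have h1 : (μ s'' + 1 + 1) * ((Program.loop b p).size * Y) ≤
          (μ s' + 1) * ((Program.loop b p).size * Y) := Nat.mul_le_mul_right _ (by omega)
      rw [mul_left_comm] at ht' ⊢
      rw [Nat.add_mul (μ s'' + 1)] at h1
      omega
    · refine ⟨_, s', .loop_false hb, ?_, hJ, hb⟩
      have h1 : 1 * ((Program.loop b p).size * Y) ≤ (μ s' + 1) * ((Program.loop b p).size * Y) :=
        Nat.mul_le_mul_right _ (by omega)
      rw [mul_left_comm]
      omega

end RealRAM

open Finset

/-! ### Sums over the leaves of a tree, and the Kraft equality -/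

namespace CodeTree

variable {α : Type}

/-- The sum of `F (d + depth of the leaf) (label of the leaf)` over the leaves of the tree. -/
def leafSum {M : Type} [AddCommMonoid M] (F : ℕ → α → M) : ℕ → CodeTree α → M
  | d, leaf c => F d c
  | d, node l r => l.leafSum F (d + 1) + r.leafSum F (d + 1)

/-- The height of the tree. -/
def height : CodeTree α → ℕ
  | leaf _ => 0
  | node l r => max l.height r.height + 1

theorem leafSum_kraft (T : CodeTree α) (d : ℕ) :
    T.leafSum (fun d _ => ((1 : ℝ) / 2) ^ d) d = (1 / 2) ^ d := by
  induction T generalizing d with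
  | leaf c => rfl
  | node l r ihl ihr => rw [leafSum, ihl, ihr, pow_succ]; ring

variable [DecidableEq α]

theorem depth_le_height (T : CodeTree α) (c : α) : T.depth c ≤ T.height := by
  induction T with
  | leaf _ => exact le_rfl
  | node l r ihl ihr =>
    simp only [depth, height]
    split_ifs <;> omega

/-- Links the recursive sum, which suits the construction of forests, with the sum over characters.
Distinct labels are needed because `depth` searches the left subtree first. -/
theorem leafSum_eq {M : Type} [AddCommMonoid M] (F : ℕ → α → M) (T : CodeTree α)
    (hT : T.leaves.Nodup) (d : ℕ) :
    T.leafSum F d = ∑ c ∈ T.leaves.toFinset, F (d + T.depth c) c := by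
  induction T generalizing d with
  | leaf c => simp [leafSum, leaves, depth]
  | node l r ihl ihr =>
    simp only [leaves, List.nodup_append] at hT
    obtain ⟨hl, hr, hd⟩ := hT
    have hdisj : Disjoint l.leaves.toFinset r.leaves.toFinset := by
      rw [Finset.disjoint_left]
      intro c hc hc'
      exact hd c (by simpa using hc) c (by simpa using hc') rfl
    rw [leafSum, leaves, List.toFinset_append, Finset.sum_union hdisj, ihl hl, ihr hr]
    congr 1
    · refine Finset.sum_congr rfl fun c hc => ?_
      have hc' : c ∈ l.leaves := by simpa using hc
      simp only [depth, hc', if_true]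
      congr 1; omega
    · refine Finset.sum_congr rfl fun c hc => ?_
      have hc' : c ∉ l.leaves := fun h => (Finset.disjoint_left.1 hdisj (by simpa using h)) hc
      simp only [depth, hc', if_false]
      congr 1; omega

theorem IsPrefixTree.leafSum_eq [Fintype α] {M : Type} [AddCommMonoid M] (F : ℕ → α → M)
    {T : CodeTree α} (hT : T.IsPrefixTree) : T.leafSum F 0 = ∑ c, F (T.depth c) c := by
  rw [CodeTree.leafSum_eq F T hT.1]
  have : T.leaves.toFinset = Finset.univ := by
    ext c; simpa using hT.2 c
  simp [this]

theorem IsPrefixTree.kraft [Fintype α] {T : CodeTree α} (hT : T.IsPrefixTree) :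
    ∑ c, ((1 : ℝ) / 2) ^ T.depth c = 1 := by
  rw [← hT.leafSum_eq (fun d _ => ((1 : ℝ) / 2) ^ d), leafSum_kraft, pow_zero]

/-- Needed for the truncation: lengthening a code word by one bit at most doubles its length. -/
theorem IsPrefixTree.depth_pos {n : ℕ} (hn : 2 ≤ n) {T : CodeTree (Fin n)} (hT : T.IsPrefixTree)
    (c : Fin n) : 1 ≤ T.depth c := by
  cases T with
  | leaf a =>
    have h0 := hT.2 ⟨0, by omega⟩
    have h1 := hT.2 ⟨1, by omega⟩
    simp only [leaves, List.mem_singleton] at h0 h1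
    rw [← h1] at h0
    simp at h0
  | node l r => simp only [depth]; split_ifs <;> omega

end CodeTree

/-! ### The cost of decoding as a monotone function of the depth -/

namespace BlockingScheme

variable (BS : BlockingScheme)

theorem sum_ite_lt_succ {M : Type} [AddCommMonoid M] {m : ℕ} (x : Fin m → M) {h : ℕ} (hm : h < m) :
    (∑ j : Fin m, if (j : ℕ) < h + 1 then x j else 0) =
      (∑ j : Fin m, if (j : ℕ) < h then x j else 0) + x ⟨h, hm⟩ := by
  have : ∀ j : Fin m, (if (j : ℕ) < h + 1 then x j else 0) =
      (if (j : ℕ) < h then x j else 0) + if j = ⟨h, hm⟩ then x j else 0 := by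
    intro j
    have : j = ⟨h, hm⟩ ↔ (j : ℕ) = h := by rw [Fin.ext_iff]
    simp only [this]
    split_ifs <;> first | omega | simp
  rw [Finset.sum_congr rfl fun j _ => this j, Finset.sum_add_distrib]
  simp

theorem width_zero : BS.width 0 = 0 := by simp [width]

theorem accessCost_zero : BS.accessCost 0 = 0 := by simp [accessCost]

theorem width_succ {h : ℕ} (hm : h < BS.m) : BS.width (h + 1) = BS.width h + BS.w ⟨h, hm⟩ :=
  sum_ite_lt_succ _ hm

theorem accessCost_succ {h : ℕ} (hm : h < BS.m) :
    BS.accessCost (h + 1) = BS.accessCost h + BS.q ⟨h, hm⟩ :=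
  sum_ite_lt_succ _ hm

theorem width_mono : Monotone BS.width := by
  intro a b hab
  refine Finset.sum_le_sum fun j _ => ?_
  split_ifs <;> omega

theorem accessCost_mono : Monotone BS.accessCost := by
  intro a b hab
  refine Finset.sum_le_sum fun j _ => ?_
  have := BS.q_nonneg j
  split_ifs <;> first | omega | linarith

theorem blockLevel_eq {d h : ℕ} (h1 : d ≤ BS.width h) (h2 : ∀ h' < h, BS.width h' < d) :
    BS.blockLevel d = h := by
  refine le_antisymm (Nat.sInf_le h1) ?_
  by_contra hlt
  push Not at hlt
  have hmem : BS.blockLevel d ∈ {h : ℕ | d ≤ BS.width h} := Nat.sInf_mem ⟨h, h1⟩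
  exact absurd (h2 _ hlt) (not_lt.2 hmem)

theorem blockLevel_zero : BS.blockLevel 0 = 0 := BS.blockLevel_eq (Nat.zero_le _) (by omega)

theorem blockLevel_mono {d d' : ℕ} (h : d ≤ d') (hd : d' ≤ BS.width BS.m) :
    BS.blockLevel d ≤ BS.blockLevel d' := by
  have hmem : BS.blockLevel d' ∈ {h : ℕ | d' ≤ BS.width h} := Nat.sInf_mem ⟨BS.m, hd⟩
  exact Nat.sInf_le (h.trans hmem)

/-- The cost of decoding a character at depth `d`, constant beyond the width of the scheme. -/
noncomputable def depthCost (d : ℕ) : ℝ :=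
  BS.accessCost (BS.blockLevel (min d (BS.width BS.m)))

theorem depthCost_of_le {d : ℕ} (hd : d ≤ BS.width BS.m) :
    BS.depthCost d = BS.accessCost (BS.blockLevel d) := by rw [depthCost, min_eq_left hd]

theorem depthCost_zero : BS.depthCost 0 = 0 := by
  rw [depthCost, Nat.zero_min, blockLevel_zero, accessCost_zero]

theorem depthCost_mono : Monotone BS.depthCost := fun _ _ h =>
  BS.accessCost_mono (BS.blockLevel_mono (min_le_min_right _ h) (min_le_right _ _))

theorem depthCost_nonneg (d : ℕ) : 0 ≤ BS.depthCost d :=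
  BS.depthCost_zero ▸ BS.depthCost_mono (Nat.zero_le d)

theorem Fits.decodeTime_eq {BS : BlockingScheme} {α : Type} [DecidableEq α] [Fintype α]
    {T : CodeTree α} (hT : BS.Fits T) (f : α → ℝ) :
    BS.decodeTime f T = ∑ c, f c * BS.depthCost (T.depth c) :=
  Finset.sum_congr rfl fun c _ => by rw [charCost, BS.depthCost_of_le (hT c)]

open Classical in
/-- The number of changes of the access cost among the first `h` block levels, plus one if
`h` is positive. -/
noncomputable def hierarchiesUpTo (h : ℕ) : ℕ :=
  #{i ∈ range h | i = 0 ∨ ∃ (hi : i < BS.m) (hi' : i - 1 < BS.m), BS.q ⟨i, hi⟩ ≠ BS.q ⟨i - 1, hi'⟩}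

theorem hierarchiesUpTo_succ_le (h : ℕ) : BS.hierarchiesUpTo h ≤ BS.hierarchiesUpTo (h + 1) := by
  classical
  refine Finset.card_le_card (Finset.filter_subset_filter _ ?_)
  exact Finset.range_subset_range.2 (Nat.le_succ h)

theorem hierarchiesUpTo_succ {h : ℕ} (hh : h = 0 ∨ ∃ (hi : h < BS.m) (hi' : h - 1 < BS.m),
    BS.q ⟨h, hi⟩ ≠ BS.q ⟨h - 1, hi'⟩) :
    BS.hierarchiesUpTo (h + 1) = BS.hierarchiesUpTo h + 1 := by
  classical
  rw [hierarchiesUpTo, Finset.range_add_one, Finset.filter_insert, if_pos hh,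
    Finset.card_insert_of_notMem (by simp)]
  rfl

/-- The index `0` accounts for the summand `1` in `hierarchies`; every other counted index is a
change of access cost. -/
theorem hierarchiesUpTo_le (h : ℕ) : BS.hierarchiesUpTo h ≤ BS.hierarchies := by
  classical
  set A : Set (Fin BS.m) := {i | ∃ j : Fin BS.m, (j : ℕ) + 1 = (i : ℕ) ∧ BS.q i ≠ BS.q j} with hA
  have hfin : A.Finite := Set.toFinite A
  have hsub : {i ∈ range h | i = 0 ∨ ∃ (hi : i < BS.m) (hi' : i - 1 < BS.m),
      BS.q ⟨i, hi⟩ ≠ BS.q ⟨i - 1, hi'⟩} ⊆ insert 0 (hfin.toFinset.image Fin.val) := by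
    intro i hi
    simp only [mem_filter, mem_range] at hi
    rcases Nat.eq_zero_or_pos i with h0 | hpos
    · simp [h0]
    · obtain ⟨-, h0 | ⟨hi1, hi2, hne⟩⟩ := hi
      · omega
      · refine Finset.mem_insert_of_mem (Finset.mem_image.2 ⟨⟨i, hi1⟩, ?_, rfl⟩)
        simp only [Set.Finite.mem_toFinset, hA, Set.mem_ofPred_eq]
        exact ⟨⟨i - 1, hi2⟩, by simp; omega, hne⟩
  calc BS.hierarchiesUpTo h ≤ #(insert 0 (hfin.toFinset.image Fin.val)) := Finset.card_le_card hsub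
    _ ≤ #(hfin.toFinset.image Fin.val) + 1 := Finset.card_insert_le _ _
    _ ≤ #hfin.toFinset + 1 := by gcongr; exact Finset.card_image_le
    _ = 1 + A.ncard := by rw [Set.ncard_eq_toFinset_card A hfin, add_comm]

end BlockingScheme

/-! ### Truncation of the height -/

/-- Shift the depths in the window `[t, t + W)` by one, and move everything below to the
depth `t + W`. -/
def truncateDepth (t W d : ℕ) : ℕ := if d < t then d else if d < t + W then d + 1 else t + W

theorem truncateDepth_le (t W d : ℕ) : truncateDepth t W d ≤ t + W := by
  unfold truncateDepth; split_ifs <;> omega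

theorem two_pow_mul_half_pow {a b : ℕ} (h : a ≤ b) :
    (2 : ℝ) ^ b * (1 / 2) ^ a = ((2 ^ (b - a) : ℕ) : ℝ) := by
  obtain ⟨k, rfl⟩ := Nat.exists_eq_add_of_le h
  rw [Nat.add_sub_cancel_left, pow_add, one_div, inv_pow]
  push_cast
  field_simp

/-- Let `K` be the Kraft mass at depths at least `t`. Shifting by one halves the contribution of the
window, so at least `K / 2` is free for the leaves placed at depth `t + W`. They use at most `n / 2
^ (t + W)`, and this fits because a nonzero `K` is at least `1 / 2 ^ t`. -/
theorem kraft_truncateDepth {n : ℕ} {ℓ : Fin n → ℕ} (hk : ∑ c, ((1 : ℝ) / 2) ^ ℓ c = 1) (t : ℕ)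
    {W : ℕ} (hW : 2 * n ≤ 2 ^ W) : ∑ c, ((1 : ℝ) / 2) ^ truncateDepth t W (ℓ c) ≤ 1 := by
  by_cases hex : ∃ c, t ≤ ℓ c
  swap
  · push Not at hex
    refine le_of_eq (Eq.trans (Finset.sum_congr rfl fun c _ => ?_) hk)
    rw [truncateDepth, if_pos (hex c)]
  obtain ⟨c₀, hc₀⟩ := hex
  set A : ℝ := ∑ c, if ℓ c < t then ((1 : ℝ) / 2) ^ ℓ c else 0 with hA
  set K : ℝ := ∑ c, if ℓ c < t then 0 else ((1 : ℝ) / 2) ^ ℓ c with hK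
  have hAK : A + K = 1 := by
    rw [hA, hK, ← Finset.sum_add_distrib]
    refine Eq.trans (Finset.sum_congr rfl fun c _ => ?_) hk
    split_ifs <;> simp
  have hKpos : 0 < K := by
    refine Finset.sum_pos' (fun c _ => ?_) ⟨c₀, Finset.mem_univ _, ?_⟩
    · split_ifs <;> positivity
    · rw [if_neg (by omega)]; positivity
  -- The mass above depth `t` is a multiple of `1 / 2 ^ t`. By the Kraft equality so is the positive
  -- number `K`, which gives its lower bound.
  have hint : ∃ N : ℕ, (2 : ℝ) ^ t * A = N := by
    refine ⟨∑ c, if ℓ c < t then 2 ^ (t - ℓ c) else 0, ?_⟩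
    rw [hA, Finset.mul_sum]
    push_cast
    refine Finset.sum_congr rfl fun c _ => ?_
    split_ifs with h
    · rw [two_pow_mul_half_pow h.le]; push_cast; rfl
    · simp
  obtain ⟨N, hN⟩ := hint
  have h2t : (0 : ℝ) < 2 ^ t := by positivity
  have hKge : 1 ≤ (2 : ℝ) ^ t * K := by
    have h1 : (2 : ℝ) ^ t * K = ((2 ^ t : ℕ) : ℝ) - N := by
      rw [← hN]; push_cast; linear_combination (2 : ℝ) ^ t * hAK
    have h2 : (0 : ℝ) < ((2 ^ t : ℕ) : ℝ) - N := by rw [← h1]; positivity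
    have h3 : N < 2 ^ t := by exact_mod_cast sub_pos.1 h2
    have h4 : ((N + 1 : ℕ) : ℝ) ≤ ((2 ^ t : ℕ) : ℝ) := by exact_mod_cast h3
    rw [h1]; push_cast at h4 ⊢; linarith
  have hsum : ∑ c, ((1 : ℝ) / 2) ^ truncateDepth t W (ℓ c) ≤ A + K / 2 + n * (1 / 2) ^ (t + W) := by
    have : A + K / 2 + n * ((1 : ℝ) / 2) ^ (t + W) =
        ∑ c, ((if ℓ c < t then ((1 : ℝ) / 2) ^ ℓ c else 0) +
          (if ℓ c < t then 0 else ((1 : ℝ) / 2) ^ ℓ c) / 2 + (1 / 2) ^ (t + W)) := by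
      rw [Finset.sum_add_distrib, Finset.sum_add_distrib, ← Finset.sum_div]
      simp [hA, hK]
    rw [this]
    refine Finset.sum_le_sum fun c _ => ?_
    have hp : (0 : ℝ) ≤ (1 / 2) ^ (t + W) := by positivity
    have hp' : (0 : ℝ) ≤ (1 / 2) ^ ℓ c := by positivity
    unfold truncateDepth
    split_ifs
    · linarith
    · rw [pow_succ]; linarith
    · linarith
  have hn : n * ((1 : ℝ) / 2) ^ (t + W) ≤ K / 2 := by
    have hW' : (2 * n : ℝ) ≤ 2 ^ W := by exact_mod_cast hW
    have e : (2 : ℝ) ^ t * (2 : ℝ) ^ W * (1 / 2) ^ (t + W) = 1 := by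
      rw [← pow_add, ← mul_pow]; norm_num
    have hp : (0 : ℝ) ≤ (1 / 2) ^ (t + W) := by positivity
    have h1 : (2 : ℝ) ^ t * (2 * n * (1 / 2) ^ (t + W)) ≤ 2 ^ t * K := by
      calc (2 : ℝ) ^ t * (2 * n * (1 / 2) ^ (t + W))
          ≤ 2 ^ t * (2 ^ W * (1 / 2) ^ (t + W)) := by gcongr
        _ = 1 := by rw [← mul_assoc, e]
        _ ≤ _ := hKge
    have := le_of_mul_le_mul_left h1 h2t
    linarith
  linarith

/-- Above the window nothing changes and below it depths only decrease, so the window alone pays. -/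
theorem sum_mul_truncateDepth_le {n : ℕ} {f : Fin n → ℝ} (hf : ∀ c, 0 ≤ f c) (ℓ : Fin n → ℕ)
    {Q : ℕ → ℝ} (hQ : Monotone Q) (i W : ℕ) (hW : 0 < W) :
    ∑ c, f c * Q (truncateDepth (i * W) W (ℓ c)) ≤
      ∑ c, f c * Q (ℓ c) + ∑ c with ℓ c / W = i, f c * (Q (ℓ c + 1) - Q (ℓ c)) := by
  rw [Finset.sum_filter, ← Finset.sum_add_distrib]
  refine Finset.sum_le_sum fun c _ => ?_
  have hdiv : ℓ c / W = i ↔ i * W ≤ ℓ c ∧ ℓ c < i * W + W := by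
    rw [Nat.div_eq_iff hW]
    constructor
    · rintro ⟨h1, h2⟩; exact ⟨h1, by omega⟩
    · rintro ⟨h1, h2⟩; exact ⟨h1, by omega⟩
  unfold truncateDepth
  by_cases h1 : ℓ c < i * W
  · rw [if_pos h1, if_neg (by rw [hdiv]; omega), add_zero]
  · by_cases h2 : ℓ c < i * W + W
    · rw [if_neg h1, if_pos h2, if_pos (by rw [hdiv]; omega)]
      linarith
    · rw [if_neg h1, if_neg h2, if_neg (by rw [hdiv]; omega), add_zero]
      exact mul_le_mul_of_nonneg_left (hQ (by omega)) (hf c)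

/-- Distinct windows contain distinct characters; the increases of all windows in `G` together are
therefore bounded by one copy of the total cost. -/
theorem sum_window_le {n : ℕ} (ℓ : Fin n → ℕ) (x y : Fin n → ℝ) (hy : ∀ c, 0 ≤ y c) (W : ℕ)
    (G : Finset ℕ) (hxy : ∀ c, ℓ c / W ∈ G → x c ≤ y c) :
    ∑ i ∈ G, ∑ c with ℓ c / W = i, x c ≤ ∑ c, y c := by
  calc ∑ i ∈ G, ∑ c with ℓ c / W = i, x c
      ≤ ∑ i ∈ G, ∑ c with ℓ c / W = i, y c := by
        refine Finset.sum_le_sum fun i hi => Finset.sum_le_sum fun c hc => hxy c ?_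
        rw [(Finset.mem_filter.1 hc).2]; exact hi
    _ = ∑ c with ℓ c / W ∈ G, y c := by
        rw [← Finset.sum_fiberwise_of_maps_to (s := {c | ℓ c / W ∈ G}) (t := G)
          (g := fun c => ℓ c / W) (fun c hc => (Finset.mem_filter.1 hc).2)]
        refine Finset.sum_congr rfl fun i hi => Finset.sum_congr ?_ fun _ _ => rfl
        ext c
        simp only [mem_filter, mem_univ, true_and]
        exact ⟨fun h => ⟨h ▸ hi, h⟩, fun h => h.2⟩
    _ ≤ ∑ c, y c := Finset.sum_le_sum_of_subset_of_nonneg (Finset.filter_subset _ _)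
        fun c _ _ => hy c

/-- If the sum of `x` over `G` is at most `X`, few members of `G` exceed `δ X`. -/
theorem card_filter_lt_mul_le {G : Finset ℕ} {x : ℕ → ℝ} {X δ : ℝ}
    (hX : 0 ≤ X) (hG : ∀ A ⊆ G, ∑ i ∈ A, x i ≤ X) : #{i ∈ G | δ * X < x i} * δ < 1 := by
  by_contra! h
  set A := {i ∈ G | δ * X < x i} with hA
  have hne : A.Nonempty := by
    rw [Finset.nonempty_iff_ne_empty]
    intro h0
    rw [h0] at h
    norm_num at h
  have h1 : ∑ i ∈ A, δ * X < ∑ i ∈ A, x i :=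
    Finset.sum_lt_sum_of_nonempty hne fun i hi => (Finset.mem_filter.1 hi).2
  rw [Finset.sum_const, nsmul_eq_mul, ← mul_assoc] at h1
  have h2 := hG A (Finset.filter_subset _ _)
  nlinarith

/-- Every sequence of depths with the Kraft equality can be squeezed into
`W (M + B)` levels, where `B` counts the levels whose cost exceeds the cost of all levels above. -/
theorem exists_truncation {n : ℕ} {f : Fin n → ℝ} (hf : ∀ c, 0 ≤ f c) {ℓ : Fin n → ℕ}
    (hℓ : ∀ c, 1 ≤ ℓ c) (hk : ∑ c, ((1 : ℝ) / 2) ^ ℓ c = 1) {Q : ℕ → ℝ} (hQ : Monotone Q)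
    (hQ0 : ∀ d, 0 ≤ Q d) {W M H : ℕ} {δ : ℝ} (hδ : 0 < δ) (hW : 2 * n ≤ 2 ^ W) (hW0 : 0 < W)
    (hM : 2 ≤ M * δ) (hH : H = W * (M + #{j ∈ range H | Q j < Q (j + 1) - Q j})) :
    ∃ ℓ' : Fin n → ℕ, (∀ c, ℓ' c ≤ H) ∧ ∑ c, ((1 : ℝ) / 2) ^ ℓ' c ≤ 1 ∧
      ∑ c, f c * (ℓ' c : ℝ) ≤ (1 + δ) * ∑ c, f c * (ℓ c : ℝ) ∧
      ∑ c, f c * Q (ℓ' c) ≤ (1 + δ) * ∑ c, f c * Q (ℓ c) := by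
  set bad := {j ∈ range H | Q j < Q (j + 1) - Q j} with hbad
  set G := range (M + #bad) \ bad.image (· / W) with hG
  -- Each bad level spoils at most one window, so `M` of the `M + #bad` windows survive.
  have hGcard : M ≤ #G := by
    have h1 := Finset.le_card_sdiff (bad.image (· / W)) (range (M + #bad))
    have h2 : #(bad.image (· / W)) ≤ #bad := Finset.card_image_le
    rw [Finset.card_range, ← hG] at h1
    omega
  have hmono : Monotone fun d : ℕ => (d : ℝ) := Nat.mono_cast
  have hlen : #{i ∈ G | δ * ∑ c, f c * (ℓ c : ℝ) <
      ∑ c with ℓ c / W = i, f c * (((ℓ c + 1 : ℕ) : ℝ) - (ℓ c : ℝ))} * δ < 1 := by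
    refine card_filter_lt_mul_le
      (Finset.sum_nonneg fun c _ => mul_nonneg (hf c) (Nat.cast_nonneg _)) fun A _ =>
      sum_window_le ℓ _ _ (fun c => mul_nonneg (hf c) (Nat.cast_nonneg _)) W A fun c _ => ?_
    refine mul_le_mul_of_nonneg_left ?_ (hf c)
    have : (1 : ℝ) ≤ ℓ c := by exact_mod_cast hℓ c
    push_cast; linarith
  have hcost : #{i ∈ G | δ * ∑ c, f c * Q (ℓ c) <
      ∑ c with ℓ c / W = i, f c * (Q (ℓ c + 1) - Q (ℓ c))} * δ < 1 := by
    refine card_filter_lt_mul_le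
      (Finset.sum_nonneg fun c _ => mul_nonneg (hf c) (hQ0 _)) fun A hA =>
      sum_window_le ℓ _ _ (fun c => mul_nonneg (hf c) (hQ0 _)) W A fun c hc => ?_
    refine mul_le_mul_of_nonneg_left ?_ (hf c)
    have hcG := hA hc
    rw [hG, Finset.mem_sdiff, Finset.mem_range] at hcG
    -- A character of a window in `G` whose cost more than doubles would sit at a bad level, and its
    -- window would have been discarded.
    by_contra! hlt
    refine hcG.2 (Finset.mem_image.2 ⟨ℓ c, ?_, rfl⟩)
    rw [hbad, Finset.mem_filter, Finset.mem_range]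
    refine ⟨?_, hlt⟩
    rw [hH, mul_comm]
    exact (Nat.div_lt_iff_lt_mul hW0).1 hcG.1
  -- Each of the two requirements fails for fewer than `1 / δ` windows, and `G` has at least `M ≥ 2
  -- / δ` of them.
  obtain ⟨i, hiG, hi1, hi2⟩ : ∃ i ∈ G,
      ∑ c with ℓ c / W = i, f c * (((ℓ c + 1 : ℕ) : ℝ) - (ℓ c : ℝ)) ≤ δ * ∑ c, f c * (ℓ c : ℝ) ∧
      ∑ c with ℓ c / W = i, f c * (Q (ℓ c + 1) - Q (ℓ c)) ≤ δ * ∑ c, f c * Q (ℓ c) := by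
    by_contra! hno
    have hsub : G ⊆ {i ∈ G | δ * ∑ c, f c * (ℓ c : ℝ) <
        ∑ c with ℓ c / W = i, f c * (((ℓ c + 1 : ℕ) : ℝ) - (ℓ c : ℝ))} ∪
        {i ∈ G | δ * ∑ c, f c * Q (ℓ c) <
          ∑ c with ℓ c / W = i, f c * (Q (ℓ c + 1) - Q (ℓ c))} := by
      intro i hi
      rw [Finset.mem_union, Finset.mem_filter, Finset.mem_filter]
      rcases le_or_gt (∑ c with ℓ c / W = i, f c * (((ℓ c + 1 : ℕ) : ℝ) - (ℓ c : ℝ)))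
        (δ * ∑ c, f c * (ℓ c : ℝ)) with h | h
      · exact Or.inr ⟨hi, hno i hi h⟩
      · exact Or.inl ⟨hi, h⟩
    have hc := (hGcard.trans (Finset.card_le_card hsub)).trans (Finset.card_union_le _ _)
    have hc' : (M : ℝ) ≤ (#{i ∈ G | δ * ∑ c, f c * (ℓ c : ℝ) <
        ∑ c with ℓ c / W = i, f c * (((ℓ c + 1 : ℕ) : ℝ) - (ℓ c : ℝ))} : ℝ) +
        (#{i ∈ G | δ * ∑ c, f c * Q (ℓ c) <
          ∑ c with ℓ c / W = i, f c * (Q (ℓ c + 1) - Q (ℓ c))} : ℝ) := by exact_mod_cast hc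
    have := mul_le_mul_of_nonneg_right hc' hδ.le
    linarith
  refine ⟨fun c => truncateDepth (i * W) W (ℓ c), fun c => ?_, kraft_truncateDepth hk _ hW, ?_, ?_⟩
  · refine (truncateDepth_le _ _ _).trans ?_
    have : i < M + #bad := Finset.mem_range.1 (Finset.mem_sdiff.1 hiG).1
    calc i * W + W = W * (i + 1) := by ring
      _ ≤ W * (M + #bad) := Nat.mul_le_mul_left _ this
      _ = H := hH.symm
  · have := sum_mul_truncateDepth_le hf ℓ hmono i W hW0
    linarith
  · have := sum_mul_truncateDepth_le hf ℓ hQ i W hW0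
    linarith

/-- Assigning the depths to the characters in the opposite order of the frequencies
increases no cost that is monotone in the depth. -/
theorem exists_antitone_depths {n : ℕ} {φ : Fin n → ℝ} (hφ : Monotone φ) (ℓ : Fin n → ℕ) :
    ∃ σ : Equiv.Perm (Fin n), Antitone (ℓ ∘ σ) ∧
      ∀ Q : ℕ → ℝ, Monotone Q → ∑ i, φ i * Q (ℓ (σ i)) ≤ ∑ i, φ i * Q (ℓ i) := by
  -- The permutation does not depend on `Q`, so code length and decode time are improved by the same
  -- rearrangement.
  refine ⟨Tuple.sort fun i => OrderDual.toDual (ℓ i), ?_, fun Q hQ => ?_⟩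
  · exact fun i j h => Tuple.monotone_sort (fun i => OrderDual.toDual (ℓ i)) h
  · set σ := Tuple.sort fun i => OrderDual.toDual (ℓ i) with hσ
    have hanti : Antitone (fun i => Q (ℓ (σ i))) := fun i j h =>
      hQ (Tuple.monotone_sort (fun i => OrderDual.toDual (ℓ i)) h)
    have hav : Antivary φ (fun i => Q (ℓ (σ i))) := hφ.antivary hanti
    have := hav.sum_mul_le_sum_mul_comp_perm (σ := σ⁻¹)
    simpa using this

/-! ### The dynamic program -/

section DynamicProgram

variable (S : ℕ → ℝ) (u : ℕ → ℕ) (inc : ℕ → ℝ) (H : ℕ)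

/-- One step of the dynamic program, which looks up earlier entries in `t`. An entry consists of a
choice (`0`: infeasible, `1`: the next character becomes a leaf, `2`: all available nodes are
split) and of the remaining decode time. -/
noncomputable def dpCell (t : ℕ → ℕ → ℕ → ℕ → ℕ × ℝ) (e g b r : ℕ) : ℕ × ℝ :=
  if g = 0 then (if b = 0 then (1, 0) else (0, 0))
  else if b = 0 then (0, 0)
  else
    let leaf : ℕ × ℝ := if 0 < (t e (g - 1) (b - 1) r).1 then (1, (t e (g - 1) (b - 1) r).2)
      else (0, 0)
    let c := inc (H - e) * S g + (t (e - 1) g (b + b) (r - u g)).2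
    if 0 < e ∧ b + b ≤ g ∧ u g ≤ r ∧ 0 < (t (e - 1) g (b + b) (r - u g)).1 ∧
      (leaf.1 = 0 ∨ c < leaf.2) then (2, c) else leaf

/-- The dynamic program: the least decode time (and the first step achieving it) of a forest of
`b` trees at depth `H - e`, holding the `g` least frequent characters, with `r` units of code
length. -/
noncomputable def dpTable (e g b r : ℕ) : ℕ × ℝ :=
  dpCell S u inc H (fun e' g' b' r' => if _h : e' + g' < e + g then dpTable e' g' b' r' else (0, 0))
    e g b r
termination_by e + g

/-- The guard in the definition serves only termination: a leaf lowers `g`, a split lowers `e`, and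
where neither is possible the looked-up value is not used. -/
theorem dpTable_eq (e g b r : ℕ) :
    dpTable S u inc H e g b r = dpCell S u inc H (dpTable S u inc H) e g b r := by
  rw [dpTable]
  rcases Nat.eq_zero_or_pos g with rfl | hg
  · simp [dpCell]
  rcases Nat.eq_zero_or_pos e with rfl | he
  · have h1 : 0 + (g - 1) < 0 + g := by omega
    simp [dpCell, hg]
  · have h1 : e + (g - 1) < e + g := by omega
    have h2 : e - 1 + g < e + g := by omega
    simp [dpCell, hg, he]

variable {S u inc H}

theorem dpTable_zero {e b r : ℕ} :
    dpTable S u inc H e 0 b r = if b = 0 then (1, 0) else (0, 0) := by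
  rw [dpTable_eq, dpCell, if_pos rfl]

theorem dpTable_leaf {e g b r : ℕ} (h : 0 < (dpTable S u inc H e g b r).1) :
    0 < (dpTable S u inc H e (g + 1) (b + 1) r).1 ∧
      (dpTable S u inc H e (g + 1) (b + 1) r).2 ≤ (dpTable S u inc H e g b r).2 := by
  rw [dpTable_eq S u inc H e (g + 1) (b + 1) r, dpCell, if_neg (by omega), if_neg (by omega)]
  simp only [Nat.add_sub_cancel, h, if_true, one_ne_zero, false_or]
  split_ifs with h'
  · exact ⟨by norm_num, h'.2.2.2.2.le⟩
  · exact ⟨by norm_num, le_rfl⟩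

theorem dpTable_split {e g b r : ℕ} (hb : 0 < b) (hbg : b + b ≤ g) (hr : u g ≤ r)
    (h : 0 < (dpTable S u inc H e g (b + b) (r - u g)).1) :
    0 < (dpTable S u inc H (e + 1) g b r).1 ∧
      (dpTable S u inc H (e + 1) g b r).2 ≤
        inc (H - (e + 1)) * S g + (dpTable S u inc H e g (b + b) (r - u g)).2 := by
  rw [dpTable_eq S u inc H (e + 1) g b r, dpCell, if_neg (by omega), if_neg (by omega)]
  simp only [Nat.add_sub_cancel, hbg, hr, h, true_and, Nat.succ_pos]
  by_cases h0 : 0 < (dpTable S u inc H (e + 1) (g - 1) (b - 1) r).1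
  · simp only [h0, if_true]
    by_cases h' : inc (H - (e + 1)) * S g + (dpTable S u inc H e g (b + b) (r - u g)).2 <
        (dpTable S u inc H (e + 1) (g - 1) (b - 1) r).2
    · rw [if_pos (Or.inr h')]
      exact ⟨by norm_num, le_rfl⟩
    · rw [if_neg (by rintro (h1 | h1); exacts [one_ne_zero h1, h' h1])]
      exact ⟨by norm_num, not_lt.1 h'⟩
  · simp [h0]

/-- The possible outcomes at a feasible entry with characters left. -/
theorem dpTable_cases {e g b r : ℕ} (h : 0 < (dpTable S u inc H e (g + 1) b r).1) :
    0 < b ∧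
    (((dpTable S u inc H e (g + 1) b r).1 = 1 ∧ 0 < (dpTable S u inc H e g (b - 1) r).1 ∧
      (dpTable S u inc H e (g + 1) b r).2 = (dpTable S u inc H e g (b - 1) r).2) ∨
    ((dpTable S u inc H e (g + 1) b r).1 = 2 ∧ 0 < e ∧ b + b ≤ g + 1 ∧ u (g + 1) ≤ r ∧
      0 < (dpTable S u inc H (e - 1) (g + 1) (b + b) (r - u (g + 1))).1 ∧
      (dpTable S u inc H e (g + 1) b r).2 = inc (H - e) * S (g + 1) +
        (dpTable S u inc H (e - 1) (g + 1) (b + b) (r - u (g + 1))).2)) := by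
  rw [dpTable_eq, dpCell, if_neg (by omega)] at h ⊢
  by_cases hb : b = 0
  · simp [hb] at h
  rw [if_neg hb] at h ⊢
  refine ⟨by omega, ?_⟩
  simp only [Nat.add_sub_cancel] at h ⊢
  split_ifs at h ⊢ with h1 h2 h2
  · exact Or.inr ⟨rfl, h2.1, h2.2.1, h2.2.2.1, h2.2.2.2.1, rfl⟩
  · exact Or.inl ⟨rfl, h1, rfl⟩
  · exact Or.inr ⟨rfl, h2.1, h2.2.1, h2.2.2.1, h2.2.2.2.1, rfl⟩
  · simp at h

/-- Depths satisfying the Kraft inequality and the code length budget show that an entry of the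
dynamic program is feasible, and bound its value. -/
theorem dpTable_le_of_kraft {φ : ℕ → ℝ} {Q : ℕ → ℝ} {unit : ℝ} {n : ℕ}
    (hφ : ∀ i < n, 0 ≤ φ i) (hS : ∀ g ≤ n, S g = ∑ i ∈ range g, φ i)
    (hQ : Monotone Q) (hinc : ∀ d < H, inc d = Q (d + 1) - Q d) (hunit : 0 ≤ unit)
    (hu : ∀ g ≤ n, u g = 0 ∨ u g * unit < S g) :
    ∀ (k e g b r : ℕ) (ℓ : ℕ → ℕ), e + g = k → e ≤ H → g ≤ n → b ≤ g →
      (∀ i < g, H - e ≤ ℓ i ∧ ℓ i ≤ H) → (∀ i j, i ≤ j → j < g → ℓ j ≤ ℓ i) →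
      ∑ i ∈ range g, ((1 : ℝ) / 2) ^ ℓ i ≤ b * (1 / 2) ^ (H - e) →
      ∑ i ∈ range g, φ i * ((ℓ i : ℝ) - (H - e : ℕ)) ≤ r * unit →
      0 < (dpTable S u inc H e g b r).1 ∧
        (dpTable S u inc H e g b r).2 ≤ ∑ i ∈ range g, φ i * (Q (ℓ i) - Q (H - e)) := by
  intro k
  induction k using Nat.strong_induction_on with
  | _ k ih =>
  intro e g b r ℓ hk he hg hbg hℓ hanti hkraft hlen
  rcases Nat.eq_zero_or_pos g with rfl | hgpos
  · have : b = 0 := by omega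
    subst this
    simp [dpTable_zero]
  obtain ⟨g, rfl⟩ : ∃ g', g = g' + 1 := ⟨g - 1, by omega⟩
  have hp : (0 : ℝ) < (1 / 2) ^ (H - e) := by positivity
  have hbpos : 0 < b := by
    rcases Nat.eq_zero_or_pos b with rfl | h
    · have : 0 < ∑ i ∈ range (g + 1), ((1 : ℝ) / 2) ^ ℓ i :=
        Finset.sum_pos (fun i _ => by positivity) ⟨0, by simp⟩
      simp only [Nat.cast_zero, zero_mul] at hkraft
      linarith
    · exact h
  obtain ⟨b, rfl⟩ : ∃ b', b = b' + 1 := ⟨b - 1, by omega⟩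
  -- Depths are antitone, so the most frequent remaining character `g` is a shallowest one. If it
  -- lies at the current depth, it becomes a leaf.
  by_cases hlast : ℓ g = H - e
  · rw [Finset.sum_range_succ, hlast] at hkraft hlen
    have hrec := ih (e + g) (by omega) e g b r ℓ rfl he (by omega) (by omega)
      (fun i hi => hℓ i (by omega)) (fun i j hij hj => hanti i j hij (by omega))
      (by push_cast at hkraft; linarith) (by simpa using hlen)
    obtain ⟨h1, h2⟩ := dpTable_leaf hrec.1
    refine ⟨h1, h2.trans (hrec.2.trans (le_of_eq ?_))⟩
    rw [Finset.sum_range_succ, hlast, sub_self, mul_zero, add_zero]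
  have hgt : ∀ i < g + 1, H - e + 1 ≤ ℓ i := by
    intro i hi
    have h1 := hanti i g (by omega) (by omega)
    have h2 := (hℓ g (by omega)).1
    omega
  have hepos : 0 < e := by
    have h1 := hgt g (by omega)
    have h2 := (hℓ g (by omega)).2
    omega
  obtain ⟨e, rfl⟩ : ∃ e', e = e' + 1 := ⟨e - 1, by omega⟩
  have hsub : H - e = H - (e + 1) + 1 := by omega
  -- Now all remaining characters lie strictly deeper. All nodes are split, provided that there are
  -- enough characters to fill their children.
  by_cases hbb : (b + 1) + (b + 1) ≤ g + 1
  · have hSg := hS (g + 1) hg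
    have hrest : ∑ i ∈ range (g + 1), φ i * ((ℓ i : ℝ) - (H - e : ℕ)) =
        ∑ i ∈ range (g + 1), φ i * ((ℓ i : ℝ) - (H - (e + 1) : ℕ)) - S (g + 1) := by
      rw [hSg, ← Finset.sum_sub_distrib]
      refine Finset.sum_congr rfl fun i _ => ?_
      rw [hsub]; push_cast; ring
    have hrest0 : 0 ≤ ∑ i ∈ range (g + 1), φ i * ((ℓ i : ℝ) - (H - e : ℕ)) := by
      refine Finset.sum_nonneg fun i hi => ?_
      have hi' : i < g + 1 := Finset.mem_range.1 hi
      refine mul_nonneg (hφ i (by omega)) (sub_nonneg.2 ?_)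
      rw [hsub]
      exact_mod_cast hgt i hi'
    -- The split costs at least `u (g + 1)` units of true length, and strictly more than that unless
    -- `u (g + 1) = 0`. The strictness excludes `u (g + 1) > r` even when the unit is zero.
    have hur : u (g + 1) ≤ r := by
      by_contra! hlt
      rcases hu (g + 1) hg with h0 | h0
      · omega
      · have h1 : (r : ℝ) + 1 ≤ u (g + 1) := by exact_mod_cast hlt
        have h2 : ((r : ℝ) + 1) * unit ≤ u (g + 1) * unit := by gcongr
        linarith
    have husg : u (g + 1) * unit ≤ S (g + 1) := by
      rcases hu (g + 1) hg with h0 | h0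
      · rw [h0, hSg]
        simp only [Nat.cast_zero, zero_mul]
        exact Finset.sum_nonneg fun i hi => hφ i (by have := Finset.mem_range.1 hi; omega)
      · exact h0.le
    have hrec := ih (e + (g + 1)) (by omega) e (g + 1) ((b + 1) + (b + 1)) (r - u (g + 1)) ℓ rfl
      (by omega) hg hbb (fun i hi => ⟨by have := hgt i hi; omega, (hℓ i hi).2⟩) hanti
      (by rw [hsub, pow_succ]; push_cast at hkraft ⊢; linarith)
      (by rw [hrest, Nat.cast_sub hur]; linarith)
    obtain ⟨h1, h2⟩ := dpTable_split (Nat.succ_pos b) hbb hur hrec.1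
    refine ⟨h1, h2.trans ?_⟩
    have hcost : ∑ i ∈ range (g + 1), φ i * (Q (ℓ i) - Q (H - (e + 1))) =
        inc (H - (e + 1)) * S (g + 1) + ∑ i ∈ range (g + 1), φ i * (Q (ℓ i) - Q (H - e)) := by
      rw [hinc _ (by omega), hSg, Finset.mul_sum, ← Finset.sum_add_distrib]
      refine Finset.sum_congr rfl fun i _ => ?_
      rw [hsub]; ring
    rw [hcost]
    linarith [hrec.2]
  -- Too few characters for a split: the Kraft inequality is slack. One character becomes a leaf
  -- here, and the other `g ≤ 2 * b` move up to the next level, which is no deeper than their old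
  -- depths. This is how a full tree arises from an inequality.
  · have hrec := ih (e + 1 + g) (by omega) (e + 1) g b r (fun _ => H - e) rfl he (by omega)
      (by omega) (fun i _ => ⟨by omega, by omega⟩) (fun _ _ _ _ => le_rfl)
      (by
        rw [Finset.sum_const, Finset.card_range, nsmul_eq_mul, hsub, pow_succ]
        have : (g : ℝ) ≤ 2 * b := by exact_mod_cast (by omega : g ≤ 2 * b)
        nlinarith)
      (by
        refine le_trans ?_ hlen
        rw [Finset.sum_range_succ]
        have hlastnn : 0 ≤ φ g * ((ℓ g : ℝ) - (H - (e + 1) : ℕ)) :=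
          mul_nonneg (hφ g (by omega)) (sub_nonneg.2 (by exact_mod_cast (hℓ g (by omega)).1))
        refine le_add_of_le_of_nonneg (Finset.sum_le_sum fun i hi => ?_) hlastnn
        have hi' := Finset.mem_range.1 hi
        refine mul_le_mul_of_nonneg_left ?_ (hφ i (by omega))
        have : ((H - e : ℕ) : ℝ) ≤ ℓ i := by
          rw [hsub]; exact_mod_cast hgt i (by omega)
        linarith)
    obtain ⟨h1, h2⟩ := dpTable_leaf hrec.1
    refine ⟨h1, h2.trans (hrec.2.trans ?_)⟩
    rw [Finset.sum_range_succ]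
    have hlastnn : 0 ≤ φ g * (Q (ℓ g) - Q (H - (e + 1))) :=
      mul_nonneg (hφ g (by omega)) (sub_nonneg.2 (hQ (hℓ g (by omega)).1))
    refine le_add_of_le_of_nonneg (Finset.sum_le_sum fun i hi => ?_) hlastnn
    have hi' := Finset.mem_range.1 hi
    refine mul_le_mul_of_nonneg_left ?_ (hφ i (by omega))
    have : Q (H - e) ≤ Q (ℓ i) := hQ (by rw [hsub]; exact hgt i (by omega))
    linarith

end DynamicProgram

/-! ### Computing the window size, the number of windows and the height bound -/

namespace RealRAM

open Program NExp RExp Test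

/-- Sets register `2` to `⌈log₂ n⌉ + 1`. -/
def windowPhase : Program :=
  .seq (.seq (setNat 24 (.lit 1)) (setNat 2 (.lit 1))) <|
  .loop (natLt (.reg 24) (.reg 0)) <|
    .seq (setNat 24 (.add (.reg 24) (.reg 24))) (setNat 2 (.add (.reg 2) (.lit 1)))

theorem windowPhase_ends {s : Store} (hn : 2 ≤ s.nat 0) {X : ℕ} (hX : s.nat 0 + 1 ≤ X) :
    Ends windowPhase s X
      (fun s' => 2 * s.nat 0 ≤ 2 ^ s'.nat 2 ∧ 0 < s'.nat 2 ∧ 2 ^ s'.nat 2 < 4 * s.nat 0) := by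
  refine Ends.straight_seq rfl (by omega) (Ends.mono (Ends.loop (X := X)
    (fun s' => ∃ w, s'.nat 2 = w + 1 ∧ s'.nat 24 = 2 ^ w ∧ 2 ^ w < 2 * s.nat 0)
    (fun s' => s.nat 0 - s'.nat 24) 1 le_rfl ?_ ?_ fun s' hF hJ hb =>
      Ends.straight rfl le_rfl ?_).withFrame le_rfl ?_)
  · simp [effect, NExp.eval]; omega
  · exact ⟨0, by simp [effect, NExp.eval], by simp [effect, NExp.eval], by omega⟩
  · obtain ⟨w, h2, h24, hlt⟩ := hJ
    have h0 : s'.nat 0 = s.nat 0 := hF.nat 0 rfl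
    simp only [Test.Holds, NExp.eval, h24, h0] at hb
    have hpos : 0 < 2 ^ w := by positivity
    refine ⟨⟨w + 1, ?_, ?_, ?_⟩, ?_⟩
    · simp [effect, NExp.eval, h2]
    · simp [effect, NExp.eval, h24, pow_succ, mul_two]
    · rw [pow_succ]; omega
    · simp [effect, NExp.eval, h24]; omega
  · rintro s' ⟨hF, ⟨w, h2, h24, hlt⟩, hb⟩
    have h0 : s'.nat 0 = s.nat 0 := hF.nat 0 rfl
    simp only [Test.Holds, NExp.eval, h24, h0] at hb
    rw [h2, pow_succ]
    omega

/-- Sets register `3` to `M = ⌈2 / δ⌉` and register `4` to `W M`. -/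
def roundPhase : Program :=
  .loop (realLt (.mul (.ofNat (.reg 3)) (.reg 2)) (.lit 2)) <|
    .seq (setNat 3 (.add (.reg 3) (.lit 1))) (setNat 4 (.add (.reg 4) (.reg 2)))

/-- Without rounding, a ceiling is found by counting up; without integer multiplication, the product
is accumulated on the way. -/
theorem roundPhase_ends {s : Store} (hδ : 0 < s.real 2) (h3 : s.nat 3 = 0) (h4 : s.nat 4 = 0)
    {X : ℕ} (hX : ⌈2 / s.real 2⌉₊ + 1 ≤ X) :
    Ends roundPhase s X (fun s' => s'.nat 3 = ⌈2 / s.real 2⌉₊ ∧ s'.nat 4 = s.nat 2 * s'.nat 3) := by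
  refine Ends.mono (Ends.loop (X := X)
    (fun s' => s'.nat 3 ≤ ⌈2 / s.real 2⌉₊ ∧ s'.nat 4 = s.nat 2 * s'.nat 3)
    (fun s' => ⌈2 / s.real 2⌉₊ - s'.nat 3) 1 le_rfl ?_ ?_ fun s' hF hJ hb =>
      Ends.straight rfl le_rfl ?_).withFrame le_rfl ?_
  · omega
  · simp [h3, h4]
  · have hr : s'.real 2 = s.real 2 := hF.real 2 rfl
    have hn : s'.nat 2 = s.nat 2 := hF.nat 2 rfl
    simp only [Test.Holds, NExp.eval, RExp.eval, hr] at hb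
    push_cast at hb
    rw [← lt_div_iff₀ hδ] at hb
    have hlt : s'.nat 3 < ⌈2 / s.real 2⌉₊ := Nat.lt_ceil.2 hb
    simp only [effect, NExp.eval, Function.update_apply]
    simp [hJ.2, hn, mul_add]
    omega
  · rintro s' ⟨hF, ⟨h1, h2⟩, hb⟩
    have hr : s'.real 2 = s.real 2 := hF.real 2 rfl
    simp only [Test.Holds, NExp.eval, RExp.eval, hr] at hb
    push_cast at hb
    rw [← lt_div_iff₀ hδ, not_lt] at hb
    exact ⟨le_antisymm h1 (Nat.ceil_le.2 hb), h2⟩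

end RealRAM

namespace BlockingScheme

variable (BS : BlockingScheme)

open Classical in
/-- The number of levels above level `d` whose cost exceeds that of all levels above. -/
noncomputable def badLevels (d : ℕ) : ℕ :=
  #{j ∈ range d | BS.depthCost j < BS.depthCost (j + 1) - BS.depthCost j}

theorem badLevels_succ (d : ℕ) : BS.badLevels (d + 1) = BS.badLevels d +
    if BS.depthCost d < BS.depthCost (d + 1) - BS.depthCost d then 1 else 0 := by
  classical
  rw [badLevels, Finset.range_add_one, Finset.filter_insert]
  split_ifs with h
  · rw [Finset.card_insert_of_notMem (by simp)]; rfl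
  · rfl

theorem depthCost_eq {d h : ℕ} (hm : h ≤ BS.m) (h1 : d ≤ BS.width h)
    (h2 : ∀ h' < h, BS.width h' < d) : BS.depthCost d = BS.accessCost h := by
  rw [BS.depthCost_of_le (h1.trans (BS.width_mono hm)), BS.blockLevel_eq h1 h2]

end BlockingScheme

namespace RealRAM

open Program NExp RExp Test

/-- Fills the real array `3` with the increments of the cost of decoding. Register `4` ends up
holding the number of levels of the trees that are considered: it is increased by `W` for every
level whose cost exceeds the cost of all levels above. -/
def levelPhase : Program :=
  .loop (natLt (.reg 5) (.reg 4)) <|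
    .ite (natLt (.reg 7) (.add (.reg 5) (.lit 1)))
      (.ite (natLt (.reg 6) (.reg 1))
        (.seq (.ite (realLt (.reg 3) (.get 1 (.reg 6)))
          (setNat 4 (.add (.reg 4) (.reg 2))) .skip) <|
        .seq (putReal 3 (.reg 5) (.get 1 (.reg 6))) <|
        .seq (setReal 3 (.add (.reg 3) (.get 1 (.reg 6)))) <|
        .seq (setNat 7 (.add (.reg 7) (.get 0 (.reg 6)))) <|
        .seq (setNat 6 (.add (.reg 6) (.lit 1))) (setNat 5 (.add (.reg 5) (.lit 1))))
        (setNat 4 (.reg 5)))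
      (setNat 5 (.add (.reg 5) (.lit 1)))

/-- The invariant of `levelPhase` at depth `d`, when `h` block levels are in use. -/
structure LevelInv (BS : BlockingScheme) (W M : ℕ) (s : Store) (d h H : ℕ) : Prop where
  reg_d : s.nat 5 = d
  reg_h : s.nat 6 = h
  reg_H : s.nat 4 = H
  reg_width : s.nat 7 = BS.width h
  reg_cost : s.real 3 = BS.accessCost h
  le_m : h ≤ BS.m
  le_width : d ≤ BS.width h
  width_lt : ∀ h' < h, BS.width h' < d
  d_le : d ≤ H
  inc : ∀ j < d, s.realArr 3 j = BS.depthCost (j + 1) - BS.depthCost j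
  inc_zero : ∀ j, d ≤ j → s.realArr 3 j = 0
  bad : BS.badLevels d ≤ BS.hierarchiesUpTo h
  H_le : H ≤ W * (M + BS.hierarchies)
  H_eq : H = W * (M + BS.badLevels d) ∨ (H = d ∧ BS.width BS.m ≤ d)

/-- The target `H` grows while it is approached, by `W` at every bad level, and ends as a solution
of `H = W * (M + badLevels H)` unless the scheme is exhausted first. Since bad levels start
hierarchies, the time is governed by `W * (M + k)`, independently of the number of block levels. -/
theorem levelPhase_ends {s : Store} {BS : BlockingScheme} {W M : ℕ}
    (h1 : s.nat 1 = BS.m) (h2 : s.nat 2 = W) (h4 : s.nat 4 = W * M) (h5 : s.nat 5 = 0)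
    (h6 : s.nat 6 = 0) (h7 : s.nat 7 = 0) (hr3 : s.real 3 = 0) (hA3 : ∀ j, s.realArr 3 j = 0)
    (hw : ∀ h (hm : h < BS.m), s.natArr 0 h = BS.w ⟨h, hm⟩)
    (hq : ∀ h (hm : h < BS.m), s.realArr 1 h = BS.q ⟨h, hm⟩)
    {X : ℕ} (hX : W * (M + BS.hierarchies) + 2 ≤ X) :
    Ends levelPhase s X (fun s' => s'.nat 4 ≤ BS.width BS.m ∧
      s'.nat 4 ≤ W * (M + BS.hierarchies) ∧
      (s'.nat 4 = W * (M + BS.badLevels (s'.nat 4)) ∨ BS.width BS.m ≤ s'.nat 4) ∧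
      ∀ j < s'.nat 4, s'.realArr 3 j = BS.depthCost (j + 1) - BS.depthCost j) := by
  refine Ends.mono (Ends.loop (X := X)
    (fun s' => ∃ d h H, LevelInv BS W M s' d h H)
    -- The value `0` after termination matters: when the scheme is exhausted, the body lowers `H` to
    -- `d` and does not advance `d`.
    (fun s' => if s'.nat 5 < s'.nat 4 then W * (M + BS.hierarchies) + 1 - s'.nat 5 else 0) 1 le_rfl
      ?_ ?_ fun s' hF hJ hb => Ends.straight rfl le_rfl ?_) le_rfl ?_
  · simp only [mul_one]
    split_ifs <;> omega
  · refine ⟨0, 0, W * M, h5, h6, h4, by rw [h7, BS.width_zero], by rw [hr3, BS.accessCost_zero],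
      Nat.zero_le _, Nat.zero_le _, by omega, Nat.zero_le _, by omega, fun j _ => hA3 j, ?_, ?_,
      Or.inl ?_⟩
    · simp [BlockingScheme.badLevels]
    · exact Nat.mul_le_mul_left _ (by omega)
    · simp [BlockingScheme.badLevels]
  · obtain ⟨d, h, H, hJ⟩ := hJ
    have g1 : s'.nat 1 = BS.m := (hF.nat 1 rfl).trans h1
    have g2 : s'.nat 2 = W := (hF.nat 2 rfl).trans h2
    have gw : s'.natArr 0 = s.natArr 0 := hF.natArr 0 rfl
    have gq : s'.realArr 1 = s.realArr 1 := hF.realArr 1 rfl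
    simp only [Test.Holds, NExp.eval, hJ.reg_d, hJ.reg_H] at hb
    have hcd := BS.depthCost_eq hJ.le_m hJ.le_width hJ.width_lt
    have hHle := hJ.H_le
    have hH : H = W * (M + BS.badLevels d) := by
      rcases hJ.H_eq with h | h
      · exact h
      · omega
    by_cases c1 : BS.width h < d + 1
    swap
    -- Inside a block the cost does not change; the array entry is left at its initial value `0`.
    · have hcd' : BS.depthCost (d + 1) = BS.accessCost h :=
        BS.depthCost_eq hJ.le_m (by omega) fun h' hh => (hJ.width_lt h' hh).trans (Nat.lt_succ_self d)
      have hbad : BS.badLevels (d + 1) = BS.badLevels d := by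
        rw [BS.badLevels_succ, hcd', hcd, if_neg, add_zero]
        rw [sub_self, not_lt, ← hcd]
        exact BS.depthCost_nonneg d
      simp only [effect, Test.Holds, NExp.eval, hJ.reg_width, hJ.reg_d, c1, if_false]
      refine ⟨⟨d + 1, h, H, by simp, by simp [hJ.reg_h], by simp [hJ.reg_H], by simp [hJ.reg_width],
        hJ.reg_cost, hJ.le_m, by omega, fun h' hh => (hJ.width_lt h' hh).trans (Nat.lt_succ_self d),
        by omega, fun j hj => ?_, fun j hj => hJ.inc_zero j (by omega), by rw [hbad]; exact hJ.bad,
        hJ.H_le, Or.inl (by rw [hbad]; exact hH)⟩, ?_⟩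
      · rcases Nat.lt_succ_iff_lt_or_eq.1 hj with hj | rfl
        · exact hJ.inc j hj
        · simp only
          rw [hJ.inc_zero j le_rfl, hcd, hcd', sub_self]
      · simp [hJ.reg_H]
        split_ifs <;> omega
    have hwd : BS.width h = d := le_antisymm (by omega) hJ.le_width
    by_cases c2 : h < BS.m
    swap
    -- No block level is left: `d` is the full width of the scheme, and every admitted tree has
    -- height at most `d`.
    · have hhm : h = BS.m := le_antisymm hJ.le_m (by omega)
      simp only [effect, Test.Holds, NExp.eval, hJ.reg_width, hJ.reg_d, hJ.reg_h, g1, c1, c2,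
        if_false, if_true]
      refine ⟨⟨d, h, d, by simp [hJ.reg_d], by simp [hJ.reg_h], by simp, by simp [hJ.reg_width],
        hJ.reg_cost, hJ.le_m, hJ.le_width, hJ.width_lt, le_rfl, hJ.inc, hJ.inc_zero, hJ.bad,
        by omega, Or.inr ⟨rfl, by rw [← hhm, hwd]⟩⟩, ?_⟩
      simp [hJ.reg_d, hJ.reg_H, hb]
      omega
    have hws := BS.width_succ c2
    have hwpos := BS.w_pos ⟨h, c2⟩
    have hlt' : ∀ h' < h + 1, BS.width h' < d + 1 := fun h' hh =>
      (BS.width_mono (Nat.lt_succ_iff.1 hh)).trans_lt c1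
    have hcd' : BS.depthCost (d + 1) = BS.accessCost h + BS.q ⟨h, c2⟩ := by
      rw [← BS.accessCost_succ c2]
      exact BS.depthCost_eq c2 (by omega) hlt'
    have hinc : BS.depthCost (d + 1) - BS.depthCost d = BS.q ⟨h, c2⟩ := by
      rw [hcd', hcd]; ring
    have hbadh : BS.badLevels (d + 1) ≤ BS.hierarchiesUpTo (h + 1) := by
      rw [BS.badLevels_succ, hinc, hcd]
      split_ifs with hbad
      · rw [BS.hierarchiesUpTo_succ]
        · exact Nat.add_le_add_right hJ.bad 1
        · rcases Nat.eq_zero_or_pos h with h0 | hpos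
          · exact Or.inl h0
          -- A bad level costs more than all block levels above, in particular more than its
          -- predecessor, so the two costs differ.
          · refine Or.inr ⟨c2, by omega, fun heq => ?_⟩
            obtain ⟨h, rfl⟩ : ∃ h', h = h' + 1 := ⟨h - 1, by omega⟩
            have hh : h < BS.m := by omega
            rw [BS.accessCost_succ hh, heq] at hbad
            have hnn : 0 ≤ BS.accessCost h := BS.accessCost_zero ▸ BS.accessCost_mono (Nat.zero_le h)
            simp only [Nat.add_sub_cancel] at hbad
            linarith
      · exact hJ.bad.trans (BS.hierarchiesUpTo_succ_le h)
    have hle' : W * (M + BS.badLevels (d + 1)) ≤ W * (M + BS.hierarchies) :=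
      Nat.mul_le_mul_left _ (Nat.add_le_add_left (hbadh.trans (BS.hierarchiesUpTo_le _)) _)
    have hmono : H ≤ W * (M + BS.badLevels (d + 1)) := by
      rw [hH]
      exact Nat.mul_le_mul_left _ (Nat.add_le_add_left (by rw [BS.badLevels_succ]; omega) _)
    have hH' : (if BS.accessCost h < BS.q ⟨h, c2⟩ then H + W else H) =
        W * (M + BS.badLevels (d + 1)) := by
      rw [BS.badLevels_succ, hinc, hcd, hH]
      split_ifs <;> ring
    have hbody : ∀ s'' : Store, s''.nat 5 = d + 1 → s''.nat 6 = h + 1 →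
        s''.nat 4 = (if BS.accessCost h < BS.q ⟨h, c2⟩ then H + W else H) →
        s''.nat 7 = BS.width h + BS.w ⟨h, c2⟩ → s''.real 3 = BS.accessCost h + BS.q ⟨h, c2⟩ →
        s''.realArr 3 = Function.update (s'.realArr 3) d (BS.q ⟨h, c2⟩) →
        (∃ d h H, LevelInv BS W M s'' d h H) ∧
        (if s''.nat 5 < s''.nat 4 then W * (M + BS.hierarchies) + 1 - s''.nat 5 else 0) <
        if s'.nat 5 < s'.nat 4 then W * (M + BS.hierarchies) + 1 - s'.nat 5 else 0 := by
      intro s'' e5 e6 e4 e7 er ea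
      rw [hH'] at e4
      refine ⟨⟨d + 1, h + 1, _, e5, e6, e4, by rw [e7, hws], by rw [er, BS.accessCost_succ c2],
        c2, by omega, hlt', by omega, fun j hj => ?_, fun j hj => ?_, hbadh, hle', Or.inl rfl⟩, ?_⟩
      · rw [ea]
        rcases Nat.lt_succ_iff_lt_or_eq.1 hj with hj | rfl
        · rw [Function.update_of_ne (by omega), hJ.inc j hj]
        · rw [Function.update_self, hinc]
      · rw [ea, Function.update_of_ne (by omega), hJ.inc_zero j (by omega)]
      · rw [e5, e4, hJ.reg_d, hJ.reg_H, if_pos hb]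
        split_ifs <;> omega
    have gq' : s'.realArr 1 h = BS.q ⟨h, c2⟩ := by rw [gq, hq h c2]
    have gw' : s'.natArr 0 h = BS.w ⟨h, c2⟩ := by rw [gw, hw h c2]
    refine hbody _ ?_ ?_ ?_ ?_ ?_ ?_ <;> by_cases hc : BS.accessCost h < BS.q ⟨h, c2⟩ <;>
      simp [effect, Test.Holds, NExp.eval, RExp.eval, c1, c2, g1, hc, hJ.reg_width, hJ.reg_d,
        hJ.reg_h, hJ.reg_H, hJ.reg_cost, gq', gw', g2]
  · rintro s' ⟨⟨d, h, H, hJ⟩, hb⟩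
    simp only [Test.Holds, NExp.eval, hJ.reg_d, hJ.reg_H] at hb
    have hdH : d = H := le_antisymm hJ.d_le (by omega)
    subst hdH
    rw [hJ.reg_H]
    refine ⟨hJ.le_width.trans (BS.width_mono hJ.le_m), hJ.H_le, ?_, hJ.inc⟩
    rcases hJ.H_eq with h | h
    · exact Or.inl h
    · exact Or.inr h.2

end RealRAM

/-! ### Ranking with ties broken by the index -/

section Rank

/-- The order by value, ties being broken by the index. -/
def Precedes (F : ℕ → ℝ) (j i : ℕ) : Prop := F j < F i ∨ (¬ F i < F j ∧ j < i)

theorem Precedes.irrefl (F : ℕ → ℝ) (i : ℕ) : ¬ Precedes F i i := by simp [Precedes]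

theorem Precedes.trans {F : ℕ → ℝ} {i j k : ℕ} (h : Precedes F i j) (h' : Precedes F j k) :
    Precedes F i k := by
  rcases h with h | ⟨h1, h2⟩ <;> rcases h' with h' | ⟨h1', h2'⟩
  · exact Or.inl (h.trans h')
  · exact Or.inl (lt_of_lt_of_le h (not_lt.1 h1'))
  · exact Or.inl (lt_of_le_of_lt (not_lt.1 h1) h')
  · exact Or.inr ⟨not_lt.2 ((not_lt.1 h1).trans (not_lt.1 h1')), h2.trans h2'⟩

theorem Precedes.total {F : ℕ → ℝ} {i j : ℕ} (h : i ≠ j) : Precedes F i j ∨ Precedes F j i := by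
  rcases lt_trichotomy (F i) (F j) with h1 | h1 | h1
  · exact Or.inl (Or.inl h1)
  · rcases lt_or_gt_of_ne h with h2 | h2
    · exact Or.inl (Or.inr ⟨by rw [h1]; exact lt_irrefl _, h2⟩)
    · exact Or.inr (Or.inr ⟨by rw [h1]; exact lt_irrefl _, h2⟩)
  · exact Or.inr (Or.inl h1)

open Classical in
/-- The number of indices below `k` that precede `i`. -/
noncomputable def rankBelow (F : ℕ → ℝ) (k i : ℕ) : ℕ := #{j ∈ range k | Precedes F j i}

open Classical in
theorem rankBelow_succ (F : ℕ → ℝ) (k i : ℕ) :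
    rankBelow F (k + 1) i = rankBelow F k i + if Precedes F k i then 1 else 0 := by
  rw [rankBelow, Finset.range_add_one, Finset.filter_insert]
  split_ifs with h
  · rw [Finset.card_insert_of_notMem (by simp)]; rfl
  · rfl

theorem rankBelow_lt_of_precedes {F : ℕ → ℝ} {n i j : ℕ} (hi : i < n) (h : Precedes F i j) :
    rankBelow F n i < rankBelow F n j := by
  classical
  refine Finset.card_lt_card (Finset.ssubset_iff_subset_ne.2 ⟨fun k hk => ?_, fun heq => ?_⟩)
  · rw [Finset.mem_filter] at hk ⊢
    exact ⟨hk.1, hk.2.trans h⟩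
  · have h1 : i ∈ {k ∈ range n | Precedes F k j} := by simp [hi, h]
    rw [← heq, Finset.mem_filter] at h1
    exact Precedes.irrefl F i h1.2

theorem rankBelow_lt {F : ℕ → ℝ} {n i : ℕ} (hi : i < n) : rankBelow F n i < n := by
  classical
  calc rankBelow F n i < #(range n) := by
        refine Finset.card_lt_card (Finset.filter_ssubset.2 ⟨i, by simpa using hi, ?_⟩)
        exact Precedes.irrefl F i
    _ = n := Finset.card_range n

/-- Every array that is filled by rank is a permutation that sorts. -/
theorem exists_perm_of_rank {F : ℕ → ℝ} {n : ℕ} {A : ℕ → ℕ}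
    (hA : ∀ i < n, A (rankBelow F n i) = i) :
    ∃ π : Equiv.Perm (Fin n), (∀ k : Fin n, A k = π k) ∧ Monotone fun k => F (π k) := by
  -- Ranks are strictly monotone for a total order, hence `ρ` is a bijection of `Fin n`; its inverse
  -- sorts.
  let ρ : Fin n → Fin n := fun i => ⟨rankBelow F n i, rankBelow_lt i.2⟩
  have hinj : Function.Injective ρ := by
    intro i j hij
    by_contra hne
    have hval : rankBelow F n i = rankBelow F n j := congrArg Fin.val hij
    rcases Precedes.total (F := F) (fun h => hne (Fin.ext h)) with h | h
    · exact (rankBelow_lt_of_precedes i.2 h).ne hval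
    · exact (rankBelow_lt_of_precedes j.2 h).ne' hval
  let e : Equiv.Perm (Fin n) := Equiv.ofBijective ρ hinj.bijective_of_finite
  have hval : ∀ k : Fin n, rankBelow F n (e.symm k) = k := fun k =>
    congrArg Fin.val (e.apply_symm_apply k)
  refine ⟨e.symm, fun k => ?_, fun k k' hkk' => ?_⟩
  · have := hA (e.symm k) (e.symm k).2
    rwa [hval] at this
  · by_contra hlt
    have := rankBelow_lt_of_precedes (F := F) (e.symm k').2 (Or.inl (not_le.1 hlt))
    rw [hval, hval] at this
    exact absurd hkk' (not_le.2 (by exact_mod_cast this))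

end Rank

/-! ### Units of code length, sorting, rounded partial sums, strides -/

namespace RealRAM

open Program NExp RExp Test

/-- Sets register `8` to `V = ⌈(H + 1) / ε⌉`, and the real register `4` to the unit of code length
`ε (1 + δ) L / (H + 1)`. -/
def unitPhase : Program :=
  .seq (.loop (realLt (.mul (.ofNat (.reg 8)) (.reg 1)) (.ofNat (.add (.reg 4) (.lit 1))))
    (setNat 8 (.add (.reg 8) (.lit 1)))) <|
  setReal 4 (.div (.mul (.reg 1) (.mul (.add (.lit 1) (.reg 2)) (.reg 0)))
    (.ofNat (.add (.reg 4) (.lit 1))))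

theorem unitPhase_ends {s : Store} (hε : 0 < s.real 1) (h8 : s.nat 8 = 0)
    {X : ℕ} (hX : ⌈((s.nat 4 : ℝ) + 1) / s.real 1⌉₊ + 1 ≤ X) :
    Ends unitPhase s X (fun s' => s'.nat 8 = ⌈((s.nat 4 : ℝ) + 1) / s.real 1⌉₊ ∧
      s'.real 4 = s.real 1 * ((1 + s.real 2) * s.real 0) / ((s.nat 4 : ℝ) + 1)) := by
  refine Ends.seq (fun s' => s'.nat 8 = ⌈((s.nat 4 : ℝ) + 1) / s.real 1⌉₊)
    (Ends.mono (Ends.loop (X := X) (fun s' => s'.nat 8 ≤ ⌈((s.nat 4 : ℝ) + 1) / s.real 1⌉₊)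
    (fun s' => ⌈((s.nat 4 : ℝ) + 1) / s.real 1⌉₊ - s'.nat 8) 1 le_rfl ?_ ?_ fun s' hF hJ hb =>
      Ends.straight rfl le_rfl ?_).withFrame le_rfl ?_) fun s' hF h => Ends.straight rfl (by omega) ?_
  · omega
  · simp [h8]
  · have hr : s'.real 1 = s.real 1 := hF.real 1 rfl
    have hn : s'.nat 4 = s.nat 4 := hF.nat 4 rfl
    simp only [Test.Holds, NExp.eval, RExp.eval, hr, hn] at hb
    push_cast at hb
    rw [← lt_div_iff₀ hε] at hb
    have hlt := Nat.lt_ceil.2 hb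
    simp only [effect, NExp.eval, Function.update_apply]
    simp
    omega
  · rintro s' ⟨hF, h1, hb⟩
    have hr : s'.real 1 = s.real 1 := hF.real 1 rfl
    have hn : s'.nat 4 = s.nat 4 := hF.nat 4 rfl
    simp only [Test.Holds, NExp.eval, RExp.eval, hr, hn] at hb
    push_cast at hb
    rw [← lt_div_iff₀ hε, not_lt] at hb
    exact le_antisymm h1 (Nat.ceil_le.2 hb)
  · have hn : s'.nat 4 = s.nat 4 := hF.nat 4 rfl
    have hr0 : s'.real 0 = s.real 0 := hF.real 0 rfl
    have hr1 : s'.real 1 = s.real 1 := hF.real 1 rfl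
    have hr2 : s'.real 2 = s.real 2 := hF.real 2 rfl
    simp [effect, NExp.eval, RExp.eval, h, hn, hr0, hr1, hr2]

/-- Counts in register `11` the characters preceding character number `[register 9]`. -/
def rankLoop : Program :=
  .loop (natLt (.reg 10) (.reg 0)) <|
    .seq (.ite (realLt (.get 0 (.reg 10)) (.get 0 (.reg 9))) (setNat 11 (.add (.reg 11) (.lit 1)))
      (.ite (realLt (.get 0 (.reg 9)) (.get 0 (.reg 10))) .skip
        (.ite (natLt (.reg 10) (.reg 9)) (setNat 11 (.add (.reg 11) (.lit 1))) .skip)))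
    (setNat 10 (.add (.reg 10) (.lit 1)))

theorem rankLoop_ends {s : Store} (h10 : s.nat 10 = 0) (h11 : s.nat 11 = 0)
    {X : ℕ} (hX : s.nat 0 + 1 ≤ X) :
    Ends rankLoop s X (fun s' => s'.nat 11 = rankBelow (s.realArr 0) (s.nat 0) (s.nat 9)) := by
  refine Ends.mono (Ends.loop (X := X)
    (fun s' => s'.nat 10 ≤ s.nat 0 ∧ s'.nat 11 = rankBelow (s.realArr 0) (s'.nat 10) (s.nat 9))
    (fun s' => s.nat 0 - s'.nat 10) 1 le_rfl (by omega) ?_ fun s' hF hJ hb =>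
      Ends.straight rfl le_rfl ?_).withFrame le_rfl ?_
  · simp [h10, h11, rankBelow]
  · have h0 : s'.nat 0 = s.nat 0 := hF.nat 0 rfl
    have h9 : s'.nat 9 = s.nat 9 := hF.nat 9 rfl
    have hA : s'.realArr 0 = s.realArr 0 := hF.realArr 0 rfl
    simp only [Test.Holds, NExp.eval, h0] at hb
    have hs := rankBelow_succ (s.realArr 0) (s'.nat 10) (s.nat 9)
    rw [← hJ.2] at hs
    by_cases c1 : s.realArr 0 (s'.nat 10) < s.realArr 0 (s.nat 9)
    · simp only [Precedes, c1, true_or, if_true] at hs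
      simp [effect, NExp.eval, RExp.eval, Test.Holds, h9, hA, c1, hs]
      omega
    · by_cases c2 : s.realArr 0 (s.nat 9) < s.realArr 0 (s'.nat 10)
      · simp only [Precedes, c1, c2, not_true, false_and, or_false, if_false] at hs
        simp [effect, NExp.eval, RExp.eval, Test.Holds, h9, hA, c1, c2, hs]
        omega
      · simp only [Precedes, c1, c2, not_false_eq_true, true_and, false_or] at hs
        by_cases c3 : s'.nat 10 < s.nat 9
        · simp only [c3, if_true] at hs
          simp [effect, NExp.eval, RExp.eval, Test.Holds, h9, hA, c1, c2, c3, hs]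
          omega
        · simp only [c3, if_false] at hs
          simp [effect, NExp.eval, RExp.eval, Test.Holds, h9, hA, c1, c2, c3, hs]
          omega
  · rintro s' ⟨hF, ⟨h1, h2⟩, hb⟩
    have h0 : s'.nat 0 = s.nat 0 := hF.nat 0 rfl
    simp only [Test.Holds, NExp.eval, h0] at hb
    rw [h2, le_antisymm h1 (not_lt.1 hb)]

/-- Sorts the characters: the integer array `4` lists them by increasing frequency. -/
def sortPhase : Program :=
  .loop (natLt (.reg 9) (.reg 0)) <|
    .seq (.seq (setNat 10 (.lit 0)) (setNat 11 (.lit 0))) <|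
    .seq rankLoop <|
    .seq (putNat 4 (.reg 11) (.reg 9)) (setNat 9 (.add (.reg 9) (.lit 1)))

/-- Quadratic sorting is good enough, since the table alone takes more time. -/
theorem sortPhase_ends {s : Store} (h9 : s.nat 9 = 0)
    {X : ℕ} (hX : (s.nat 0 + 1) * (s.nat 0 + 1) ≤ X) :
    Ends sortPhase s X
      (fun s' => ∀ i < s.nat 0, s'.natArr 4 (rankBelow (s.realArr 0) (s.nat 0) i) = i) := by
  refine Ends.mono (Ends.loop (X := X)
    (fun s' => s'.nat 9 ≤ s.nat 0 ∧
      ∀ i < s'.nat 9, s'.natArr 4 (rankBelow (s.realArr 0) (s.nat 0) i) = i)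
    (fun s' => s.nat 0 - s'.nat 9) (s.nat 0 + 1) (by omega) (by rw [h9]; exact hX) ?_
    fun s' hF hJ hb => Ends.straight_seq rfl (by omega)
      (Ends.seq _ (rankLoop_ends ?_ ?_ ?_) fun s'' hF'' h11 => Ends.straight rfl (by omega)
        ?_)).withFrame le_rfl ?_
  · simp [h9]
  · simp [effect, NExp.eval]
  · simp [effect, NExp.eval]
  · have h0 : s'.nat 0 = s.nat 0 := hF.nat 0 rfl
    simp [effect, NExp.eval, h0]
  · have h0 : s'.nat 0 = s.nat 0 := hF.nat 0 rfl
    have hA : s'.realArr 0 = s.realArr 0 := hF.realArr 0 rfl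
    have h9'' : s''.nat 9 = s'.nat 9 := hF''.nat 9 rfl
    have hA4 : s''.natArr 4 = s'.natArr 4 := hF''.natArr 4 rfl
    simp only [Test.Holds, NExp.eval, h0] at hb
    simp [effect, NExp.eval, h0, hA] at h11
    simp only [effect, NExp.eval, h11, h9'', hA4, Function.update_self]
    refine ⟨⟨hb, fun i hi => ?_⟩, by omega⟩
    rcases Nat.lt_succ_iff_lt_or_eq.1 hi with hi | rfl
    · rw [Function.update_of_ne, hJ.2 i hi]
      intro heq
      rcases Precedes.total (F := s.realArr 0) hi.ne with h | h
      · exact (rankBelow_lt_of_precedes (by omega) h).ne heq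
      · exact (rankBelow_lt_of_precedes hb h).ne' heq
    · rw [Function.update_self]
  · rintro s' ⟨hF, ⟨h1, h2⟩, hb⟩
    have h0 : s'.nat 0 = s.nat 0 := hF.nat 0 rfl
    simp only [Test.Holds, NExp.eval, h0] at hb
    exact fun i hi => h2 i (by omega)

/-- Rounds the entry `[register 17] + 1` of the real array `2` to units, in register `11`. -/
def roundLoop : Program :=
  .loop (natLt (.reg 10) (.add (.reg 8) (.lit 1))) <|
    .seq (.ite (realLt (.mul (.ofNat (.add (.reg 11) (.lit 1))) (.reg 4))
      (.get 2 (.add (.reg 17) (.lit 1)))) (setNat 11 (.add (.reg 11) (.lit 1))) .skip)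
    (setNat 10 (.add (.reg 10) (.lit 1)))

/-- `k` is the number of units, of size `unit`, in the code length `x`, but at most `V + 1`. -/
def IsRounding (unit : ℝ) (V : ℕ) (x : ℝ) (k : ℕ) : Prop :=
  (k = 0 ∨ k * unit < x) ∧ (k ≤ V → x ≤ (k + 1) * unit)

/-- The number of iterations is fixed at `V + 1`, and the count stalls once the next unit does not
fit. The cap `V + 1` exceeds every budget, so it marks a split as unaffordable; it also ensures
termination when the unit is not positive. -/
theorem roundLoop_ends {s : Store} (h10 : s.nat 10 = 0) (h11 : s.nat 11 = 0)
    {X : ℕ} (hX : s.nat 8 + 2 ≤ X) :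
    Ends roundLoop s X
      (fun s' => IsRounding (s.real 4) (s.nat 8) (s.realArr 2 (s.nat 17 + 1)) (s'.nat 11)) := by
  refine Ends.mono (Ends.loop (X := X)
    (fun s' => s'.nat 10 ≤ s.nat 8 + 1 ∧ s'.nat 11 ≤ s'.nat 10 ∧
      (s'.nat 11 = 0 ∨ s'.nat 11 * s.real 4 < s.realArr 2 (s.nat 17 + 1)) ∧
      (s'.nat 11 < s'.nat 10 → s.realArr 2 (s.nat 17 + 1) ≤ (s'.nat 11 + 1) * s.real 4))
    (fun s' => s.nat 8 + 1 - s'.nat 10) 1 le_rfl (by omega) ?_ fun s' hF hJ hb =>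
      Ends.straight rfl le_rfl ?_).withFrame le_rfl ?_
  · simp [h10, h11]
  · have h8 : s'.nat 8 = s.nat 8 := hF.nat 8 rfl
    have h17 : s'.nat 17 = s.nat 17 := hF.nat 17 rfl
    have hr : s'.real 4 = s.real 4 := hF.real 4 rfl
    have hA : s'.realArr 2 = s.realArr 2 := hF.realArr 2 rfl
    simp only [Test.Holds, NExp.eval, h8] at hb
    obtain ⟨j1, j2, j3, j4⟩ := hJ
    by_cases c1 : ((s'.nat 11 : ℝ) + 1) * s.real 4 < s.realArr 2 (s.nat 17 + 1)
    · simp [effect, NExp.eval, RExp.eval, Test.Holds, h17, hr, hA, c1]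
      refine ⟨⟨by omega, by omega, fun hlt => absurd (j4 (by omega)) (not_le.2 c1)⟩, by omega⟩
    · simp [effect, NExp.eval, RExp.eval, Test.Holds, h17, hr, hA, c1]
      refine ⟨⟨by omega, by omega, j3, fun _ => not_lt.1 c1⟩, by omega⟩
  · rintro s' ⟨hF, ⟨j1, j2, j3, j4⟩, hb⟩
    have h8 : s'.nat 8 = s.nat 8 := hF.nat 8 rfl
    simp only [Test.Holds, NExp.eval, h8] at hb
    exact ⟨j3, fun hle => j4 (by omega)⟩

/-- Computes the sums of the smallest frequencies (real array `2`) and rounds them (integer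
array `5`). -/
def sumPhase : Program :=
  .loop (natLt (.reg 17) (.reg 0)) <|
    .seq (.seq (putReal 2 (.add (.reg 17) (.lit 1))
      (.add (.get 2 (.reg 17)) (.get 0 (.get 4 (.reg 17))))) <|
      .seq (setNat 10 (.lit 0)) (setNat 11 (.lit 0))) <|
    .seq roundLoop <|
    .seq (putNat 5 (.add (.reg 17) (.lit 1)) (.reg 11)) (setNat 17 (.add (.reg 17) (.lit 1)))

theorem sumPhase_ends {s : Store} (h17 : s.nat 17 = 0) (hS : s.realArr 2 0 = 0)
    (hu : s.natArr 5 0 = 0) {X : ℕ} (hX : (s.nat 0 + 1) * (s.nat 8 + 2) ≤ X) :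
    Ends sumPhase s X
      (fun s' => (∀ g ≤ s.nat 0, s'.realArr 2 g = ∑ i ∈ range g, s.realArr 0 (s.natArr 4 i)) ∧
        s'.natArr 5 0 = 0 ∧ ∀ g, 0 < g → g ≤ s.nat 0 →
          IsRounding (s.real 4) (s.nat 8) (s'.realArr 2 g) (s'.natArr 5 g)) := by
  refine Ends.mono (Ends.loop (X := X)
    (fun s' => s'.nat 17 ≤ s.nat 0 ∧
      (∀ g ≤ s'.nat 17, s'.realArr 2 g = ∑ i ∈ range g, s.realArr 0 (s.natArr 4 i)) ∧
        s'.natArr 5 0 = 0 ∧ ∀ g, 0 < g → g ≤ s'.nat 17 →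
          IsRounding (s.real 4) (s.nat 8) (s'.realArr 2 g) (s'.natArr 5 g))
    (fun s' => s.nat 0 - s'.nat 17) (s.nat 8 + 2) (by omega) (by rw [h17]; exact hX) ?_
    fun s' hF hJ hb => Ends.straight_seq rfl (by omega)
      (Ends.seq _ (roundLoop_ends ?_ ?_ ?_) fun s'' hF'' h11 => Ends.straight rfl (by omega)
        ?_)).withFrame le_rfl ?_
  · rw [h17]
    refine ⟨by omega, fun g hg => ?_, hu, fun g hg hg' => by omega⟩
    have : g = 0 := by omega
    subst this
    simp [hS]
  · simp [effect, NExp.eval]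
  · simp [effect, NExp.eval]
  · have h8 : s'.nat 8 = s.nat 8 := hF.nat 8 rfl
    simp [effect, NExp.eval, h8]
  · obtain ⟨j1, j2, j3, j4⟩ := hJ
    have h0 : s'.nat 0 = s.nat 0 := hF.nat 0 rfl
    have h8 : s'.nat 8 = s.nat 8 := hF.nat 8 rfl
    have hr : s'.real 4 = s.real 4 := hF.real 4 rfl
    have hA0 : s'.realArr 0 = s.realArr 0 := hF.realArr 0 rfl
    have hA4 : s'.natArr 4 = s.natArr 4 := hF.natArr 4 rfl
    have k17 : s''.nat 17 = s'.nat 17 := hF''.nat 17 rfl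
    have kA5 : s''.natArr 5 = s'.natArr 5 := hF''.natArr 5 rfl
    have kA2 : s''.realArr 2 = Function.update (s'.realArr 2) (s'.nat 17 + 1)
      (∑ i ∈ range (s'.nat 17 + 1), s.realArr 0 (s.natArr 4 i)) := by
      rw [hF''.realArr 2 rfl]
      simp [effect, NExp.eval, RExp.eval, hA0, hA4, j2, Finset.sum_range_succ]
    simp only [Test.Holds, NExp.eval, h0] at hb
    simp [effect, NExp.eval, RExp.eval, h8, hr, hA0, hA4, j2, ← Finset.sum_range_succ] at h11
    simp only [effect, NExp.eval, k17, kA5, kA2, Function.update_self]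
    refine ⟨⟨hb, fun g hg => ?_, ?_, fun g hg hg' => ?_⟩, by omega⟩
    · rcases Nat.le_succ_iff.1 hg with hg | rfl
      · rw [Function.update_of_ne (by omega), j2 g hg]
      · rw [Function.update_self]
    · rw [Function.update_of_ne (by omega), j3]
    · rcases Nat.le_succ_iff.1 hg' with hg' | rfl
      · rw [Function.update_of_ne (by omega), Function.update_of_ne (by omega)]
        exact j4 g hg hg'
      · simpa using h11
  · rintro s' ⟨hF, ⟨j1, j2, j3, j4⟩, hb⟩
    have h0 : s'.nat 0 = s.nat 0 := hF.nat 0 rfl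
    simp only [Test.Holds, NExp.eval, h0] at hb
    have he : s'.nat 17 = s.nat 0 := by omega
    rw [he] at j2 j4
    exact ⟨j2, j3, j4⟩

/-- Sets register `y` to `n + 1` times register `x`. -/
def scaleLoop (x y : ℕ) : Program :=
  .seq (.seq (setNat 9 (.lit 0)) (setNat y (.lit 0))) <|
  .loop (natLt (.reg 9) (.add (.reg 0) (.lit 1))) <|
    .seq (setNat y (.add (.reg y) (.reg x))) (setNat 9 (.add (.reg 9) (.lit 1)))

theorem scaleLoop_ends {s : Store} {x y : ℕ} (hxy : x ≠ y) (hx : x ≠ 9) (hy : y ≠ 9) (hy0 : y ≠ 0)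
    {X : ℕ} (hX : s.nat 0 + 2 ≤ X) :
    Ends (scaleLoop x y) s X (fun s' => s'.nat y = (s.nat 0 + 1) * s.nat x) := by
  refine Ends.straight_seq rfl (by omega) (Ends.mono (Ends.loop (X := X)
    (fun s' => s'.nat 9 ≤ s.nat 0 + 1 ∧ s'.nat 0 = s.nat 0 ∧ s'.nat x = s.nat x ∧
      s'.nat y = s'.nat 9 * s.nat x)
    (fun s' => s.nat 0 + 1 - s'.nat 9) 1 le_rfl ?_ ?_ fun s' hF hJ hb =>
      Ends.straight rfl le_rfl ?_) le_rfl ?_)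
  · simp [effect, NExp.eval, hy.symm]; omega
  · simp [effect, NExp.eval, hy.symm, hy0.symm, hx, hxy]
  · obtain ⟨j1, j2, j3, j4⟩ := hJ
    simp only [Test.Holds, NExp.eval, j2] at hb
    simp [effect, NExp.eval, hy, hy.symm, hy0.symm, hx, hxy, j2, j3, j4, add_mul]
    omega
  · rintro s' ⟨⟨j1, j2, j3, j4⟩, hb⟩
    simp only [Test.Holds, NExp.eval, j2] at hb
    rw [j4, show s'.nat 9 = s.nat 0 + 1 by omega]

/-- Sets the registers `12`, `13`, `14` to `V + 1`, `(n + 1) (V + 1)`, `(n + 1)² (V + 1)`. -/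
def stridePhase : Program :=
  .seq (setNat 12 (.add (.reg 8) (.lit 1))) <| .seq (scaleLoop 12 13) (scaleLoop 13 14)

theorem stridePhase_ends {s : Store} {X : ℕ} (hX : s.nat 0 + 2 ≤ X) :
    Ends stridePhase s X (fun s' => s'.nat 12 = s.nat 8 + 1 ∧
      s'.nat 13 = (s.nat 0 + 1) * (s.nat 8 + 1) ∧
      s'.nat 14 = (s.nat 0 + 1) * ((s.nat 0 + 1) * (s.nat 8 + 1))) := by
  refine Ends.straight_seq rfl (by omega) (Ends.seq _ (scaleLoop_ends (by decide) (by decide)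
    (by decide) (by decide) ?_) fun s' hF h => Ends.mono (scaleLoop_ends (by decide) (by decide)
    (by decide) (by decide) ?_).withFrame le_rfl ?_)
  · simpa [effect] using hX
  · have h0 : s'.nat 0 = s.nat 0 := hF.nat 0 rfl
    rw [h0]; exact hX
  · rintro s'' ⟨hF'', h''⟩
    have h0 : s'.nat 0 = s.nat 0 := hF.nat 0 rfl
    have h12 : s''.nat 12 = s.nat 8 + 1 := by
      rw [hF''.nat 12 rfl, hF.nat 12 rfl]; simp [effect, NExp.eval]
    have h13 : s'.nat 13 = (s.nat 0 + 1) * (s.nat 8 + 1) := by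
      rw [h]; simp [effect, NExp.eval]
    exact ⟨h12, (hF''.nat 13 rfl).trans h13, by rw [h'', h13, h0]⟩

end RealRAM

/-! ### Addresses of table entries -/

/-- The address of an entry of the dynamic program. -/
def tableIndex (n V e g b r : ℕ) : ℕ := ((e * (n + 1) + g) * (n + 1) + b) * (V + 1) + r

theorem mul_add_inj {k x x' y y' : ℕ} (hy : y < k) (hy' : y' < k) (h : x * k + y = x' * k + y') :
    x = x' ∧ y = y' := by
  have hx : x = x' := by
    have h1 := congrArg (· / k) h
    simpa [Nat.add_comm (_ * k), Nat.add_mul_div_right _ _ (show 0 < k by omega),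
      Nat.div_eq_of_lt hy, Nat.div_eq_of_lt hy'] using h1
  subst hx
  exact ⟨rfl, by omega⟩

theorem tableIndex_inj {n V e g b r e' g' b' r' : ℕ} (hg : g ≤ n) (hb : b ≤ n) (hr : r ≤ V)
    (hg' : g' ≤ n) (hb' : b' ≤ n) (hr' : r' ≤ V)
    (h : tableIndex n V e g b r = tableIndex n V e' g' b' r') :
    e = e' ∧ g = g' ∧ b = b' ∧ r = r' := by
  obtain ⟨h1, h2⟩ := mul_add_inj (by omega) (by omega) h
  obtain ⟨h3, h4⟩ := mul_add_inj (by omega) (by omega) h1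
  obtain ⟨h5, h6⟩ := mul_add_inj (by omega) (by omega) h3
  exact ⟨h5, h6, h4, h2⟩

theorem tableIndex_leaf (n V e g b r : ℕ) :
    tableIndex n V e (g + 1) (b + 1) r - (n + 1) * (V + 1) - (V + 1) = tableIndex n V e g b r := by
  have : tableIndex n V e (g + 1) (b + 1) r =
      tableIndex n V e g b r + (V + 1) + (n + 1) * (V + 1) := by
    unfold tableIndex; ring
  omega

/-- Both predecessors of an entry are reached from its address by adding and subtracting stored
quantities, without multiplication. The stored multiple `b * (V + 1)` accounts for the doubling of
`b`. -/
theorem tableIndex_split (n V e g b r u : ℕ) :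
    tableIndex n V (e + 1) g b (r + u) + b * (V + 1) - (n + 1) * ((n + 1) * (V + 1)) - u =
      tableIndex n V e g (b + b) r := by
  have : tableIndex n V (e + 1) g b (r + u) + b * (V + 1) =
      tableIndex n V e g (b + b) r + u + (n + 1) * ((n + 1) * (V + 1)) := by
    unfold tableIndex; ring
  omega

theorem tableIndex_lt {n V e g b r H : ℕ} (he : e ≤ H) (hg : g ≤ n) (hb : b ≤ n) (hr : r ≤ V) :
    tableIndex n V e g b r < (H + 1) * ((n + 1) * ((n + 1) * (V + 1))) := by
  have h1 : e * (n + 1) + g < (H + 1) * (n + 1) := by nlinarith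
  have h2 : (e * (n + 1) + g) * (n + 1) + b < (H + 1) * (n + 1) * (n + 1) := by nlinarith
  have h3 : tableIndex n V e g b r < (H + 1) * (n + 1) * (n + 1) * (V + 1) := by
    unfold tableIndex; nlinarith
  calc _ < _ := h3
    _ = _ := by ring

/-! ### Filling the table -/

namespace RealRAM

open Program NExp RExp Test

theorem Program.effect_frame {p : Program} (hp : p.straight = true) (s : Store) :
    Frame p s (p.effect s) := by
  obtain ⟨t, h, -⟩ := Program.runs_effect hp s
  exact h.frame

/-- The address of the entry reached by turning the next character into a leaf. -/
def leafAddr : NExp := .sub (.sub (.reg 15) (.reg 13)) (.reg 12)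

/-- The address of the entry reached by splitting all available nodes. -/
def splitAddr : NExp := .sub (.sub (.add (.reg 15) (.reg 20)) (.reg 14)) (.get 5 (.reg 17))

/-- Tries to turn the next character into a leaf. -/
def leafCode : Program :=
  .ite (natLt (.lit 0) (.get 6 leafAddr))
    (.seq (setNat 21 (.lit 1)) (setReal 5 (.get 4 leafAddr))) .skip

/-- Tries to split all available nodes. -/
def splitCode : Program :=
  .ite (natLt (.lit 0) (.reg 16))
    (.ite (natLt (.add (.reg 18) (.reg 18)) (.add (.reg 17) (.lit 1)))
      (.ite (natLt (.get 5 (.reg 17)) (.add (.reg 19) (.lit 1)))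
        (.ite (natLt (.lit 0) (.get 6 splitAddr))
          (.seq (setReal 6 (.add (.mul (.get 3 (.sub (.reg 4) (.reg 16))) (.get 2 (.reg 17)))
            (.get 4 splitAddr)))
            (.ite (natLt (.reg 21) (.lit 1)) (.seq (setNat 21 (.lit 2)) (setReal 5 (.reg 6)))
              (.ite (realLt (.reg 6) (.reg 5)) (.seq (setNat 21 (.lit 2)) (setReal 5 (.reg 6)))
                .skip)))
          .skip)
        .skip)
      .skip)
    .skip

/-- Computes the current entry of the dynamic program. -/
def cellCode : Program :=
  .seq (setNat 21 (.lit 0)) <| .seq (setReal 5 (.lit 0)) <|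
  .seq (.ite (natLt (.lit 0) (.reg 17))
    (.ite (natLt (.lit 0) (.reg 18)) (.seq leafCode splitCode) .skip)
    (.ite (natLt (.lit 0) (.reg 18)) .skip (setNat 21 (.lit 1)))) <|
  .seq (putNat 6 (.reg 15) (.reg 21)) (putReal 4 (.reg 15) (.reg 5))

/-- Looked-up cells are assumed correct only under the conditions that the code tests beforehand;
elsewhere the truncated subtractions may yield meaningless addresses. -/
theorem cellCode_effect {s : Store} {t : ℕ → ℕ → ℕ → ℕ → ℕ × ℝ} {e g b r H : ℕ}
    (he : s.nat 16 = e) (hg : s.nat 17 = g) (hb : s.nat 18 = b) (hr : s.nat 19 = r)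
    (hH : s.nat 4 = H)
    (hleaf : 0 < g → 0 < b → s.natArr 6 (leafAddr.eval s) = (t e (g - 1) (b - 1) r).1 ∧
      s.realArr 4 (leafAddr.eval s) = (t e (g - 1) (b - 1) r).2)
    (hsplit : 0 < e → b + b ≤ g → s.natArr 5 g ≤ r →
      s.natArr 6 (splitAddr.eval s) = (t (e - 1) g (b + b) (r - s.natArr 5 g)).1 ∧
      s.realArr 4 (splitAddr.eval s) = (t (e - 1) g (b + b) (r - s.natArr 5 g)).2) :
    (cellCode.effect s).natArr 6 = Function.update (s.natArr 6) (s.nat 15)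
      (dpCell (s.realArr 2) (s.natArr 5) (s.realArr 3) H t e g b r).1 ∧
    (cellCode.effect s).realArr 4 = Function.update (s.realArr 4) (s.nat 15)
      (dpCell (s.realArr 2) (s.natArr 5) (s.realArr 3) H t e g b r).2 := by
  subst he hg hb hr hH
  simp only [leafAddr, splitAddr, NExp.eval] at hleaf hsplit
  by_cases cg : s.nat 17 = 0
  · by_cases cb : s.nat 18 = 0 <;>
      simp [cellCode, effect, NExp.eval, RExp.eval, Test.Holds, dpCell, cg, cb,
        Nat.pos_iff_ne_zero]
  by_cases cb : s.nat 18 = 0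
  · simp [cellCode, effect, NExp.eval, RExp.eval, Test.Holds, dpCell, cg, cb, Nat.pos_of_ne_zero cg]
  have cg' := Nat.pos_of_ne_zero cg
  have cb' := Nat.pos_of_ne_zero cb
  obtain ⟨l1, l2⟩ := hleaf cg' cb'
  generalize hx : t (s.nat 16) (s.nat 17 - 1) (s.nat 18 - 1) (s.nat 19) = x at l1 l2
  by_cases cs : 0 < s.nat 16 ∧ s.nat 18 + s.nat 18 ≤ s.nat 17 ∧ s.natArr 5 (s.nat 17) ≤ s.nat 19
  · obtain ⟨c1, c2, c3⟩ := cs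
    obtain ⟨m1, m2⟩ := hsplit c1 c2 c3
    generalize hy : t (s.nat 16 - 1) (s.nat 17) (s.nat 18 + s.nat 18)
      (s.nat 19 - s.natArr 5 (s.nat 17)) = y at m1 m2
    have c2' := Nat.lt_succ_of_le c2
    have c3' := Nat.lt_succ_of_le c3
    by_cases c4 : 0 < y.1 <;> by_cases c5 : 0 < x.1 <;>
      by_cases c6 : s.realArr 3 (s.nat 4 - s.nat 16) * s.realArr 2 (s.nat 17) + y.2 < x.2 <;>
      simp [cellCode, leafCode, splitCode, leafAddr, splitAddr, effect, NExp.eval, RExp.eval,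
        Test.Holds, dpCell, cg, cb, cg', cb', c1, c2, c3, c2', c3', c4, c5, c6, l1, l2, m1, m2,
        hx, hy]
  · have : ¬ (0 < s.nat 16 ∧ s.nat 18 + s.nat 18 ≤ s.nat 17 ∧
        s.natArr 5 (s.nat 17) ≤ s.nat 19 ∧ 0 < (t (s.nat 16 - 1) (s.nat 17)
          (s.nat 18 + s.nat 18) (s.nat 19 - s.natArr 5 (s.nat 17))).1 ∧
        ((if 0 < x.1 then ((1, x.2) : ℕ × ℝ) else (0, 0)).1 = 0 ∨
          s.realArr 3 (s.nat 4 - s.nat 16) * s.realArr 2 (s.nat 17) +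
          (t (s.nat 16 - 1) (s.nat 17) (s.nat 18 + s.nat 18)
            (s.nat 19 - s.natArr 5 (s.nat 17))).2 <
            (if 0 < x.1 then ((1, x.2) : ℕ × ℝ) else (0, 0)).2)) :=
      fun h => cs ⟨h.1, h.2.1, h.2.2.1⟩
    rw [dpCell, if_neg cg, if_neg cb, hx]
    simp only [this, if_false]
    by_cases c5 : 0 < x.1 <;> by_cases c1 : 0 < s.nat 16 <;>
      by_cases c2 : s.nat 18 + s.nat 18 ≤ s.nat 17 <;>
      by_cases c3 : s.natArr 5 (s.nat 17) ≤ s.nat 19 <;>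
      first
      | exfalso; omega
      | simp [cellCode, leafCode, splitCode, leafAddr, effect, NExp.eval, RExp.eval,
          Test.Holds, Order.lt_add_one_iff, cg', cb', c1, c2, c3, c5, l1, l2]

/-- Moves on to the next entry of the dynamic program. -/
def advanceCode : Program :=
  .seq (setNat 15 (.add (.reg 15) (.lit 1))) <| .seq (setNat 19 (.add (.reg 19) (.lit 1))) <|
  .ite (natLt (.reg 19) (.reg 12)) .skip <|
  .seq (setNat 19 (.lit 0)) <| .seq (setNat 18 (.add (.reg 18) (.lit 1))) <|
  .seq (setNat 20 (.add (.reg 20) (.reg 12))) <|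
  .ite (natLt (.reg 18) (.add (.reg 0) (.lit 1))) .skip <|
  .seq (setNat 18 (.lit 0)) <| .seq (setNat 20 (.lit 0)) <|
  .seq (setNat 17 (.add (.reg 17) (.lit 1))) <|
  .ite (natLt (.reg 17) (.add (.reg 0) (.lit 1))) .skip <|
  .seq (setNat 17 (.lit 0)) <| setNat 16 (.add (.reg 16) (.lit 1))

/-- The registers describing the current entry of the dynamic program. -/
structure AtEntry (n V : ℕ) (s : Store) (e g b r : ℕ) : Prop where
  reg_e : s.nat 16 = e
  reg_g : s.nat 17 = g
  reg_b : s.nat 18 = b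
  reg_r : s.nat 19 = r
  reg_p : s.nat 15 = tableIndex n V e g b r
  reg_bs : s.nat 20 = b * (V + 1)
  hg : g ≤ n
  hb : b ≤ n
  hr : r ≤ V

/-- A mixed-radix counter with carries from `r` to `b` to `g` to `e`; the successive cases are the
lengths of the carry. -/
theorem advanceCode_effect {n V : ℕ} {s : Store} {e g b r : ℕ} (h : AtEntry n V s e g b r)
    (hn : s.nat 0 = n) (hV : s.nat 12 = V + 1) :
    ∃ e' g' b' r', AtEntry n V (advanceCode.effect s) e' g' b' r' ∧
      tableIndex n V e' g' b' r' = tableIndex n V e g b r + 1 := by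
  obtain ⟨h1, h2, h3, h4, h5, h6, hg, hb, hr⟩ := h
  by_cases c1 : r + 1 < V + 1
  · refine ⟨e, g, b, r + 1, ?_, by unfold tableIndex; ring⟩
    constructor <;> first
      | omega
      | simp [advanceCode, effect, NExp.eval, Test.Holds, h1, h2, h3, h4, h5, h6, hV, c1, tableIndex,
          add_assoc]
  have hr' : r = V := by omega
  by_cases c2 : b + 1 < n + 1
  · have hi : tableIndex n V e g (b + 1) 0 = tableIndex n V e g b r + 1 := by
      subst hr'; unfold tableIndex; ring
    refine ⟨e, g, b + 1, 0, ?_, hi⟩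
    constructor <;> first
      | omega
      | simp [advanceCode, effect, NExp.eval, Test.Holds, h1, h2, h3, h4, h5, h6, hV, hn, c1, c2,
          hi, add_mul]
  have hb' : b = n := by omega
  by_cases c3 : g + 1 < n + 1
  · have hi : tableIndex n V e (g + 1) 0 0 = tableIndex n V e g b r + 1 := by
      subst hr' hb'; unfold tableIndex; ring
    refine ⟨e, g + 1, 0, 0, ?_, hi⟩
    constructor <;> first
      | omega
      | simp [advanceCode, effect, NExp.eval, Test.Holds, h1, h2, h3, h4, h5, h6, hV, hn, c1, c2,
          c3, hi]
  have hg' : g = n := by omega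
  have hi : tableIndex n V (e + 1) 0 0 0 = tableIndex n V e g b r + 1 := by
    rw [hr', hb', hg']; unfold tableIndex; ring
  refine ⟨e + 1, 0, 0, 0, ?_, hi⟩
  constructor <;> first
    | omega
    | simp [advanceCode, effect, NExp.eval, Test.Holds, h1, h2, h3, h4, h5, h6, hV, hn, c1, c2,
        c3, hi]

/-- Fills the table of the dynamic program. -/
def tablePhase : Program :=
  .seq (.seq (setNat 15 (.lit 0)) <| .seq (setNat 16 (.lit 0)) <| .seq (setNat 17 (.lit 0)) <|
    .seq (setNat 18 (.lit 0)) <| .seq (setNat 19 (.lit 0)) (setNat 20 (.lit 0))) <|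
  .loop (natLt (.reg 16) (.add (.reg 4) (.lit 1))) (.seq cellCode advanceCode)

/-- The table is correct below the address `p`. -/
def TableCorrect (n V : ℕ) (t : ℕ → ℕ → ℕ → ℕ → ℕ × ℝ) (s : Store) (p : ℕ) : Prop :=
  ∀ e g b r, g ≤ n → b ≤ n → r ≤ V → tableIndex n V e g b r < p →
    s.natArr 6 (tableIndex n V e g b r) = (t e g b r).1 ∧
    s.realArr 4 (tableIndex n V e g b r) = (t e g b r).2

/-- Addresses increase lexicographically in `(e, g, b, r)`. The leaf predecessor has the same `e`
and smaller `g`, the split predecessor has smaller `e`, so both are already filled. -/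
theorem tablePhase_ends {s : Store} {n V H : ℕ} (hn : s.nat 0 = n) (hV : s.nat 12 = V + 1)
    (h13 : s.nat 13 = (n + 1) * (V + 1)) (h14 : s.nat 14 = (n + 1) * ((n + 1) * (V + 1)))
    (hH : s.nat 4 = H) {X : ℕ} (hX : (H + 1) * ((n + 1) * ((n + 1) * (V + 1))) + 1 ≤ X) :
    Ends tablePhase s X (fun s' => s'.nat 15 = (H + 1) * ((n + 1) * ((n + 1) * (V + 1))) ∧
      TableCorrect n V (dpTable (s.realArr 2) (s.natArr 5) (s.realArr 3) H) s'
        ((H + 1) * ((n + 1) * ((n + 1) * (V + 1))))) := by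
  set N := (H + 1) * ((n + 1) * ((n + 1) * (V + 1))) with hN
  set t := dpTable (s.realArr 2) (s.natArr 5) (s.realArr 3) H with ht
  have hend : tableIndex n V (H + 1) 0 0 0 = N := by rw [hN]; unfold tableIndex; ring
  refine Ends.straight_seq rfl (by omega) (Ends.mono (Ends.loop (X := X)
    (fun s' => TableCorrect n V t s' (s'.nat 15) ∧ s'.nat 15 ≤ N ∧
      ∃ e g b r, AtEntry n V s' e g b r)
    (fun s' => N - s'.nat 15) 1 le_rfl ?_ ?_ fun s' hF hJ hb =>
      Ends.straight rfl le_rfl ?_).withFrame le_rfl ?_)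
  · simp [effect, NExp.eval]; omega
  · refine ⟨?_, ?_, 0, 0, 0, 0, ?_⟩
    · intro e g b r _ _ _ hlt
      simp [effect, NExp.eval] at hlt
    · simp [effect, NExp.eval]
    · constructor <;> simp [effect, NExp.eval, tableIndex]
  · obtain ⟨hT, hle, e, g, b, r, hE⟩ := hJ
    have g0 : s'.nat 0 = n := (hF.nat 0 rfl).trans hn
    have g4 : s'.nat 4 = H := (hF.nat 4 rfl).trans hH
    have g12 : s'.nat 12 = V + 1 := (hF.nat 12 rfl).trans hV
    have g13 : s'.nat 13 = (n + 1) * (V + 1) := (hF.nat 13 rfl).trans h13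
    have g14 : s'.nat 14 = (n + 1) * ((n + 1) * (V + 1)) := (hF.nat 14 rfl).trans h14
    have gS : s'.realArr 2 = s.realArr 2 := hF.realArr 2 rfl
    have gu : s'.natArr 5 = s.natArr 5 := hF.natArr 5 rfl
    have gi : s'.realArr 3 = s.realArr 3 := hF.realArr 3 rfl
    simp only [Test.Holds, NExp.eval, hE.reg_e, g4] at hb
    have hcell := cellCode_effect (t := t) hE.reg_e hE.reg_g hE.reg_b hE.reg_r g4
      (fun hg hb => by
        obtain ⟨g, rfl⟩ : ∃ g', g = g' + 1 := ⟨g - 1, by omega⟩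
        obtain ⟨b, rfl⟩ : ∃ b', b = b' + 1 := ⟨b - 1, by omega⟩
        have h1 := hE.hg
        have h2 := hE.hb
        have haddr : leafAddr.eval s' = tableIndex n V e g b r := by
          simp only [leafAddr, NExp.eval, hE.reg_p, g12, g13, tableIndex_leaf]
        rw [haddr]
        refine hT e g b r (by omega) (by omega) hE.hr ?_
        rw [hE.reg_p, ← haddr]
        simp only [leafAddr, NExp.eval, hE.reg_p, g12]
        have : 0 < tableIndex n V e (g + 1) (b + 1) r := by unfold tableIndex; positivity
        omega)
      (fun he hbg hur => by
        obtain ⟨e, rfl⟩ : ∃ e', e = e' + 1 := ⟨e - 1, by omega⟩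
        obtain ⟨r', hr'⟩ : ∃ r', r = r' + s'.natArr 5 g := ⟨r - s'.natArr 5 g, by omega⟩
        have h1 := hE.hg
        have h2 := hE.hr
        have haddr : splitAddr.eval s' = tableIndex n V e g (b + b) r' := by
          simp only [splitAddr, NExp.eval, hE.reg_p, hE.reg_bs, hE.reg_g, g14, hr',
            tableIndex_split]
        rw [haddr, hr', Nat.add_sub_cancel, Nat.add_sub_cancel]
        refine hT e g (b + b) r' h1 (by omega) (by omega) ?_
        rw [hE.reg_p]
        -- All entries with a smaller first index precede the current one, whatever their other
        -- coordinates in range.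
        have hb' := hE.hb
        unfold tableIndex
        nlinarith)
    have hcell1 : dpCell (s'.realArr 2) (s'.natArr 5) (s'.realArr 3) H t e g b r = t e g b r := by
      rw [gS, gu, gi, ht, ← dpTable_eq]
    rw [hcell1] at hcell
    set s₁ := cellCode.effect s' with hs₁
    have hF₁ : Frame cellCode s' s₁ := Program.effect_frame rfl s'
    have hE₁ : AtEntry n V s₁ e g b r := by
      refine ⟨?_, ?_, ?_, ?_, ?_, ?_, hE.hg, hE.hb, hE.hr⟩
      · exact (hF₁.nat 16 rfl).trans hE.reg_e
      · exact (hF₁.nat 17 rfl).trans hE.reg_g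
      · exact (hF₁.nat 18 rfl).trans hE.reg_b
      · exact (hF₁.nat 19 rfl).trans hE.reg_r
      · exact (hF₁.nat 15 rfl).trans hE.reg_p
      · exact (hF₁.nat 20 rfl).trans hE.reg_bs
    obtain ⟨e', g', b', r', hE', hi⟩ := advanceCode_effect hE₁ ((hF₁.nat 0 rfl).trans g0)
      ((hF₁.nat 12 rfl).trans g12)
    have hF₂ : Frame advanceCode s₁ (advanceCode.effect s₁) := Program.effect_frame rfl s₁
    have hlt := tableIndex_lt (Nat.lt_succ_iff.1 hb) hE.hg hE.hb hE.hr
    rw [← hN] at hlt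
    change (TableCorrect n V t (advanceCode.effect s₁) ((advanceCode.effect s₁).nat 15) ∧
      (advanceCode.effect s₁).nat 15 ≤ N ∧ ∃ e g b r, AtEntry n V (advanceCode.effect s₁) e g b r) ∧
      N - (advanceCode.effect s₁).nat 15 < N - s'.nat 15
    rw [hE'.reg_p, hi, hE.reg_p]
    refine ⟨⟨fun e₀ g₀ b₀ r₀ hg₀ hb₀ hr₀ hlt₀ => ?_, by omega, _, _, _, _, hE'⟩, by omega⟩
    rw [hF₂.natArr 6 rfl, hF₂.realArr 4 rfl, hcell.1, hcell.2, hE.reg_p]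
    rcases Nat.lt_succ_iff_lt_or_eq.1 hlt₀ with hlt₀ | heq
    · rw [Function.update_of_ne hlt₀.ne, Function.update_of_ne hlt₀.ne]
      exact hT e₀ g₀ b₀ r₀ hg₀ hb₀ hr₀ (by rw [hE.reg_p]; exact hlt₀)
    · obtain ⟨rfl, rfl, rfl, rfl⟩ := tableIndex_inj hg₀ hb₀ hr₀ hE.hg hE.hb hE.hr heq
      rw [Function.update_self, Function.update_self]
      exact ⟨rfl, rfl⟩
  · rintro s' ⟨hF, ⟨hT, hle, e, g, b, r, hE⟩, hb⟩
    have g4 : s'.nat 4 = H := (hF.nat 4 rfl).trans hH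
    simp only [Test.Holds, NExp.eval, hE.reg_e, g4] at hb
    have hge : N ≤ s'.nat 15 := by
      rw [hE.reg_p, ← hend]
      have : H + 1 ≤ e := by omega
      calc tableIndex n V (H + 1) 0 0 0 ≤ tableIndex n V e 0 0 0 := by unfold tableIndex; gcongr
        _ ≤ tableIndex n V e g b r := by unfold tableIndex; gcongr <;> omega
    have heq : s'.nat 15 = N := le_antisymm hle hge
    rw [heq] at hT
    exact ⟨heq, hT⟩

end RealRAM

/-! ### Building the tree from the choices of the dynamic program -/

theorem Finset.sum_range_two_mul' {M : Type*} [AddCommMonoid M] (x : ℕ → M) (b : ℕ) :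
    ∑ i ∈ range (b + b), x i = ∑ i ∈ range b, (x (2 * i) + x (2 * i + 1)) := by
  induction b with
  | zero => simp
  | succ b ih =>
    rw [show b + 1 + (b + 1) = b + b + 1 + 1 by ring, Finset.sum_range_succ, Finset.sum_range_succ,
      ih, Finset.sum_range_succ, add_assoc, ← two_mul]

namespace RealRAM

open Program NExp RExp Test

/-- Unfolds a loop once. The construction of the tree is analysed by induction along the recursion
of the table, because its result is described from the end backwards. -/
theorem Ends.loop_step {b : Test} {p : Program} {s : Store} {Y X : ℕ} {Q : Store → Prop}
    (R : Store → Prop) (hY : 1 ≤ Y) (hb : b.Holds s) (h : Ends p s Y R)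
    (h' : ∀ s', Frame p s s' → R s' → Ends (.loop b p) s' X Q) :
    Ends (.loop b p) s (Y + X) Q := by
  obtain ⟨t, s', hr, ht, hR⟩ := h
  obtain ⟨t', s'', hr', ht', hQ⟩ := h' s' hr.frame hR
  refine ⟨_, s'', .loop_true hb hr hr', ?_, hQ⟩
  have hc : b.cost + 1 ≤ (b.cost + 1) * Y := Nat.le_mul_of_pos_right _ hY
  have hs : (Program.loop b p).size * Y = (b.cost + 1) * Y + p.size * Y := by
    rw [Program.size, Nat.add_mul]
  rw [Nat.mul_add]
  omega

theorem Ends.loop_done {b : Test} {p : Program} {s : Store} {X : ℕ} {Q : Store → Prop}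
    (hX : 1 ≤ X) (hb : ¬ b.Holds s) (h : Q s) : Ends (.loop b p) s X Q := by
  refine ⟨_, s, .loop_false hb, ?_, h⟩
  calc b.cost + 1 ≤ (Program.loop b p).size := by rw [Program.size]; omega
    _ ≤ _ := Nat.le_mul_of_pos_right _ hX

/-- Gives two new children to each of the `[register 18]` nodes starting at `[register 22]`. -/
def childLoop : Program :=
  .seq (setNat 9 (.lit 0)) <|
  .loop (natLt (.reg 9) (.reg 18)) <|
    .seq (putNat 2 (.reg 22) (.reg 23)) <| .seq (putNat 3 (.reg 22) (.add (.reg 23) (.lit 1))) <|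
    .seq (setNat 23 (.add (.reg 23) (.lit 2))) <| .seq (setNat 22 (.add (.reg 22) (.lit 1)))
      (setNat 9 (.add (.reg 9) (.lit 1)))

theorem childLoop_ends {s : Store} {X : ℕ} (hX : s.nat 18 + 1 ≤ X) :
    Ends childLoop s X (fun s' => s'.nat 22 = s.nat 22 + s.nat 18 ∧
      (∀ a < s.nat 22, s'.natArr 2 a = s.natArr 2 a ∧ s'.natArr 3 a = s.natArr 3 a) ∧
      ∀ i < s.nat 18, s'.natArr 2 (s.nat 22 + i) = s.nat 23 + 2 * i ∧
        s'.natArr 3 (s.nat 22 + i) = s.nat 23 + (2 * i + 1)) := by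
  refine Ends.straight_seq rfl (by omega) (Ends.mono (Ends.loop (X := X)
    (fun s' => s'.nat 9 ≤ s.nat 18 ∧ s'.nat 22 = s.nat 22 + s'.nat 9 ∧
      s'.nat 23 = s.nat 23 + 2 * s'.nat 9 ∧
      (∀ a < s.nat 22, s'.natArr 2 a = s.natArr 2 a ∧ s'.natArr 3 a = s.natArr 3 a) ∧
      ∀ i < s'.nat 9, s'.natArr 2 (s.nat 22 + i) = s.nat 23 + 2 * i ∧
        s'.natArr 3 (s.nat 22 + i) = s.nat 23 + (2 * i + 1))
    (fun s' => s.nat 18 - s'.nat 9) 1 le_rfl ?_ ?_ fun s' hF hJ hb =>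
      Ends.straight rfl le_rfl ?_).withFrame le_rfl ?_)
  · simp [effect, NExp.eval]; omega
  · simp [effect, NExp.eval]
  · obtain ⟨j1, j2, j3, j4, j5⟩ := hJ
    have h18 : s'.nat 18 = s.nat 18 := hF.nat 18 rfl
    simp only [Test.Holds, NExp.eval, h18] at hb
    simp [effect, NExp.eval, j2, j3]
    refine ⟨⟨by omega, by omega, by omega, fun a ha => ?_, fun i hi => ?_⟩, by omega⟩
    · rw [Function.update_of_ne (by omega), Function.update_of_ne (by omega)]
      exact j4 a ha
    · rcases Nat.lt_or_eq_of_le hi with hi | rfl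
      · rw [Function.update_of_ne (by omega), Function.update_of_ne (by omega)]
        exact j5 i hi
      · simp [add_assoc]
  · rintro s' ⟨hF, ⟨j1, j2, j3, j4, j5⟩, hb⟩
    have h18 : s'.nat 18 = s.nat 18 := hF.nat 18 rfl
    simp only [Test.Holds, NExp.eval, h18] at hb
    have he : s'.nat 9 = s.nat 18 := by omega
    rw [he] at j2 j5
    exact ⟨j2, j4, j5⟩

/-- The first available node becomes a leaf with the next character. -/
def leafMove : Program :=
  .seq (putNat 1 (.reg 22) (.add (.get 4 (.sub (.reg 17) (.lit 1))) (.lit 1))) <|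
  .seq (setNat 15 leafAddr) <| .seq (setNat 22 (.add (.reg 22) (.lit 1))) <|
  .seq (setNat 18 (.sub (.reg 18) (.lit 1))) <| .seq (setNat 17 (.sub (.reg 17) (.lit 1)))
    (setNat 20 (.sub (.reg 20) (.reg 12)))

/-- All available nodes are split. -/
def splitMove : Program :=
  .seq (.seq (setNat 15 splitAddr) (setNat 23 (.add (.reg 22) (.reg 18)))) <|
  .seq childLoop <|
  .seq (setNat 18 (.add (.reg 18) (.reg 18))) (setNat 20 (.add (.reg 20) (.reg 20)))

/-- Builds the tree by following the choices of the dynamic program. -/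
def buildLoop : Program :=
  .loop (natLt (.lit 0) (.reg 17)) (.ite (natLt (.get 6 (.reg 15)) (.lit 2)) leafMove splitMove)

/-- The registers during the construction of the tree. -/
structure AtBuild (n V H : ℕ) (u : ℕ → ℕ) (t : ℕ → ℕ → ℕ → ℕ → ℕ × ℝ) (ch : ℕ → Fin n) (s : Store)
    (e g b r : ℕ) : Prop where
  reg_g : s.nat 17 = g
  reg_b : s.nat 18 = b
  reg_p : s.nat 15 = tableIndex n V e g b r
  reg_bs : s.nat 20 = b * (V + 1)
  reg_sb : s.nat 12 = V + 1
  reg_sg : s.nat 13 = (n + 1) * (V + 1)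
  reg_se : s.nat 14 = (n + 1) * ((n + 1) * (V + 1))
  units : s.natArr 5 = u
  chars : ∀ i < n, s.natArr 4 i = ch i
  table : TableCorrect n V t s ((H + 1) * ((n + 1) * ((n + 1) * (V + 1))))
  fresh : ∀ a, s.nat 22 ≤ a → s.natArr 1 a = 0
  he : e ≤ H
  hg : g ≤ n
  hb : b ≤ n
  hr : r ≤ V

theorem AtBuild.choice {n V H : ℕ} {u : ℕ → ℕ} {t : ℕ → ℕ → ℕ → ℕ → ℕ × ℝ} {ch : ℕ → Fin n}
    {s : Store} {e g b r : ℕ} (h : AtBuild n V H u t ch s e g b r) :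
    s.natArr 6 (s.nat 15) = (t e g b r).1 := by
  rw [h.reg_p]
  exact (h.table e g b r h.hg h.hb h.hr (tableIndex_lt h.he h.hg h.hb h.hr)).1

theorem leafMove_ends {n V H : ℕ} {u : ℕ → ℕ} {t : ℕ → ℕ → ℕ → ℕ → ℕ × ℝ} {ch : ℕ → Fin n}
    {s : Store} {e g b r : ℕ} (h : AtBuild n V H u t ch s e (g + 1) (b + 1) r) {X : ℕ}
    (hX : 1 ≤ X) :
    Ends leafMove s X (fun s' => AtBuild n V H u t ch s' e g b r ∧ s'.nat 22 = s.nat 22 + 1 ∧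
      s'.natArr 1 (s.nat 22) = ch g + 1 ∧ (∀ a < s.nat 22, s'.natArr 1 a = s.natArr 1 a) ∧
      s'.natArr 2 = s.natArr 2 ∧ s'.natArr 3 = s.natArr 3) := by
  refine Ends.straight rfl hX ?_
  have hF : Frame leafMove s (leafMove.effect s) := Program.effect_frame rfl s
  have hg := h.hg
  have hb := h.hb
  have h1 : (leafMove.effect s).natArr 1 =
      Function.update (s.natArr 1) (s.nat 22) (ch g + 1) := by
    simp [leafMove, effect, NExp.eval, h.reg_g, h.chars g (by omega)]
  have h22 : (leafMove.effect s).nat 22 = s.nat 22 + 1 := by simp [leafMove, effect, NExp.eval]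
  refine ⟨⟨?_, ?_, ?_, ?_, ?_, ?_, ?_, ?_, ?_, ?_, ?_, h.he, by omega, by omega, h.hr⟩, h22, ?_, ?_,
    hF.natArr 2 rfl, hF.natArr 3 rfl⟩
  · simp [leafMove, effect, NExp.eval, h.reg_g]
  · simp [leafMove, effect, NExp.eval, h.reg_b]
  · simp [leafMove, leafAddr, effect, NExp.eval, h.reg_p, h.reg_sg, h.reg_sb, tableIndex_leaf]
  · simp [leafMove, effect, NExp.eval, h.reg_bs, h.reg_sb, Nat.succ_mul]
  · exact (hF.nat 12 rfl).trans h.reg_sb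
  · exact (hF.nat 13 rfl).trans h.reg_sg
  · exact (hF.nat 14 rfl).trans h.reg_se
  · exact (hF.natArr 5 rfl).trans h.units
  · rw [hF.natArr 4 rfl]; exact h.chars
  · unfold TableCorrect
    rw [hF.natArr 6 rfl, hF.realArr 4 rfl]
    exact h.table
  · intro a ha
    rw [h22] at ha
    rw [h1, Function.update_of_ne (by omega)]
    exact h.fresh a (by omega)
  · rw [h1, Function.update_self]
  · intro a ha
    rw [h1, Function.update_of_ne (by omega)]

theorem splitMove_ends {n V H : ℕ} {u : ℕ → ℕ} {t : ℕ → ℕ → ℕ → ℕ → ℕ × ℝ} {ch : ℕ → Fin n}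
    {s : Store} {e g b r : ℕ} (h : AtBuild n V H u t ch s (e + 1) g b r) (hbg : b + b ≤ g)
    (hur : u g ≤ r) {X : ℕ} (hX : n + 1 ≤ X) :
    Ends splitMove s X (fun s' => AtBuild n V H u t ch s' e g (b + b) (r - u g) ∧
      s'.nat 22 = s.nat 22 + b ∧ s'.natArr 1 = s.natArr 1 ∧
      (∀ a < s.nat 22, s'.natArr 2 a = s.natArr 2 a ∧ s'.natArr 3 a = s.natArr 3 a) ∧
      ∀ i < b, s'.natArr 2 (s.nat 22 + i) = s.nat 22 + b + 2 * i ∧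
        s'.natArr 3 (s.nat 22 + i) = s.nat 22 + b + (2 * i + 1)) := by
  have hg := h.hg
  have hb := h.hb
  have he := h.he
  have hr := h.hr
  refine Ends.mono (Ends.straight_seq rfl (X := X) (by omega)
    (Ends.seq _ (childLoop_ends ?_) fun s' hF h' =>
    Ends.straight rfl (by omega) (Q := fun s'' => s''.nat 18 = b + b ∧
      s''.nat 20 = (b + b) * (V + 1) ∧ s''.nat 22 = s.nat 22 + b ∧
      s''.nat 15 = tableIndex n V e g (b + b) (r - u g) ∧
      (∀ a < s.nat 22, s''.natArr 2 a = s.natArr 2 a ∧ s''.natArr 3 a = s.natArr 3 a) ∧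
      ∀ i < b, s''.natArr 2 (s.nat 22 + i) = s.nat 22 + b + 2 * i ∧
        s''.natArr 3 (s.nat 22 + i) = s.nat 22 + b + (2 * i + 1)) ?_)).withFrame le_rfl ?_
  · simp [effect, h.reg_b]; omega
  · obtain ⟨k1, k2, k3⟩ := h'
    have k18 : s'.nat 18 = s.nat 18 := by rw [hF.nat 18 rfl]; simp [effect]
    have k20 : s'.nat 20 = s.nat 20 := by rw [hF.nat 20 rfl]; simp [effect]
    have k15 : s'.nat 15 = splitAddr.eval s := by rw [hF.nat 15 rfl]; simp [effect]
    have haddr : splitAddr.eval s = tableIndex n V e g (b + b) (r - u g) := by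
      obtain ⟨r', rfl⟩ : ∃ r', r = r' + u g := ⟨r - u g, by omega⟩
      rw [Nat.add_sub_cancel, ← tableIndex_split n V e g b r' (u g)]
      simp [splitAddr, NExp.eval, h.reg_p, h.reg_bs, h.reg_se, h.reg_g, h.units]
    simp [effect, NExp.eval, h.reg_b] at k1 k2 k3
    simp only [effect, NExp.eval]
    refine ⟨?_, ?_, ?_, ?_, k2, k3⟩
    · simp [k18, h.reg_b]
    · simp [k20, h.reg_bs, add_mul]
    · simpa using k1
    · simp [k15, haddr]
  · rintro s' ⟨hF, k18, k20, k22, k15, k2, k3⟩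
    have hA1 : s'.natArr 1 = s.natArr 1 := hF.natArr 1 rfl
    refine ⟨⟨?_, k18, k15, k20, ?_, ?_, ?_, ?_, ?_, ?_, ?_, by omega, hg, by omega, by omega⟩, k22,
      hA1, k2, k3⟩
    · exact (hF.nat 17 rfl).trans h.reg_g
    · exact (hF.nat 12 rfl).trans h.reg_sb
    · exact (hF.nat 13 rfl).trans h.reg_sg
    · exact (hF.nat 14 rfl).trans h.reg_se
    · exact (hF.natArr 5 rfl).trans h.units
    · rw [hF.natArr 4 rfl]; exact h.chars
    · unfold TableCorrect
      rw [hF.natArr 6 rfl, hF.realArr 4 rfl]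
      exact h.table
    · intro a ha
      rw [hA1]
      exact h.fresh a (by omega)

/-- The store holds a forest of `b` trees, at the addresses from `p` on and at the depth `H - e`,
with the characters `ch 0, …, ch (g - 1)`, of decode time `D` and code length at most `K`. -/
def HoldsForest {n : ℕ} (ch : ℕ → Fin n) (f : Fin n → ℝ) (Q : ℕ → ℝ) (H : ℕ) (s : Store)
    (p e g b : ℕ) (D K : ℝ) : Prop :=
  ∃ ts : ℕ → CodeTree (Fin n), (∀ i < b, s.HoldsTree (p + i) (ts i)) ∧
    (∀ i < b, (ts i).height ≤ e) ∧
    (∑ i ∈ range b, ((ts i).leaves : Multiset (Fin n))) = ∑ i ∈ range g, {ch i} ∧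
    ∑ i ∈ range b, (ts i).leafSum (fun d c => f c * Q d) (H - e) = D ∧
    ∑ i ∈ range b, (ts i).leafSum (fun d c => f c * (d : ℝ)) (H - e) ≤ K

theorem HoldsForest.leaf {n : ℕ} {ch : ℕ → Fin n} {f : Fin n → ℝ} {Q : ℕ → ℝ} {H : ℕ} {s : Store}
    {p e g b : ℕ} {D K : ℝ} (h : HoldsForest ch f Q H s (p + 1) e g b D K)
    (hp : s.natArr 1 p = ch g + 1) :
    HoldsForest ch f Q H s p e (g + 1) (b + 1) (D + f (ch g) * Q (H - e))
      (K + f (ch g) * ((H - e : ℕ) : ℝ)) := by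
  obtain ⟨ts, h1, h2, h3, h4, h5⟩ := h
  refine ⟨fun i => if i = 0 then .leaf (ch g) else ts (i - 1), fun i hi => ?_, fun i hi => ?_, ?_,
    ?_, ?_⟩
  · rcases Nat.eq_zero_or_pos i with rfl | hpos
    · simpa [Store.HoldsTree] using hp
    · have := h1 (i - 1) (by omega)
      rw [show p + 1 + (i - 1) = p + i by omega] at this
      simpa [hpos.ne'] using this
  · rcases Nat.eq_zero_or_pos i with rfl | hpos
    · simp [CodeTree.height]
    · simpa [hpos.ne'] using h2 (i - 1) (by omega)
  · rw [Finset.sum_range_succ', Finset.sum_range_succ, ← h3]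
    simp [CodeTree.leaves]
  · rw [Finset.sum_range_succ', ← h4]
    simp [CodeTree.leafSum]
  · rw [Finset.sum_range_succ']
    simpa [CodeTree.leafSum] using h5

theorem HoldsForest.split {n : ℕ} {ch : ℕ → Fin n} {f : Fin n → ℝ} {Q : ℕ → ℝ} {H : ℕ} {s : Store}
    {p e g b : ℕ} {D K : ℝ} (he : e + 1 ≤ H) (h : HoldsForest ch f Q H s (p + b) e g (b + b) D K)
    (h1 : ∀ i < b, s.natArr 1 (p + i) = 0)
    (h2 : ∀ i < b, s.natArr 2 (p + i) = p + b + 2 * i ∧ s.natArr 3 (p + i) = p + b + (2 * i + 1)) :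
    HoldsForest ch f Q H s p (e + 1) g b D K := by
  obtain ⟨ts, k1, k2, k3, k4, k5⟩ := h
  have hsub : H - (e + 1) + 1 = H - e := by omega
  refine ⟨fun i => .node (ts (2 * i)) (ts (2 * i + 1)), fun i hi => ?_, fun i hi => ?_, ?_, ?_, ?_⟩
  · refine ⟨h1 i hi, ?_, ?_⟩
    · rw [(h2 i hi).1]; exact k1 _ (by omega)
    · rw [(h2 i hi).2]; exact k1 _ (by omega)
  · have := k2 (2 * i) (by omega)
    have := k2 (2 * i + 1) (by omega)
    simp only [CodeTree.height]
    omega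
  · rw [← k3, Finset.sum_range_two_mul']
    simp only [CodeTree.leaves, Multiset.coe_add]
  · rw [← k4, Finset.sum_range_two_mul']
    simp only [CodeTree.leafSum, hsub]
  · refine le_trans (le_of_eq ?_) k5
    rw [Finset.sum_range_two_mul']
    simp only [CodeTree.leafSum, hsub]

/-- Nodes form a queue: leaves are taken from its front, and a split of all `b` nodes is followed by
their `2 * b` children. The trees are read off in the final store, so cells below the front must be
preserved. In the bound for the code length, `r` is the remaining budget and `e` allows one unit of
rounding error for each split that may still come. -/
theorem buildLoop_ends {n V H : ℕ} {u : ℕ → ℕ} {ch : ℕ → Fin n} {S inc : ℕ → ℝ} {f : Fin n → ℝ}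
    {Q : ℕ → ℝ} {unit : ℝ} (hS : ∀ g ≤ n, S g = ∑ i ∈ range g, f (ch i))
    (hinc : ∀ d < H, inc d = Q (d + 1) - Q d)
    (hu : ∀ g, 0 < g → g ≤ n → u g ≤ V → S g ≤ (u g + 1) * unit) (hunit : 0 ≤ unit) :
    ∀ (k e g b r : ℕ) (s : Store), e + g = k →
      AtBuild n V H u (dpTable S u inc H) ch s e g b r →
      0 < (dpTable S u inc H e g b r).1 →
      Ends buildLoop s ((k + 1) * (n + 1)) (fun s' =>
        (∀ a < s.nat 22, s'.natArr 1 a = s.natArr 1 a ∧ s'.natArr 2 a = s.natArr 2 a ∧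
          s'.natArr 3 a = s.natArr 3 a) ∧
        HoldsForest ch f Q H s' (s.nat 22) e g b
          (Q (H - e) * S g + (dpTable S u inc H e g b r).2)
          (((H - e : ℕ) : ℝ) * S g + (r + e) * unit)) := by
  intro k
  induction k using Nat.strong_induction_on with
  | _ k ih =>
  intro e g b r s hk h hfeas
  have hgn := h.hg
  rcases Nat.eq_zero_or_pos g with rfl | hgpos
  · rw [dpTable_zero] at hfeas ⊢
    have hb0 : b = 0 := by
      by_contra hb
      simp [hb] at hfeas
    subst hb0
    refine Ends.loop_done (by nlinarith) (by simp [Test.Holds, NExp.eval, h.reg_g])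
      ⟨fun _ _ => ⟨rfl, rfl, rfl⟩, fun _ => .leaf (ch 0), by simp, by simp, by simp, ?_, ?_⟩
    · simp [hS 0 (Nat.zero_le n)]
    · simp only [hS 0 (Nat.zero_le n), Finset.range_zero, Finset.sum_empty]
      positivity
  obtain ⟨g, rfl⟩ : ∃ g', g = g' + 1 := ⟨g - 1, by omega⟩
  have hhold : (natLt (.lit 0) (.reg 17)).Holds s := by simp [Test.Holds, NExp.eval, h.reg_g]
  -- Every move lowers `e + g` by one and creates children for at most `n` nodes.
  have hX : (k + 1) * (n + 1) = (n + 1) + (k - 1 + 1) * (n + 1) := by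
    obtain ⟨k, rfl⟩ : ∃ k', k = k' + 1 := ⟨k - 1, by omega⟩
    simp; ring
  have hchoice := h.choice
  obtain ⟨hbpos, hc⟩ := dpTable_cases hfeas
  obtain ⟨b, rfl⟩ : ∃ b', b = b' + 1 := ⟨b - 1, by omega⟩
  rcases hc with ⟨hc1, hc2, hc3⟩ | ⟨hc1, he, hbb, hur, hc2, hc3⟩
  · rw [hX]
    refine Ends.loop_step _ (by omega) hhold (Ends.ite (by omega)
      (fun _ => leafMove_ends h (by omega)) fun hno => ?_) fun s' hF hR => ?_
    · simp [Test.Holds, NExp.eval, hchoice, hc1] at hno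
    · obtain ⟨hR, h22, hlab, hfr, hA2, hA3⟩ := hR
      have hsum : S (g + 1) = S g + f (ch g) := by
        rw [hS _ hgn, hS g (by omega), Finset.sum_range_succ]
      refine (ih (k - 1) (by omega) e g b r s' (by omega) hR hc2).mono le_rfl ?_
      rintro s'' ⟨hfr', hH⟩
      rw [h22] at hfr' hH
      refine ⟨fun a ha => ?_, ?_⟩
      · obtain ⟨q1, q2, q3⟩ := hfr' a (by omega)
        exact ⟨q1.trans (hfr a ha), q2.trans (congrFun hA2 a), q3.trans (congrFun hA3 a)⟩
      · have := hH.leaf (by rw [(hfr' _ (Nat.lt_succ_self _)).1, hlab])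
        rw [hc3, hsum]
        simp only [Nat.add_sub_cancel]
        convert this using 1 <;> ring
  · obtain ⟨e, rfl⟩ : ∃ e', e = e' + 1 := ⟨e - 1, by omega⟩
    have heH := h.he
    have hsub : H - (e + 1) + 1 = H - e := by omega
    rw [hX]
    refine Ends.loop_step _ (by omega) hhold (Ends.ite (by omega) (fun hyes => ?_)
      fun _ => splitMove_ends h hbb hur le_rfl) fun s' hF hR => ?_
    · simp [Test.Holds, NExp.eval, hchoice, hc1] at hyes
    · obtain ⟨hR, h22, hA1, hfr, hch⟩ := hR
      refine (ih (k - 1) (by omega) e (g + 1) _ _ s' (by omega) hR hc2).mono le_rfl ?_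
      rintro s'' ⟨hfr', hH⟩
      rw [h22] at hfr' hH
      refine ⟨fun a ha => ?_, ?_⟩
      · obtain ⟨q1, q2, q3⟩ := hfr' a (by omega)
        exact ⟨q1.trans (congrFun hA1 a), q2.trans (hfr a ha).1, q3.trans (hfr a ha).2⟩
      · have := hH.split (by omega)
          -- Labels are written for leaves only; the initial `0` already marks a split node as
          -- internal.
          (fun i hi => by
            rw [(hfr' _ (by omega)).1, hA1]
            exact h.fresh _ (by omega))
          (fun i hi => by
            rw [(hfr' _ (by omega)).2.1, (hfr' _ (by omega)).2.2]
            exact hch i hi)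
        obtain ⟨ts, k1, k2, k3, k4, k5⟩ := this
        refine ⟨ts, k1, k2, k3, k4.trans ?_, k5.trans ?_⟩
        · rw [hc3, hinc _ (by omega), hsub]
          simp only [Nat.add_sub_cancel]
          ring
        -- The true cost of the split is at most one unit above its rounded cost, and `e` drops by
        -- one.
        · have h1 := hu (g + 1) (by omega) hgn (hur.trans h.hr)
          rw [Nat.cast_sub hur, ← hsub]
          push_cast
          linarith

end RealRAM

/-! ### The table competes with every admitted tree -/

/-- The depths of `T` are truncated to height `H`, or left alone if `H` already reaches the width of
the scheme. Then they are rearranged by frequency and handed to `dpTable_le_of_kraft` with the whole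
alphabet and a single root. -/
theorem BlockingScheme.dpTable_feasible {n : ℕ} (hn : 2 ≤ n) {BS : BlockingScheme} {f : Fin n → ℝ}
    (hf : ∀ c, 0 ≤ f c) {W M H V : ℕ} {δ L unit : ℝ} {S inc : ℕ → ℝ} {u : ℕ → ℕ} {ch : ℕ → Fin n}
    {π : Equiv.Perm (Fin n)} (hδ : 0 < δ) (hW : 2 * n ≤ 2 ^ W) (hW0 : 0 < W) (hM : 2 ≤ M * δ)
    (hH : H = W * (M + BS.badLevels H) ∨ BS.width BS.m ≤ H)
    (hch : ∀ k : Fin n, ch k = π k) (hsort : Monotone fun k => f (π k))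
    (hS : ∀ g ≤ n, S g = ∑ i ∈ range g, f (ch i))
    (hinc : ∀ d < H, inc d = BS.depthCost (d + 1) - BS.depthCost d) (hunit : 0 ≤ unit)
    (hu : ∀ g ≤ n, u g = 0 ∨ u g * unit < S g) (hV : (1 + δ) * L ≤ V * unit)
    {T : CodeTree (Fin n)} (hT : T.IsPrefixTree) (hfit : BS.Fits T) (hlen : T.len f ≤ L) :
    0 < (dpTable S u inc H H n 1 V).1 ∧
      (dpTable S u inc H H n 1 V).2 ≤ (1 + δ) * BS.decodeTime f T := by
  obtain ⟨ℓ, hℓH, hℓk, hℓlen, hℓcost⟩ : ∃ ℓ : Fin n → ℕ, (∀ c, ℓ c ≤ H) ∧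
      ∑ c, ((1 : ℝ) / 2) ^ ℓ c ≤ 1 ∧
      ∑ c, f c * (ℓ c : ℝ) ≤ (1 + δ) * ∑ c, f c * (T.depth c : ℝ) ∧
      ∑ c, f c * BS.depthCost (ℓ c) ≤ (1 + δ) * ∑ c, f c * BS.depthCost (T.depth c) := by
    rcases hH with hH | hH
    · refine exists_truncation hf (hT.depth_pos hn) hT.kraft BS.depthCost_mono
        BS.depthCost_nonneg hδ hW hW0 hM (hH.trans ?_)
      -- The two sides differ only in the decidability instance of the filter.
      unfold badLevels
      congr!
    · refine ⟨T.depth, fun c => (hfit c).trans hH, hT.kraft.le, ?_, ?_⟩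
      · have : 0 ≤ ∑ c, f c * (T.depth c : ℝ) :=
          Finset.sum_nonneg fun c _ => mul_nonneg (hf c) (Nat.cast_nonneg _)
        nlinarith
      · have : 0 ≤ ∑ c, f c * BS.depthCost (T.depth c) :=
          Finset.sum_nonneg fun c _ => mul_nonneg (hf c) (BS.depthCost_nonneg _)
        nlinarith
  obtain ⟨σ, hσ, hσle⟩ := exists_antitone_depths hsort fun i => ℓ (π i)
  set τ : Equiv.Perm (Fin n) := π * σ with hτ
  set ℓ' : ℕ → ℕ := fun i => if h : i < n then ℓ (τ ⟨i, h⟩) else 0 with hℓ'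
  have hℓ'val : ∀ k : Fin n, ℓ' k = ℓ (τ k) := fun k => by simp [hℓ']
  have hle : ∀ Q : ℕ → ℝ, Monotone Q →
      ∑ i ∈ range n, f (ch i) * Q (ℓ' i) ≤ ∑ c, f c * Q (ℓ c) := by
    intro Q hQ
    rw [Finset.sum_range]
    calc ∑ i : Fin n, f (ch i) * Q (ℓ' i) = ∑ i, f (π i) * Q (ℓ (π (σ i))) :=
          Finset.sum_congr rfl fun i _ => by rw [hch, hℓ'val]; rfl
      _ ≤ ∑ i, f (π i) * Q (ℓ (π i)) := hσle Q hQ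
      _ = ∑ c, f c * Q (ℓ c) := Equiv.sum_comp π fun c => f c * Q (ℓ c)
  have hmain := dpTable_le_of_kraft (S := S) (u := u) (inc := inc) (H := H)
    (φ := fun i => f (ch i)) (Q := BS.depthCost) (unit := unit) (n := n)
    (fun i _ => hf _) hS BS.depthCost_mono hinc hunit hu (H + n) H n 1 V ℓ' rfl le_rfl le_rfl
    (by omega)
    (fun i hi => by
      rw [hℓ'val ⟨i, hi⟩, Nat.sub_self]
      exact ⟨Nat.zero_le _, hℓH _⟩)
    (fun i j hij hj => by
      rw [hℓ'val ⟨i, by omega⟩, hℓ'val ⟨j, hj⟩]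
      exact hσ (show (⟨i, by omega⟩ : Fin n) ≤ ⟨j, hj⟩ from hij))
    (by
      rw [Finset.sum_range, Nat.sub_self]
      calc ∑ i : Fin n, ((1 : ℝ) / 2) ^ ℓ' i = ∑ i, ((1 : ℝ) / 2) ^ ℓ (τ i) :=
            Finset.sum_congr rfl fun i _ => by rw [hℓ'val]
        _ = ∑ c, ((1 : ℝ) / 2) ^ ℓ c := Equiv.sum_comp τ fun c => ((1 : ℝ) / 2) ^ ℓ c
        _ ≤ 1 := hℓk
        _ = _ := by simp)
    (by
      have h1 := hle (fun d => (d : ℝ)) Nat.mono_cast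
      have h2 : (1 + δ) * ∑ c, f c * (T.depth c : ℝ) ≤ (1 + δ) * L := by
        gcongr
        exact hlen
      simp only [Nat.sub_self, Nat.cast_zero, sub_zero]
      linarith)
  refine ⟨hmain.1, hmain.2.trans ?_⟩
  simp only [Nat.sub_self, BS.depthCost_zero, sub_zero]
  rw [hfit.decodeTime_eq]
  exact (hle _ BS.depthCost_mono).trans hℓcost

/-! ### Reading off the tree -/

namespace RealRAM

open Program NExp RExp Test

theorem Store.HoldsTree.congr {n : ℕ} {s s' : Store} (h : s'.natArr = s.natArr)
    {T : CodeTree (Fin n)} {p : ℕ} (hT : s.HoldsTree p T) : s'.HoldsTree p T := by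
  induction T generalizing p with
  | leaf c => simpa only [Store.HoldsTree, h] using hT
  | node l r ihl ihr =>
    obtain ⟨h1, h2, h3⟩ := hT
    refine ⟨by rw [h]; exact h1, ?_, ?_⟩
    · rw [h]; exact ihl h2
    · rw [h]; exact ihr h3

/-- Equality of the multiset of leaf labels with the whole alphabet gives at once that labels are
distinct and that none is missing. -/
theorem HoldsForest.tree {n : ℕ} {ch : ℕ → Fin n} {f : Fin n → ℝ} {Q : ℕ → ℝ} {H : ℕ} {s : Store}
    {p : ℕ} {D K : ℝ} {π : Equiv.Perm (Fin n)} (hch : ∀ k : Fin n, ch k = π k)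
    (h : HoldsForest ch f Q H s p H n 1 D K) :
    ∃ T : CodeTree (Fin n), T.IsPrefixTree ∧ s.HoldsTree p T ∧ T.height ≤ H ∧
      ∑ c, f c * Q (T.depth c) = D ∧ T.len f ≤ K := by
  obtain ⟨ts, h1, h2, h3, h4, h5⟩ := h
  have h1 := h1 0 one_pos
  have h2 := h2 0 one_pos
  simp only [Finset.sum_range_one, Nat.sub_self] at h3 h4 h5
  have hleaves : ((ts 0).leaves : Multiset (Fin n)) = (Finset.univ : Finset (Fin n)).val := by
    rw [h3, Finset.sum_range]
    calc ∑ i : Fin n, ({ch i} : Multiset (Fin n)) = ∑ i : Fin n, {π i} :=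
          Finset.sum_congr rfl fun i _ => by rw [hch]
      _ = ∑ c : Fin n, {c} := Equiv.sum_comp π fun c => ({c} : Multiset (Fin n))
      _ = _ := Finset.sum_multiset_singleton _
  have hT : (ts 0).IsPrefixTree := by
    refine ⟨?_, fun c => ?_⟩
    · rw [← Multiset.coe_nodup, hleaves]
      exact Finset.univ.nodup
    · rw [← Multiset.mem_coe, hleaves]
      exact Finset.mem_univ c
  rw [hT.leafSum_eq] at h4 h5
  exact ⟨ts 0, hT, h1, h2, h4, h5⟩

/-- Builds the tree, if the dynamic program has found one. -/
def buildPhase : Program :=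
  .seq (.seq (setNat 15 (.add (.add (.sub (.reg 15) (.reg 13)) (.reg 12)) (.reg 8))) <|
    .seq (setNat 17 (.reg 0)) <| .seq (setNat 18 (.lit 1)) <| .seq (setNat 20 (.reg 12))
      (setNat 22 (.lit 0))) <|
  .seq (.ite (natLt (.lit 0) (.get 6 (.reg 15))) buildLoop .skip) (setNat 0 (.lit 0))

theorem buildPhase_ends {s : Store} {n V H : ℕ} {u : ℕ → ℕ} {ch : ℕ → Fin n} {S inc : ℕ → ℝ}
    {f : Fin n → ℝ} {Q : ℕ → ℝ} {unit : ℝ} (hn : 1 ≤ n)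
    (hS : ∀ g ≤ n, S g = ∑ i ∈ range g, f (ch i))
    (hinc : ∀ d < H, inc d = Q (d + 1) - Q d)
    (hu : ∀ g, 0 < g → g ≤ n → u g ≤ V → S g ≤ (u g + 1) * unit)
    (h0 : s.nat 0 = n) (h8 : s.nat 8 = V) (h12 : s.nat 12 = V + 1)
    (h13 : s.nat 13 = (n + 1) * (V + 1)) (h14 : s.nat 14 = (n + 1) * ((n + 1) * (V + 1)))
    (h15 : s.nat 15 = (H + 1) * ((n + 1) * ((n + 1) * (V + 1)))) (hA5 : s.natArr 5 = u)
    (hA4 : ∀ i < n, s.natArr 4 i = ch i) (hA1 : ∀ a, s.natArr 1 a = 0)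
    (hT : TableCorrect n V (dpTable S u inc H) s ((H + 1) * ((n + 1) * ((n + 1) * (V + 1)))))
    {X : ℕ} (hX : (H + n + 1) * (n + 1) ≤ X) :
    Ends buildPhase s X (fun s' => s'.nat 0 = 0 ∧ (0 < (dpTable S u inc H H n 1 V).1 →
      HoldsForest ch f Q H s' 0 H n 1 (Q 0 * S n + (dpTable S u inc H H n 1 V).2)
        ((V + H) * max unit 0))) := by
  have hX1 : 1 ≤ X := le_trans (Nat.mul_pos (by omega) (by omega)) hX
  -- For negative `L` the unit is negative. The program must halt even then, so the accounting is
  -- done with `max unit 0`.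
  have hu' : ∀ g, 0 < g → g ≤ n → u g ≤ V → S g ≤ (u g + 1) * max unit 0 := fun g h1 h2 h3 =>
    (hu g h1 h2 h3).trans (mul_le_mul_of_nonneg_left (le_max_left _ _) (by positivity))
  -- The address of the root entry is obtained from the end of the table: back over the block with
  -- `e = H` and `g = n`, then forward to `b = 1`, `r = V`.
  have hroot : (H + 1) * ((n + 1) * ((n + 1) * (V + 1))) - (n + 1) * (V + 1) + (V + 1) + V =
      tableIndex n V H n 1 V := by
    have : (H + 1) * ((n + 1) * ((n + 1) * (V + 1))) =
        (H * (n + 1) + n) * (n + 1) * (V + 1) + (n + 1) * (V + 1) := by ring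
    rw [this, Nat.add_sub_cancel]
    unfold tableIndex
    ring
  refine Ends.straight_seq rfl hX1 (Ends.seq (fun s' => 0 < (dpTable S u inc H H n 1 V).1 →
      HoldsForest ch f Q H s' 0 H n 1 (Q 0 * S n + (dpTable S u inc H H n 1 V).2)
        ((V + H) * max unit 0)) ?_ fun s' hF h => Ends.straight rfl hX1
    ⟨by simp [effect, NExp.eval], fun hf => ?_⟩)
  · set s₁ := Program.effect _ s with hs₁
    have hB : AtBuild n V H u (dpTable S u inc H) ch s₁ H n 1 V := by
      refine ⟨?_, ?_, ?_, ?_, ?_, ?_, ?_, ?_, ?_, ?_, ?_, le_rfl, le_rfl, hn, le_rfl⟩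
      · simp [hs₁, effect, NExp.eval, h0]
      · simp [hs₁, effect, NExp.eval]
      · rw [← hroot]; simp [hs₁, effect, NExp.eval, h8, h12, h13, h15]
      · simp [hs₁, effect, NExp.eval, h12]
      · simp [hs₁, effect, h12]
      · simp [hs₁, effect, h13]
      · simp [hs₁, effect, h14]
      · simp [hs₁, effect, hA5]
      · intro i hi; simp [hs₁, effect, hA4 i hi]
      · simpa [TableCorrect, hs₁, effect] using hT
      · intro a _; simp [hs₁, effect, hA1]
    have h22 : s₁.nat 22 = 0 := by simp [hs₁, effect, NExp.eval]
    have hc := hB.choice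
    refine Ends.ite hX1 (fun hb => ?_) fun hb => Ends.straight rfl hX1 fun hf => ?_
    · simp only [Test.Holds, NExp.eval, hc] at hb
      refine (buildLoop_ends (f := f) (Q := Q) hS hinc hu' (le_max_right _ _) (H + n) H n 1 V s₁ rfl hB
        hb).mono hX ?_
      rintro s' ⟨-, hH⟩ -
      rw [h22] at hH
      simpa using hH
    · simp only [Test.Holds, NExp.eval, hc] at hb
      exact absurd hf hb
  · obtain ⟨ts, k1, k2⟩ := h hf
    refine ⟨ts, fun i hi => Store.HoldsTree.congr ?_ (k1 i hi), k2⟩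
    rfl

end RealRAM

namespace RealRAM

open Program NExp RExp Test

/-- The program: a dynamic program for the trees of small height, with rounded code lengths. -/
def codeProgram : Program :=
  .seq windowPhase <| .seq roundPhase <| .seq levelPhase <| .seq unitPhase <| .seq sortPhase <|
  .seq sumPhase <| .seq stridePhase <| .seq tablePhase buildPhase

end RealRAM

/-! ### Assembly: approximation guarantees and running time -/

namespace DecodeInput

variable (I : DecodeInput)

/-- A bound for the number of levels of the trees that are considered. -/
noncomputable def levelBound : ℕ := (Nat.log 2 I.n + 2) * (⌈2 / I.δ⌉₊ + I.BS.hierarchies)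

/-- A bound for the number of units of code length. -/
noncomputable def unitBound : ℕ := ⌈((I.levelBound : ℝ) + 1) / I.ε⌉₊

/-- A bound for the number of steps, up to a constant factor. -/
noncomputable def stepBound : ℕ := (I.levelBound + 2) * (I.n + 2) ^ 2 * (I.unitBound + 2)

/-- The cell `0` is the root of a tree with the claimed guarantees, if there is one. -/
def Solved (s : RealRAM.Store) : Prop :=
  ∀ v : ℝ, I.BS.IsDOPT I.freq I.L v →
    ∃ T : CodeTree (Fin I.n), T.IsPrefixTree ∧ I.BS.Fits T ∧ s.HoldsTree (s.nat 0) T ∧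
      T.len I.freq ≤ (1 + I.ε) * (1 + I.δ) * I.L ∧ I.BS.decodeTime I.freq T ≤ (1 + I.δ) * v

theorem le_stepBound {a b c : ℕ} (ha : a ≤ I.levelBound + 2) (hb : b ≤ (I.n + 2) ^ 2)
    (hc : c ≤ I.unitBound + 2) : a * b * c ≤ I.stepBound := by
  unfold stepBound
  gcongr

/-- The budget of `V` units covers `(1 + δ) L` and exceeds it by less than one unit; rounding adds
at most `H` more. The unit is chosen so that `H + 1` of them make up `ε (1 + δ) L`. -/
theorem solved_of_forest {s : RealRAM.Store} {W M H V : ℕ} {unit : ℝ} {S inc : ℕ → ℝ} {u : ℕ → ℕ}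
    {ch : ℕ → Fin I.n} {π : Equiv.Perm (Fin I.n)} (hW : 2 * I.n ≤ 2 ^ W) (hW0 : 0 < W)
    (hM : M = ⌈2 / I.δ⌉₊) (hHw : H ≤ I.BS.width I.BS.m)
    (hH : H = W * (M + I.BS.badLevels H) ∨ I.BS.width I.BS.m ≤ H)
    (hch : ∀ k : Fin I.n, ch k = π k) (hsort : Monotone fun k => I.freq (π k))
    (hS : ∀ g ≤ I.n, S g = ∑ i ∈ range g, I.freq (ch i))
    (hinc : ∀ d < H, inc d = I.BS.depthCost (d + 1) - I.BS.depthCost d)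
    (hunit : unit = I.ε * ((1 + I.δ) * I.L) / ((H : ℝ) + 1))
    (hV : V = ⌈((H : ℝ) + 1) / I.ε⌉₊) (hu : ∀ g ≤ I.n, u g = 0 ∨ u g * unit < S g)
    (hs0 : s.nat 0 = 0) (hs : 0 < (dpTable S u inc H H I.n 1 V).1 →
      RealRAM.HoldsForest ch I.freq I.BS.depthCost H s 0 H I.n 1
        (I.BS.depthCost 0 * S I.n + (dpTable S u inc H H I.n 1 V).2) ((V + H) * max unit 0)) :
    I.Solved s := by
  rintro v ⟨⟨T₀, hT₀, hfit₀, hlen₀, hdec₀⟩, -⟩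
  have hε := I.ε_pos
  have hδ := I.δ_pos
  -- Some tree has length at most `L`, so `L` is nonnegative and the unit is as well.
  have hL : 0 ≤ I.L := le_trans (Finset.sum_nonneg fun c _ =>
    mul_nonneg (I.freq_nonneg c) (Nat.cast_nonneg _)) hlen₀
  have hH1 : (0 : ℝ) < (H : ℝ) + 1 := by positivity
  have hunit0 : 0 ≤ unit := by rw [hunit]; positivity
  have hVle : ((H : ℝ) + 1) / I.ε ≤ V := by rw [hV]; exact Nat.le_ceil _
  have hVlt : (V : ℝ) < ((H : ℝ) + 1) / I.ε + 1 := by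
    rw [hV]; exact Nat.ceil_lt_add_one (by positivity)
  have hunitL : ((H : ℝ) + 1) / I.ε * unit = (1 + I.δ) * I.L := by
    rw [hunit]; field_simp
  have hM2 : 2 ≤ (M : ℝ) * I.δ := by
    rw [← div_le_iff₀ hδ, hM]
    exact Nat.le_ceil _
  obtain ⟨hf, hle⟩ := BlockingScheme.dpTable_feasible (V := V) (L := I.L) I.two_le_n I.freq_nonneg hδ
    hW hW0 hM2 hH hch hsort hS hinc hunit0 hu
    (by rw [← hunitL]; exact mul_le_mul_of_nonneg_right hVle hunit0) hT₀ hfit₀ hlen₀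
  obtain ⟨T, hT, hhold, hheight, hcost, hlen⟩ := (hs hf).tree hch
  have hfit : I.BS.Fits T := fun c => ((T.depth_le_height c).trans hheight).trans hHw
  refine ⟨T, hT, hfit, by rw [hs0]; exact hhold, hlen.trans ?_, ?_⟩
  · rw [max_eq_left hunit0]
    calc ((V : ℝ) + H) * unit ≤ (((H : ℝ) + 1) / I.ε + (H + 1)) * unit := by
          gcongr ?_ * unit; linarith
      _ = (1 + I.δ) * I.L + (H + 1) * unit := by rw [add_mul, hunitL]
      _ = (1 + I.ε) * (1 + I.δ) * I.L := by rw [hunit]; field_simp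
  · rw [hfit.decodeTime_eq, hcost, I.BS.depthCost_zero, zero_mul, zero_add, ← hdec₀]
    exact hle

set_option maxHeartbeats 1000000 in
open RealRAM in
theorem codeProgram_ends : Ends codeProgram I.initial I.stepBound I.Solved := by
  have hn := I.two_le_n
  have hε := I.ε_pos
  have hδ := I.δ_pos
  set M := ⌈2 / I.δ⌉₊ with hM
  set k := I.BS.hierarchies with hk
  have hk1 : 1 ≤ k := by rw [hk, BlockingScheme.hierarchies]; omega
  have hYeq : I.levelBound = (Nat.log 2 I.n + 2) * (M + k) := rfl
  have hMY : M + k ≤ I.levelBound := by rw [hYeq]; exact Nat.le_mul_of_pos_left _ (by omega)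
  -- The number of steps of each phase is bounded by a product of a number of levels, a number of
  -- pairs `(g, b)` and a number of units, with a factor `1` where one of these does not occur.
  have hX := fun a b c ha hb hc => I.le_stepBound (a := a) (b := b) (c := c) ha hb hc
  have hn2 : I.n + 2 ≤ (I.n + 2) ^ 2 := Nat.le_self_pow (by norm_num) _
  have e0 : I.initial.nat 0 = I.n := rfl
  have hsq : (I.n + 1) * (I.n + 1) ≤ (I.n + 2) ^ 2 := by nlinarith
  have hsq' : (I.n + 1) * (I.n + 1) + 1 ≤ (I.n + 2) ^ 2 := by nlinarith
  -- the window
  refine Ends.seq _ (windowPhase_ends hn (le_trans ?_ (hX 1 (I.n + 1) 1 ?_ ?_ ?_)))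
    fun s₁ F₁ hp₁ => ?_
  any_goals omega
  obtain ⟨w1, w2, w3⟩ := hp₁
  rw [e0] at w1 w3
  set W := s₁.nat 2 with hW
  have hWlog : W ≤ Nat.log 2 I.n + 2 := by
    obtain ⟨w, hw⟩ : ∃ w, W = w + 1 := ⟨W - 1, by omega⟩
    rcases Nat.eq_zero_or_pos w with h0 | hpos
    · omega
    obtain ⟨w', rfl⟩ : ∃ w', w = w' + 1 := ⟨w - 1, by omega⟩
    have : 2 ^ w' ≤ I.n := by
      rw [hw, pow_succ, pow_succ] at w3
      omega
    have := Nat.le_log_of_pow_le (by norm_num) this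
    omega
  have hWY : W * (M + k) ≤ I.levelBound := by rw [hYeq]; exact Nat.mul_le_mul_right _ hWlog
  -- the number of windows
  have e2 : s₁.real 2 = I.δ := F₁.real 2 rfl
  refine Ends.seq _ (roundPhase_ends (by rw [e2]; exact hδ) (F₁.nat 3 rfl) (F₁.nat 4 rfl)
    (le_trans ?_ (hX (M + 1) 1 1 ?_ ?_ ?_))) fun s₂ F₂ hp₂ => ?_
  any_goals rw [e2]
  any_goals omega
  obtain ⟨m1, m2⟩ := hp₂
  rw [e2] at m1
  rw [m1, ← hW] at m2
  -- the levels
  refine Ends.seq _ (levelPhase_ends (BS := I.BS) (W := W) (M := M) ((F₂.nat 1 rfl).trans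
    (F₁.nat 1 rfl)) (F₂.nat 2 rfl) m2 ((F₂.nat 5 rfl).trans (F₁.nat 5 rfl))
    ((F₂.nat 6 rfl).trans (F₁.nat 6 rfl)) ((F₂.nat 7 rfl).trans (F₁.nat 7 rfl))
    ((F₂.real 3 rfl).trans (F₁.real 3 rfl)) (fun j => ?_) (fun h hm => ?_) (fun h hm => ?_)
    (le_trans ?_ (hX (W * (M + k) + 2) 1 1 ?_ ?_ ?_))) fun s₃ F₃ hp₃ => ?_
  any_goals omega
  · rw [F₂.realArr 3 rfl, F₁.realArr 3 rfl]; simp [initial]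
  · rw [F₂.natArr 0 rfl, F₁.natArr 0 rfl]; simp [initial, hm]
  · rw [F₂.realArr 1 rfl, F₁.realArr 1 rfl]; simp [initial, hm]
  · rw [mul_one, mul_one]
  obtain ⟨l1, l2, l3, l4⟩ := hp₃
  set H := s₃.nat 4 with hH
  have hHY : H ≤ I.levelBound := l2.trans hWY
  -- the unit
  have e3 : s₃.real 1 = I.ε := (F₃.real 1 rfl).trans ((F₂.real 1 rfl).trans (F₁.real 1 rfl))
  have hVY : ⌈((H : ℝ) + 1) / I.ε⌉₊ ≤ I.unitBound := by
    refine Nat.ceil_mono ?_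
    gcongr
  refine Ends.seq _ (unitPhase_ends (by rw [e3]; exact hε)
    ((F₃.nat 8 rfl).trans ((F₂.nat 8 rfl).trans (F₁.nat 8 rfl)))
    (le_trans ?_ (hX 1 1 (I.unitBound + 1) ?_ ?_ ?_))) fun s₄ F₄ hp₄ => ?_
  any_goals rw [e3, ← hH]
  any_goals omega
  obtain ⟨v1, v2⟩ := hp₄
  rw [e3, ← hH] at v1 v2
  rw [show s₃.real 2 = I.δ from (F₃.real 2 rfl).trans ((F₂.real 2 rfl).trans (F₁.real 2 rfl)),
    show s₃.real 0 = I.L from (F₃.real 0 rfl).trans ((F₂.real 0 rfl).trans (F₁.real 0 rfl))] at v2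
  set V := s₄.nat 8 with hV
  have hVY' : V ≤ I.unitBound := v1 ▸ hVY
  -- sorting
  have e4 : s₄.nat 0 = I.n := (F₄.nat 0 rfl).trans ((F₃.nat 0 rfl).trans
    ((F₂.nat 0 rfl).trans (F₁.nat 0 rfl)))
  have a4 : s₄.realArr 0 = I.initial.realArr 0 := (F₄.realArr 0 rfl).trans
    ((F₃.realArr 0 rfl).trans ((F₂.realArr 0 rfl).trans (F₁.realArr 0 rfl)))
  refine Ends.seq _ (sortPhase_ends ((F₄.nat 9 rfl).trans ((F₃.nat 9 rfl).trans
    ((F₂.nat 9 rfl).trans (F₁.nat 9 rfl)))) (le_trans ?_ (hX 1 ((I.n + 1) * (I.n + 1)) 1 ?_ ?_ ?_)))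
    fun s₅ F₅ hsort => ?_
  any_goals rw [e4]
  any_goals omega
  rw [e4, a4] at hsort
  obtain ⟨π, hπ, hmono⟩ := exists_perm_of_rank hsort
  set ch : ℕ → Fin I.n := fun i => if h : i < I.n then π ⟨i, h⟩ else ⟨0, by omega⟩ with hch
  have hchπ : ∀ j : Fin I.n, ch j = π j := fun j => by simp [hch]
  have hfreq : ∀ c : Fin I.n, I.initial.realArr 0 c = I.freq c := fun c => by simp [initial]
  have hmono' : Monotone fun j => I.freq (π j) := fun i j hij => by
    have := hmono hij
    simpa only [hfreq] using this
  have hch5 : ∀ i < I.n, s₅.natArr 4 i = ch i := fun i hi => by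
    rw [hπ ⟨i, hi⟩, ← hchπ]
  -- sums
  have e5 : s₅.nat 0 = I.n := (F₅.nat 0 rfl).trans e4
  have e5' : s₅.nat 8 = V := F₅.nat 8 rfl
  refine Ends.seq _ (sumPhase_ends ?_ ?_ ?_
    (le_trans ?_ (hX 1 (I.n + 1) (V + 2) ?_ ?_ ?_))) fun s₆ F₆ hp₆ => ?_
  any_goals rw [e5, e5']
  any_goals omega
  · exact (F₅.nat 17 rfl).trans ((F₄.nat 17 rfl).trans ((F₃.nat 17 rfl).trans
      ((F₂.nat 17 rfl).trans (F₁.nat 17 rfl))))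
  · rw [F₅.realArr 2 rfl, F₄.realArr 2 rfl, F₃.realArr 2 rfl, F₂.realArr 2 rfl, F₁.realArr 2 rfl]
    simp [initial]
  · rw [F₅.natArr 5 rfl, F₄.natArr 5 rfl, F₃.natArr 5 rfl, F₂.natArr 5 rfl, F₁.natArr 5 rfl]
    simp [initial]
  · rw [one_mul]
  obtain ⟨t1, t2, t3⟩ := hp₆
  rw [e5, e5', F₅.real 4 rfl] at t3
  rw [e5, F₅.realArr 0 rfl, a4] at t1
  set S := s₆.realArr 2 with hS
  set u := s₆.natArr 5 with hu
  have hSsum : ∀ g ≤ I.n, S g = ∑ i ∈ range g, I.freq (ch i) := fun g hg => by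
    rw [t1 g hg]
    refine Finset.sum_congr rfl fun i hi => ?_
    rw [hch5 i (by have := Finset.mem_range.1 hi; omega), hfreq]
  have huround : ∀ g ≤ I.n, u g = 0 ∨ u g * s₄.real 4 < S g := fun g hg => by
    rcases Nat.eq_zero_or_pos g with rfl | hpos
    · exact Or.inl t2
    · exact (t3 g hpos hg).1
  -- strides
  have e6 : s₆.nat 0 = I.n := (F₆.nat 0 rfl).trans e5
  have e6' : s₆.nat 8 = V := (F₆.nat 8 rfl).trans e5'
  refine Ends.seq _ (stridePhase_ends (le_trans ?_ (hX 1 (I.n + 2) 1 ?_ ?_ ?_)))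
    fun s₇ F₇ hp₇ => ?_
  any_goals rw [e6]
  any_goals omega
  obtain ⟨g1, g2, g3⟩ := hp₇
  rw [e6'] at g1 g2 g3
  rw [e6] at g2 g3
  -- the table
  have e7 : s₇.nat 0 = I.n := (F₇.nat 0 rfl).trans e6
  have e7H : s₇.nat 4 = H := (F₇.nat 4 rfl).trans ((F₆.nat 4 rfl).trans ((F₅.nat 4 rfl).trans
    (F₄.nat 4 rfl)))
  refine Ends.seq _ (tablePhase_ends e7 g1 g2 g3 e7H
    (le_trans ?_ (hX (H + 1) ((I.n + 1) * (I.n + 1) + 1) (V + 1) ?_ ?_ ?_)))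
    fun s₈ F₈ hp₈ => ?_
  any_goals omega
  · calc (H + 1) * ((I.n + 1) * ((I.n + 1) * (V + 1))) + 1
        ≤ (H + 1) * ((I.n + 1) * ((I.n + 1) * (V + 1))) + (H + 1) * (V + 1) :=
          Nat.add_le_add_left (Nat.mul_pos (by omega) (by omega)) _
      _ = (H + 1) * ((I.n + 1) * (I.n + 1) + 1) * (V + 1) := by ring
  obtain ⟨b1, b2⟩ := hp₈
  rw [F₇.realArr 2 rfl, F₇.natArr 5 rfl, ← hS, ← hu] at b2
  set inc := s₇.realArr 3 with hinc
  have hinc3 : inc = s₃.realArr 3 := (F₇.realArr 3 rfl).trans ((F₆.realArr 3 rfl).trans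
    ((F₅.realArr 3 rfl).trans (F₄.realArr 3 rfl)))
  have hincQ : ∀ d < H, inc d = I.BS.depthCost (d + 1) - I.BS.depthCost d := by
    rw [hinc3]; exact l4
  -- the tree
  refine (buildPhase_ends (V := V) (f := I.freq) (Q := I.BS.depthCost) (unit := s₄.real 4)
    (ch := ch) (by omega : 1 ≤ I.n) hSsum hincQ
    (fun g h1 h2 h3 => (t3 g h1 h2).2 h3) ((F₈.nat 0 rfl).trans e7)
    ((F₈.nat 8 rfl).trans ((F₇.nat 8 rfl).trans e6')) ((F₈.nat 12 rfl).trans g1)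
    ((F₈.nat 13 rfl).trans g2) ((F₈.nat 14 rfl).trans g3) b1
    ((F₈.natArr 5 rfl).trans (F₇.natArr 5 rfl)) (fun i hi => ?_) (fun a => ?_) b2
    (le_trans ?_ (hX (H + 1) ((I.n + 1) * (I.n + 1)) 1 ?_ ?_ ?_))).mono le_rfl ?_
  any_goals omega
  · rw [F₈.natArr 4 rfl, F₇.natArr 4 rfl, F₆.natArr 4 rfl]; exact hch5 i hi
  · rw [F₈.natArr 1 rfl, F₇.natArr 1 rfl, F₆.natArr 1 rfl, F₅.natArr 1 rfl, F₄.natArr 1 rfl,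
      F₃.natArr 1 rfl, F₂.natArr 1 rfl, F₁.natArr 1 rfl]
    simp [initial]
  · calc (H + I.n + 1) * (I.n + 1) ≤ ((H + 1) * (I.n + 1)) * (I.n + 1) :=
          Nat.mul_le_mul_right _ (by nlinarith)
      _ = (H + 1) * ((I.n + 1) * (I.n + 1)) * 1 := by ring
  · rintro s ⟨r1, r2⟩
    exact I.solved_of_forest w1 w2 rfl l1 l3 hchπ hmono' hSsum hincQ v2 v1 huround r1 r2

/-- Additive constants are absorbed by `1 ≤ E / δ` and `1 ≤ E / ε`; only here are upper bounds on
`ε` and `δ` needed. The number of levels enters twice, directly and through the number of units,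
which explains the squares of `k`, `log n` and `1 / δ`. -/
theorem stepBound_le {E : ℝ} (hεE : I.ε ≤ E) (hδE : I.δ ≤ E) :
    (I.stepBound : ℝ) ≤ 256 * (1 + E) ^ 2 * (1 + 3 * E) * ((I.n : ℝ) ^ 2 *
      (I.BS.hierarchies : ℝ) ^ 2 * (Real.logb 2 I.n) ^ 2 / (I.ε * I.δ ^ 2)) := by
  have hε := I.ε_pos
  have hδ := I.δ_pos
  have hE : 0 < E := hε.trans_le hεE
  have hn : (2 : ℝ) ≤ I.n := by exact_mod_cast I.two_le_n
  set k : ℝ := (I.BS.hierarchies : ℝ) with hk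
  have hk1 : 1 ≤ k := by
    rw [hk, BlockingScheme.hierarchies]; push_cast
    linarith [Nat.cast_nonneg (α := ℝ) (Set.ncard {i : Fin I.BS.m |
      ∃ j : Fin I.BS.m, (j : ℕ) + 1 = (i : ℕ) ∧ I.BS.q i ≠ I.BS.q j})]
  set lg := Real.logb 2 I.n with hlg
  have hlg1 : 1 ≤ lg := by
    rw [hlg, Real.le_logb_iff_rpow_le (by norm_num) (by linarith)]
    simpa using hn
  have hlog : (Nat.log 2 I.n : ℝ) ≤ lg := by
    rw [hlg, Real.le_logb_iff_rpow_le (by norm_num) (by linarith), Real.rpow_natCast]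
    exact_mod_cast Nat.pow_log_le_self 2 (by have := I.two_le_n; omega)
  have hlk : 1 ≤ lg * k := by nlinarith
  -- A bound for the number of levels, where `8 * (1 + E)` dominates `6 * (1 + E) + 2 * E`. The
  -- final constant is `256 = 4 * 8 ^ 2`, the `4` coming from `(n + 2) ^ 2 ≤ 4 * n ^ 2`.
  set B := 8 * (1 + E) * (lg * k / I.δ) with hB
  have h1δ : 1 ≤ E / I.δ := (one_le_div hδ).2 hδE
  have h1ε : 1 ≤ E / I.ε := (one_le_div hε).2 hεE
  have hceil : (⌈2 / I.δ⌉₊ : ℝ) ≤ 2 / I.δ + 1 := (Nat.ceil_lt_add_one (by positivity)).le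
  have hY : (I.levelBound : ℝ) + 2 ≤ B := by
    unfold levelBound
    push_cast
    rw [← hk]
    have h1 : (⌈2 / I.δ⌉₊ : ℝ) + k ≤ k * (2 * (1 + E) / I.δ) := by
      have : k * (2 * (1 + E) / I.δ) = k * (2 / I.δ) + k * (2 * (E / I.δ)) := by ring
      rw [this]
      have h2 : 0 < 2 / I.δ := by positivity
      nlinarith
    have h2 : (Nat.log 2 I.n : ℝ) + 2 ≤ 3 * lg := by linarith
    have h3 : (2 : ℝ) ≤ 2 * (lg * k) * (E / I.δ) := by nlinarith
    calc ((Nat.log 2 I.n : ℝ) + 2) * (⌈2 / I.δ⌉₊ + k) + 2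
        ≤ 3 * lg * (k * (2 * (1 + E) / I.δ)) + 2 * (lg * k) * (E / I.δ) := by gcongr
      _ = (6 * (1 + E) + 2 * E) * (lg * k / I.δ) := by ring
      _ ≤ B := by
        rw [hB]
        have : 0 < lg * k / I.δ := by positivity
        nlinarith
  have hB1 : 1 ≤ B := by linarith [Nat.cast_nonneg (α := ℝ) I.levelBound]
  have hV : (I.unitBound : ℝ) + 2 ≤ (1 + 3 * E) * (B / I.ε) := by
    have h1 : (I.unitBound : ℝ) ≤ ((I.levelBound : ℝ) + 1) / I.ε + 1 :=
      (Nat.ceil_lt_add_one (by positivity)).le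
    have h2 : ((I.levelBound : ℝ) + 1) / I.ε ≤ B / I.ε := by gcongr; linarith
    have h3 : (3 : ℝ) ≤ 3 * (B * (E / I.ε)) := by nlinarith
    calc (I.unitBound : ℝ) + 2 ≤ B / I.ε + 3 * (B * (E / I.ε)) := by linarith
      _ = _ := by ring
  have hn2 : ((I.n : ℝ) + 2) ^ 2 ≤ 4 * (I.n : ℝ) ^ 2 := by nlinarith
  unfold stepBound
  push_cast
  calc ((I.levelBound : ℝ) + 2) * ((I.n : ℝ) + 2) ^ 2 * ((I.unitBound : ℝ) + 2)
      ≤ B * (4 * (I.n : ℝ) ^ 2) * ((1 + 3 * E) * (B / I.ε)) := by gcongr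
    _ = _ := by rw [hB]; field_simp; ring

end DecodeInput

theorem theorem3 :
    ∃ (p : RealRAM.Program) (time : DecodeInput → ℕ) (final : DecodeInput → RealRAM.Store),
      -- on every input, `p` halts, after `time I` time units, with the store `final I`
      (∀ I : DecodeInput, RealRAM.Runs p I.initial (time I) (final I)) ∧
      -- the integer register `0` then points to a prefix tree with the claimed guarantees
      (∀ (I : DecodeInput) (v : ℝ), I.BS.IsDOPT I.freq I.L v →
        ∃ T : CodeTree (Fin I.n), T.IsPrefixTree ∧ I.BS.Fits T ∧
          (final I).HoldsTree ((final I).nat 0) T ∧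
          T.len I.freq ≤ (1 + I.ε) * (1 + I.δ) * I.L ∧
          I.BS.decodeTime I.freq T ≤ (1 + I.δ) * v) ∧
      -- running time, for `ε` and `δ` bounded from above
      (∀ E : ℝ, ∃ C : ℝ, ∀ I : DecodeInput, I.ε ≤ E → I.δ ≤ E →
        (time I : ℝ) ≤ C * ((I.n : ℝ) ^ 2 * (I.BS.hierarchies : ℝ) ^ 2 *
          (Real.logb 2 I.n) ^ 2 / (I.ε * I.δ ^ 2))) ∧
      -- running time when the number of memory hierarchies is a constant
      (∀ (E : ℝ) (k : ℕ), ∃ C : ℝ, ∀ I : DecodeInput, I.ε ≤ E → I.δ ≤ E →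
        I.BS.hierarchies = k →
        (time I : ℝ) ≤ C * ((I.n : ℝ) ^ 2 * (Real.logb 2 I.n) ^ 2 / (I.ε * I.δ ^ 2))) := by
  choose time final hruns htime hsolved using fun I : DecodeInput => I.codeProgram_ends
  set c : ℝ := (RealRAM.codeProgram.size : ℝ) with hc
  have hbound : ∀ (E : ℝ) (I : DecodeInput), I.ε ≤ E → I.δ ≤ E →
      (time I : ℝ) ≤ c * (256 * (1 + E) ^ 2 * (1 + 3 * E)) * ((I.n : ℝ) ^ 2 *
        (I.BS.hierarchies : ℝ) ^ 2 * (Real.logb 2 I.n) ^ 2 / (I.ε * I.δ ^ 2)) := by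
    intro E I hε hδ
    calc (time I : ℝ) ≤ c * I.stepBound := by rw [hc]; exact_mod_cast htime I
      _ ≤ c * _ := mul_le_mul_of_nonneg_left (I.stepBound_le hε hδ) (Nat.cast_nonneg _)
      _ = _ := by ring
  refine ⟨RealRAM.codeProgram, time, final, hruns, fun I v hv => hsolved I v hv,
    fun E => ⟨_, fun I hε hδ => hbound E I hε hδ⟩,
    fun E k => ⟨c * (256 * (1 + E) ^ 2 * (1 + 3 * E)) * (k : ℝ) ^ 2, fun I hε hδ hk => ?_⟩⟩
  refine (hbound E I hε hδ).trans (le_of_eq ?_)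
  rw [hk]
  ring
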